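/- **Setting.** Let $C=(C_{i,j})_{i,j\in I}$ be a symmetrizable generalized Cartan matrix with $n=|I|$ and fixed positive integers $r_i$ such that $B=(r_iC_{i,j})$ is symmetric. Let $(\mathfrak h,\{\alpha_i\},\{\alpha_i^\vee\})$ be a realization of $C$ over $\mathbb Q$: $\dim\mathfrak h=2n-\operatorname{rank}C$, the $\alpha_i\in\mathfrak h^*$ and the $\alpha_i^\vee\in\mathfrak h$ are linearly independent, and $\alpha_j(\alpha_i^\vee)=C_{i,j}$. Let $q\in\mathbb C^*$ be not a root of unity, with rational powers $q^a=e^{a\hbar}$ for a fixed $\hbar$ with $q=e^\hbar$, and $q_i=q^{r_i}$. Let $\mathcal U_q(\hat{\mathfrak g})$ be the quantum affinization: the $\mathbb C$-algebra with generators $x_{i,r}^\pm$ ($r\in\mathbb Z$), $k_h$ ($h\in\mathfrak h$), $h_{i,m}$ ($m\ne0$), where $\sum_{m\ge0}\phi_{i,\pm m}^\pm z^{\pm m}=k_{\pm r_i\alpha_i^\vee}\exp\bigl(\pm(q-q^{-1})\sum_{m\ge1}h_{i,\pm m}z^{\pm m}\bigr)$, $\phi^\pm_{i,\pm m}=0$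 for $m<0$, with the relations (for $x_i^\pm(w)=\sum_r x_{i,r}^\pm w^r$, $\phi_i^{\pm}(z)=\sum_m\phi^\pm_{i,m}z^m$, $\delta(z)=\sum_{r\in\mathbb Z}z^r$, $\eta\in\{+,-\}$): the $k_h$, $h_{i,m}$ commute, $k_hk_{h'}=k_{h+h'}$, $k_0=1$, $k_hx_j^\pm(z)=q^{\pm\alpha_j(h)}x_j^\pm(z)k_h$, $$\phi_i^{\eta}(z)x_j^\pm(w)=\frac{q^{\pm B_{i,j}}w-z}{w-q^{\pm B_{i,j}}z}\,x_j^\pm(w)\phi_i^{\eta}(z)\quad\text{(expanded in } z/w \text{ for } \eta=+,\ \text{in } w/z \text{ for } \eta=-),$$ $$x_i^+(z)x_j^-(w)-x_j^-(w)x_i^+(z)=\frac{\delta_{i,j}}{q_i-q_i^{-1}}\Bigl(\delta\bigl(\tfrac wz\bigr)\phi_i^+(w)-\delta\bigl(\tfrac zw\bigr)\phi_i^-(z)\Bigr),$$ $$(w-q^{\pm B_{i,j}}z)x_i^\pm(z)x_j^\pm(w)=(q^{\pm B_{i,j}}w-z)x_j^\pm(w)x_i^\pm(z),$$ and, if $C_{i,j}C_{j,i}\le3$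 for all $i\ne j$ (but not otherwise), the affine quantum Serre relations for $i\neq j$, $s=1-C_{i,j}$: $$\sum_{\pi\in\Sigma_s}\sum_{k=0}^s(-1)^k\begin{bmatrix}s\\k\end{bmatrix}_{q_i}x_i^\pm(w_{\pi(1)})\cdots x_i^\pm(w_{\pi(k)})\,x_j^\pm(z)\,x_i^\pm(w_{\pi(k+1)})\cdots x_i^\pm(w_{\pi(s)})=0.$$ Let $\mathcal U'_q(\hat{\mathfrak g})=\mathcal U_q(\hat{\mathfrak g})\otimes\mathbb C(u)$. For a module $V$ and $\omega\in\mathfrak h^*$ put $V_\omega=\{v\mid k_hv=q^{\omega(h)}v\ \forall h\in\mathfrak h\}$. $\mathrm{Mod}(\mathcal U_q(\hat{\mathfrak g}))$ is the category of $\mathcal U_q(\hat{\mathfrak g})$-modules $V=\bigoplus_\omega V_\omega$ with all $V_\omega$ finite dimensional, such that for all $\omega,i$ one has $V_{\omega\pm r\alpha_i}=0$ for $r$ large, and whose weights lie in a finite union of cones $\lambda-\sum_i\mathbb N\alpha_i$. Such a $V$ is *$l$-highest weight* of weight $(\lambda,\Psi)$ ($\lambda(\alpha_i^\vee)\in\mathbb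 Z$, $\Psi^\pm_{i,\pm m}\in\mathbb C$, $\Psi^\pm_{i,0}=q_i^{\pm\lambda(\alpha_i^\vee)}$) if it is generated by a nonzero $v\in V_\lambda$ (an $l$-highest weight vector) with $x^+_{i,r}v=0$ and $\phi^\pm_{i,\pm m}v=\Psi^\pm_{i,\pm m}v$ for all $i\in I$, $r\in\mathbb Z$, $m\ge0$. *$(l,u)$-highest weight* $\mathcal U'_q(\hat{\mathfrak g})$-modules are defined in the same way over $\mathbb C(u)$, with $\lambda\in\mathfrak h^*$ and $\Psi^\pm_{i,\pm m}(u)\in\mathbb C[u^{\pm1}]$. Let $i(V)=V\otimes\mathbb C(u)$. The fusion $i(V)\otimes_f i(V')$ is the space $i(V)\otimes_{\mathbb C(u)}i(V')$ with the $\mathcal U'_q(\hat{\mathfrak g})$-module structure for which, on $V\otimes_{\mathbb C} V'$ and inside $(V\otimes_{\mathbb C} V')((u))$, the generators act by $$x^+_{i,r}\mapsto x^+_{i,r}\otimes1+\sum_{s\ge0}u^{r+s}\phi^-_{i,-s}\otimes x^+_{i,r+s},\qquad x^-_{i,r}\mapsto u^r\,1\otimes x^-_{i,r}+\sum_{s\ge0}u^s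 x^-_{i,r-s}\otimes\phi^+_{i,s},$$ $$\phi^\pm_{i,\pm m}\mapsto\sum_{0\le s\le m}u^{\pm s}\phi^\pm_{i,\pm(m-s)}\otimes\phi^\pm_{i,\pm s},\qquad k_h\mapsto k_h\otimes k_h .$$ **Theorem 6.2.** Let $V,V'\in\mathrm{Mod}(\mathcal U_q(\hat{\mathfrak g}))$ be $l$-highest weight modules. Then the fusion module $i(V)\otimes_f i(V')$ exists, is unique, and is an $(l,u)$-highest weight module. More precisely, if $v$ and $v'$ are $l$-highest weight vectors of $V$ and $V'$, of weights $(\lambda,\Psi)$ and $(\lambda',\Psi')$, then $v\otimes v'$ is an $(l,u)$-highest weight vector that generates $i(V)\otimes_f i(V')$, of weight $\lambda+\lambda'$ and with $\phi^\pm_{i,\pm m}$ acting on it by $\sum_{0\le s\le m}u^{\pm s}\Psi^\pm_{i,\pm(m-s)}\Psi'^\pm_{i,\pm s}$. This cyclicity fails for the usual tensor product of quantum affine algebras: for every $q\in\mathbb C^*$ that is not a root of unity there are $l$-highest weight modules $V,V'\in\mathrm{Mod}(\mathcal U_q(\hat{sl}_2))$ whose usual tensor product $V\otimes V'$ is not an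 $l$-highest weight module. Here the usual tensor product is given by the coproduct $\Delta(k_h)=k_h\otimes k_h$, $\Delta(x_j^+)=x_j^+\otimes1+k_j\otimes x_j^+$, $\Delta(x_j^-)=x_j^-\otimes k_j^{-1}+1\otimes x_j^-$ ($j=0,1$) on the Drinfeld–Jimbo generators, which in terms of the generators above (with one node) are $x_1^\pm=x^\pm_{1,0}$, $k_1=k_{\alpha^\vee}$, $k_0=k_1^{-1}$, $x_0^+=x^-_{1,1}k_1^{-1}$, $x_0^-=k_1x^+_{1,-1}$. -/

import Mathlib

open scoped TensorProduct

noncomputable section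

namespace QuantumFusion

/-! ### Cartan data -/

/-- A symmetrizable generalized Cartan matrix `C`, with a fixed symmetrizer
`D = diag (r i)`, `r i` positive integers, such that `B = D C` is symmetric. -/
structure CartanDatum (ι : Type*) where
  C : Matrix ι ι ℤ
  r : ι → ℕ
  diag : ∀ i, C i i = 2
  offDiag : ∀ i j, i ≠ j → C i j ≤ 0
  zero_iff : ∀ i j, C i j = 0 ↔ C j i = 0
  r_pos : ∀ i, 0 < r i
  symm : ∀ i j, (r i : ℤ) * C i j = (r j : ℤ) * C j i

/-- The symmetrized matrix `B = D C`. -/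
def CartanDatum.B {ι : Type*} (A : CartanDatum ι) (i j : ι) : ℤ := (A.r i : ℤ) * A.C i j

/-- A realization of the Cartan matrix in the sense of Kac, over `ℚ`: linearly independent simple
roots `α_i ∈ 𝔥*` and simple coroots `α_i^∨ ∈ 𝔥` with `α_j (α_i^∨) = C_{i,j}`, in a space `𝔥` of
dimension `2n - rank C`. -/
structure Realization {ι : Type*} [Fintype ι] (A : CartanDatum ι)
    (𝔥 : Type*) [AddCommGroup 𝔥] [Module ℚ 𝔥] where
  root : ι → Module.Dual ℚ 𝔥
  coroot : ι → 𝔥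
  root_indep : LinearIndependent ℚ root
  coroot_indep : LinearIndependent ℚ coroot
  pairing : ∀ i j, root j (coroot i) = A.C i j
  finite : Module.Finite ℚ 𝔥
  finrank_eq : Module.finrank ℚ 𝔥 + (A.C.map (Int.cast : ℤ → ℚ)).rank = 2 * Fintype.card ι

/-! ### The deformation parameter

The parameter is `q = exp ħ`; fixing `ħ` fixes the rational powers `q ^ a = exp (a ħ)`. -/

/-- The rational power `q ^ a`. -/
def qpow (ħ : ℂ) (a : ℚ) : ℂ := Complex.exp ((a : ℂ) * ħ)

/-- `q = exp ħ` is not a root of unity. -/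
def NotRootOfUnity (ħ : ℂ) : Prop := ∀ n : ℕ, 0 < n → qpow ħ 1 ^ n ≠ 1

/-- The quantum integer `[n]_Q`. -/
def qInt (Q : ℂ) (n : ℤ) : ℂ := (Q ^ n - Q ^ (-n)) / (Q - Q⁻¹)

def qFactorial (Q : ℂ) (n : ℕ) : ℂ := ∏ l ∈ Finset.range n, qInt Q (l + 1)

/-- The quantum binomial coefficient. -/
def qBinom (Q : ℂ) (n k : ℕ) : ℂ := qFactorial Q n / (qFactorial Q k * qFactorial Q (n - k))

/-! ### The quantum affinization `U_q(ĝ)` -/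

/-- Drinfeld generators. The sign `ε : ℤˣ` in `x ε i r` is `1` for `x^+_{i,r}` and `-1` for
`x^-_{i,r}`. -/
inductive Gen (ι 𝔥 : Type*) where
  | x (ε : ℤˣ) (i : ι) (r : ℤ)
  | k (a : 𝔥)
  | h (i : ι) (m : {m : ℤ // m ≠ 0})

section Algebra

variable {ι : Type*} {𝔥 : Type*}

/-- The free algebra on the Drinfeld generators. -/
abbrev FreeGen (ι 𝔥 : Type*) := FreeAlgebra ℂ (Gen ι 𝔥)

def fx (ε : ℤˣ) (i : ι) (r : ℤ) : FreeGen ι 𝔥 := FreeAlgebra.ι ℂ (Gen.x ε i r)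
def fk (a : 𝔥) : FreeGen ι 𝔥 := FreeAlgebra.ι ℂ (Gen.k a)
def fh (i : ι) (m : {m : ℤ // m ≠ 0}) : FreeGen ι 𝔥 := FreeAlgebra.ι ℂ (Gen.h i m)

/-- The series `∑_{m ≥ 1} h_{i, ε m} t ^ m`. -/
def hSeries (ε : ℤˣ) (i : ι) : PowerSeries (FreeGen ι 𝔥) :=
  PowerSeries.mk fun m => if hm : (ε : ℤ) * m ≠ 0 then fh i ⟨(ε : ℤ) * m, hm⟩ else 0

/-- The coefficient of `t ^ m` in `exp (c F)`, for a power series `F` without constant term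
(only the terms `F ^ k / k!` with `k ≤ m` contribute to it). -/
def expCoeff {R : Type*} [Ring R] [Algebra ℂ R] (c : ℂ) (F : PowerSeries R) (m : ℕ) : R :=
  ∑ k ∈ Finset.range (m + 1), (c ^ k / (Nat.factorial k : ℂ)) • PowerSeries.coeff m (F ^ k)

variable [Fintype ι] [AddCommGroup 𝔥] [Module ℚ 𝔥]
variable {A : CartanDatum ι} (R : Realization A 𝔥) (ħ : ℂ)

/-- `k_i^ε = k_{ε r_i α_i^∨}`, in the free algebra. -/
def fki (ε : ℤˣ) (i : ι) : FreeGen ι 𝔥 := fk (((ε : ℤ) * (A.r i : ℤ)) • R.coroot i)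

/-- `φ^ε_{i,n}`, `n : ℤ`, in the free algebra: the coefficient of `z ^ n` in
`k_{ε r_i α_i^∨} exp (ε (q - q⁻¹) ∑_{m ≥ 1} h_{i, ε m} z ^ (ε m))`. It vanishes when `ε n < 0`. -/
def fphi (ε : ℤˣ) (i : ι) (n : ℤ) : FreeGen ι 𝔥 :=
  if 0 ≤ (ε : ℤ) * n then
    fki R ε i * expCoeff (((ε : ℤ) : ℂ) * (qpow ħ 1 - qpow ħ (-1))) (hSeries ε i)
      ((ε : ℤ) * n).toNat
  else 0

/-- The expansion in powers of `t` of `(b - t) / (1 - b t)`. With `b = q ^ B` and `t = z / w` this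
is `(q ^ B w - z) / (w - q ^ B z)`; with `b = q ^ (-B)` and `t = w / z` it is the same rational
function. -/
def structureSeries (b : ℂ) : PowerSeries ℂ :=
  (PowerSeries.C b - PowerSeries.X) * (1 - PowerSeries.C b * PowerSeries.X)⁻¹

/-- The defining relations of the quantum affinization, obtained from the relations between
currents by taking coefficients. The affine quantum Serre relations are imposed exactly when
`C_{i,j} C_{j,i} ≤ 3` for all `i ≠ j`. -/
inductive Rel : FreeGen ι 𝔥 → FreeGen ι 𝔥 → Prop
  | k_add (a b : 𝔥) : Rel (fk a * fk b) (fk (a + b))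
  | k_zero : Rel (fk 0) 1
  | k_h (a : 𝔥) (i : ι) (m : {m : ℤ // m ≠ 0}) : Rel (fk a * fh i m) (fh i m * fk a)
  | h_h (i j : ι) (m n : {m : ℤ // m ≠ 0}) : Rel (fh i m * fh j n) (fh j n * fh i m)
  | k_x (a : 𝔥) (ε : ℤˣ) (j : ι) (r : ℤ) :
      Rel (fk a * fx ε j r) (qpow ħ ((ε : ℤ) * R.root j a) • (fx ε j r * fk a))
  /-- `φ_i^η(z) x_j^ε(w) = (q^{εB} w - z) / (w - q^{εB} z) x_j^ε(w) φ_i^η(z)`, the fraction being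
  expanded in powers of `z / w` for `η = +` and of `w / z` for `η = -`. -/
  | phi_x (η ε : ℤˣ) (i j : ι) (m : ℕ) (r : ℤ) :
      Rel (fphi R ħ η i ((η : ℤ) * m) * fx ε j r)
        (∑ s ∈ Finset.range (m + 1),
          PowerSeries.coeff s (structureSeries (qpow ħ ((η : ℤ) * (ε : ℤ) * A.B i j))) •
            (fx ε j (r + (η : ℤ) * s) * fphi R ħ η i ((η : ℤ) * (m - s))))
  | x_pm_same (i : ι) (r s : ℤ) :
      Rel (fx 1 i r * fx (-1) i s - fx (-1) i s * fx 1 i r)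
        ((qpow ħ (A.r i) - qpow ħ (-(A.r i)))⁻¹ •
          (fphi R ħ 1 i (r + s) - fphi R ħ (-1) i (r + s)))
  | x_pm_ne (i j : ι) (hij : i ≠ j) (r s : ℤ) :
      Rel (fx 1 i r * fx (-1) j s - fx (-1) j s * fx 1 i r) 0
  /-- `(w - q^{εB} z) x_i^ε(z) x_j^ε(w) = (q^{εB} w - z) x_j^ε(w) x_i^ε(z)`. -/
  | x_x (ε : ℤˣ) (i j : ι) (r s : ℤ) :
      Rel (fx ε i (r + 1) * fx ε j s -
            qpow ħ ((ε : ℤ) * A.B i j) • (fx ε i r * fx ε j (s + 1)))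
        (qpow ħ ((ε : ℤ) * A.B i j) • (fx ε j s * fx ε i (r + 1)) -
            fx ε j (s + 1) * fx ε i r)
  /-- The affine quantum Serre relations, with `s = 1 - C_{i,j}`. -/
  | serre (hC : ∀ i j, i ≠ j → A.C i j * A.C j i ≤ 3) (ε : ℤˣ) (i j : ι) (hij : i ≠ j)
      (s : ℕ) (hs : (s : ℤ) = 1 - A.C i j) (r : Fin s → ℤ) (r' : ℤ) :
      Rel (∑ π : Equiv.Perm (Fin s), ∑ k ∈ Finset.range (s + 1),
          ((-1 : ℂ) ^ k * qBinom (qpow ħ (A.r i)) s k) •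
            (((List.ofFn fun l => (fx ε i (r (π l)) : FreeGen ι 𝔥)).take k).prod * fx ε j r' *
              ((List.ofFn fun l => (fx ε i (r (π l)) : FreeGen ι 𝔥)).drop k).prod)) 0

/-- The quantum affinization `U_q(ĝ)`. -/
abbrev U := RingQuot (Rel R ħ)

/-- The generator `x^ε_{i,r}`. -/
def x (ε : ℤˣ) (i : ι) (r : ℤ) : U R ħ := RingQuot.mkAlgHom ℂ (Rel R ħ) (fx ε i r)

/-- The generator `k_a`, `a ∈ 𝔥`. -/
def k (a : 𝔥) : U R ħ := RingQuot.mkAlgHom ℂ (Rel R ħ) (fk a)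

/-- The element `φ^ε_{i,n}`; it is zero when `ε n < 0`. -/
def phi (ε : ℤˣ) (i : ι) (n : ℤ) : U R ħ := RingQuot.mkAlgHom ℂ (Rel R ħ) (fphi R ħ ε i n)

/-! ### The category `Mod(U_q(ĝ))` and `l`-highest weight modules

A `U_q(ĝ)`-module is a complex vector space `V` with an algebra morphism `ρ` to `End V`. -/

variable {R ħ} {V V' : Type*} [AddCommGroup V] [Module ℂ V] [AddCommGroup V'] [Module ℂ V']

/-- The weight space `V_ω = {v | k_a v = q ^ ω(a) v for all a ∈ 𝔥}`. -/
def weightSpace (ρ : U R ħ →ₐ[ℂ] Module.End ℂ V) (ω : Module.Dual ℚ 𝔥) : Submodule ℂ V :=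
  ⨅ a : 𝔥, LinearMap.ker (ρ (k R ħ a) - qpow ħ (ω a) • (1 : Module.End ℂ V))

/-- `μ ≤ lam` in `𝔥*`, that is, `lam - μ ∈ Q^+`. -/
def RootLE (R : Realization A 𝔥) (μ lam : Module.Dual ℚ 𝔥) : Prop :=
  ∃ c : ι → ℕ, lam - μ = ∑ i, c i • R.root i

/-- `V` is an object of `Mod(U_q(ĝ))`: it is the direct sum of its weight spaces, these are finite
dimensional, `V_{ω ± r α_i} = 0` for `r` large, and the weights lie in a finite union of cones
`{μ | μ ≤ lam}`. -/
structure IsMod (ρ : U R ħ →ₐ[ℂ] Module.End ℂ V) : Prop where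
  indep : iSupIndep (weightSpace ρ)
  iSup_eq_top : ⨆ ω, weightSpace ρ ω = ⊤
  finite : ∀ ω, Module.Finite ℂ (weightSpace ρ ω)
  integrable : ∀ ω i, ∃ N : ℕ, ∀ r : ℕ, N ≤ r →
    weightSpace ρ (ω + r • R.root i) = ⊥ ∧ weightSpace ρ (ω - r • R.root i) = ⊥
  bounded : ∃ S : Finset (Module.Dual ℚ 𝔥), ∀ ω, weightSpace ρ ω ≠ ⊥ → ∃ lam ∈ S, RootLE R ω lam

/-- `(lam, Ψ)` is an `l`-weight: `lam` is an integral weight and `Ψ^±_{i,0} = q_i^{± lam(α_i^∨)}`.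
Here `Ψ ε i m` stands for `Ψ^ε_{i, ε m}`. -/
def IsLWeight (R : Realization A 𝔥) (ħ : ℂ) (lam : Module.Dual ℚ 𝔥) (Ψ : ℤˣ → ι → ℕ → ℂ) : Prop :=
  (∀ i, ∃ n : ℤ, lam (R.coroot i) = n) ∧
    ∀ ε i, Ψ ε i 0 = qpow ħ ((ε : ℤ) * (A.r i * lam (R.coroot i)))

/-- `V` is of `l`-highest weight `(lam, Ψ)`, with `l`-highest weight vector `v`. -/
structure IsLHighestWeightVector (ρ : U R ħ →ₐ[ℂ] Module.End ℂ V)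
    (lam : Module.Dual ℚ 𝔥) (Ψ : ℤˣ → ι → ℕ → ℂ) (v : V) : Prop where
  isLWeight : IsLWeight R ħ lam Ψ
  ne_zero : v ≠ 0
  k_apply : ∀ a, ρ (k R ħ a) v = qpow ħ (lam a) • v
  generates : ∀ w, ∃ g, ρ g v = w
  x_apply : ∀ i r, ρ (x R ħ 1 i r) v = 0
  phi_apply : ∀ (ε : ℤˣ) i (m : ℕ), ρ (phi R ħ ε i ((ε : ℤ) * m)) v = Ψ ε i m • v

/-- `V` is an `l`-highest weight module. -/
def IsLHighestWeight (ρ : U R ħ →ₐ[ℂ] Module.End ℂ V) : Prop :=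
  ∃ lam Ψ v, IsLHighestWeightVector ρ lam Ψ v

/-! ### The algebra `U'_q(ĝ) = U_q(ĝ) ⊗ ℂ(u)` and `(l,u)`-highest weight modules -/

/-- The field `ℂ(u)`. -/
abbrev Cu := RatFunc ℂ

variable (R ħ) in
/-- The algebra `U'_q(ĝ) = ℂ(u) ⊗ U_q(ĝ)`. -/
abbrev U' := Cu ⊗[ℂ] U R ħ

/-- The image of `g ∈ U_q(ĝ)` in `U'_q(ĝ)`. -/
def inU' (g : U R ħ) : U' R ħ := 1 ⊗ₜ g

variable {M : Type*} [AddCommGroup M] [Module Cu M]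

/-- The inclusion `ℂ[u, u⁻¹] ⊂ ℂ(u)`. -/
def laurentToCu : LaurentPolynomial ℂ →+* Cu :=
  LaurentPolynomial.eval₂ (algebraMap ℂ Cu) (Units.mk0 RatFunc.X RatFunc.X_ne_zero)

/-- `(lam, Ψ(u))` is an `(l,u)`-weight: `lam ∈ 𝔥*`, `Ψ^±_{i,±m}(u) ∈ ℂ[u, u⁻¹]` and
`Ψ^±_{i,0}(u) = q_i^{± lam(α_i^∨)}`. -/
def IsLUWeight (R : Realization A 𝔥) (ħ : ℂ) (lam : Module.Dual ℚ 𝔥)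
    (Ψ : ℤˣ → ι → ℕ → LaurentPolynomial ℂ) : Prop :=
  ∀ ε i, Ψ ε i 0 = LaurentPolynomial.C (qpow ħ ((ε : ℤ) * (A.r i * lam (R.coroot i))))

/-- `M` is of `(l,u)`-highest weight `(lam, Ψ(u))`, with `(l,u)`-highest weight vector `v`. -/
structure IsLUHighestWeightVector (σ : U' R ħ →ₐ[Cu] Module.End Cu M)
    (lam : Module.Dual ℚ 𝔥) (Ψ : ℤˣ → ι → ℕ → LaurentPolynomial ℂ) (v : M) : Prop where
  isLUWeight : IsLUWeight R ħ lam Ψ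
  ne_zero : v ≠ 0
  k_apply : ∀ a, σ (inU' (k R ħ a)) v = algebraMap ℂ Cu (qpow ħ (lam a)) • v
  generates : ∀ w, ∃ g, σ g v = w
  x_apply : ∀ i r, σ (inU' (x R ħ 1 i r)) v = 0
  phi_apply : ∀ (ε : ℤˣ) i (m : ℕ),
    σ (inU' (phi R ħ ε i ((ε : ℤ) * m))) v = laurentToCu (Ψ ε i m) • v

/-- `M` is an `(l,u)`-highest weight module. -/
def IsLUHighestWeight (σ : U' R ħ →ₐ[Cu] Module.End Cu M) : Prop :=
  ∃ lam Ψ v, IsLUHighestWeightVector σ lam Ψ v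

/-- The functor `i`: the `U'_q(ĝ)`-module `i(V) = ℂ(u) ⊗ V` obtained by extension of scalars. -/
def extendScalars (ρ : U R ħ →ₐ[ℂ] Module.End ℂ V) : U' R ħ →ₐ[Cu] Module.End Cu (Cu ⊗[ℂ] V) :=
  Algebra.TensorProduct.lift (Algebra.ofId Cu _) ((Module.End.baseChangeHom ℂ Cu V).comp ρ)
    fun c _ => Algebra.commutes c _

/-! ### The fusion product -/

open scoped RatFunc in
/-- The expansion at `u = 0`, that is, the inclusion `ℂ(u) ⊂ ℂ((u))`. -/
def cuToLaurent : Cu →+* LaurentSeries ℂ := algebraMap (RatFunc ℂ) (LaurentSeries ℂ)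

open scoped RatFunc in
theorem cuToLaurent_smul (c : ℂ) (f : Cu) :
    cuToLaurent (c • f) = HahnSeries.C c * cuToLaurent f := by
  have h : cuToLaurent (algebraMap ℂ Cu c) = HahnSeries.C c := by
    rw [IsScalarTower.algebraMap_apply ℂ (Polynomial ℂ) Cu]
    change algebraMap (RatFunc ℂ) (LaurentSeries ℂ) (algebraMap (Polynomial ℂ) (RatFunc ℂ) _) = _
    rw [← IsScalarTower.algebraMap_apply]
    simp
  rw [Algebra.smul_def, map_mul, h]

/-- The coefficient of `u ^ n` in the expansion of a rational function in `ℂ((u))`. -/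
def uCoeff (n : ℤ) : Cu →ₗ[ℂ] ℂ where
  toFun f := HahnSeries.coeff (cuToLaurent f) n
  map_add' f g := by simp
  map_smul' c f := by simp [cuToLaurent_smul]

/-- The coefficient of `u ^ n` of an element of
`(ℂ(u) ⊗ W) ⊗_{ℂ(u)} (ℂ(u) ⊗ W') = (W ⊗ W') ⊗ ℂ(u) ⊂ (W ⊗ W')((u))`. -/
def expand (W W' : Type*) [AddCommGroup W] [Module ℂ W] [AddCommGroup W'] [Module ℂ W'] (n : ℤ) :
    (Cu ⊗[ℂ] W) ⊗[Cu] (Cu ⊗[ℂ] W') →ₗ[ℂ] W ⊗[ℂ] W' :=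
  (TensorProduct.lid ℂ (W ⊗[ℂ] W')).toLinearMap ∘ₗ
    LinearMap.rTensor (W ⊗[ℂ] W') (uCoeff n) ∘ₗ
      ((TensorProduct.AlgebraTensorModule.distribBaseChange ℂ Cu W W').symm.toLinearMap.restrictScalars ℂ)

/-- The series `∑_s f s` converges to `y` for the `u`-adic topology of `(W ⊗ W')((u))`, coefficient
by coefficient. -/
def HasUSum {W W' : Type*} [AddCommGroup W] [Module ℂ W] [AddCommGroup W'] [Module ℂ W']
    (f : ℕ → (Cu ⊗[ℂ] W) ⊗[Cu] (Cu ⊗[ℂ] W')) (y : (Cu ⊗[ℂ] W) ⊗[Cu] (Cu ⊗[ℂ] W')) : Prop :=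
  ∀ n : ℤ, (Function.support fun s => expand W W' n (f s)).Finite ∧
    ∑ᶠ s, expand W W' n (f s) = expand W W' n y

/-- The element `u ^ n` of `ℂ(u)`. -/
def uPow (n : ℤ) : Cu := RatFunc.X ^ n

/-- `σ` is the fusion module structure on `V₁ ⊗_{ℂ(u)} V₂`, where `V₁ = ℂ(u) ⊗ W` and
`V₂ = ℂ(u) ⊗ W'` are `U'_q(ĝ)`-modules by `σ₁` and `σ₂`: for `v₁ ∈ W` and `v₂ ∈ W'`,
`g (v₁ ⊗ v₂) = Δ_u(g) (v₁ ⊗ v₂)` in `(W ⊗ W')((u))`, where `Δ_u` is the deformed Drinfeld coproduct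
* `Δ_u(x^+_{i,r}) = x^+_{i,r} ⊗ 1 + ∑_{s ≥ 0} u^{r+s} φ^-_{i,-s} ⊗ x^+_{i,r+s}`,
* `Δ_u(x^-_{i,r}) = u^r 1 ⊗ x^-_{i,r} + ∑_{s ≥ 0} u^s x^-_{i,r-s} ⊗ φ^+_{i,s}`,
* `Δ_u(φ^±_{i,±m}) = ∑_{0 ≤ s ≤ m} u^{±s} φ^±_{i,±(m-s)} ⊗ φ^±_{i,±s}`,
* `Δ_u(k_a) = k_a ⊗ k_a`.
These values determine `σ`: the `h_{i,m}` are polynomials in the `φ^±_{i,n}` and `k_a`, and an element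
of `V₁ ⊗ V₂` is determined by its expansion in `u`. -/
structure IsFusion {W W' : Type*} [AddCommGroup W] [Module ℂ W] [AddCommGroup W'] [Module ℂ W']
    (σ₁ : U' R ħ →ₐ[Cu] Module.End Cu (Cu ⊗[ℂ] W))
    (σ₂ : U' R ħ →ₐ[Cu] Module.End Cu (Cu ⊗[ℂ] W'))
    (σ : U' R ħ →ₐ[Cu] Module.End Cu ((Cu ⊗[ℂ] W) ⊗[Cu] (Cu ⊗[ℂ] W'))) : Prop where
  x_plus : ∀ (i : ι) (r : ℤ) (v₁ : W) (v₂ : W'),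
    HasUSum
      (fun s => uPow (r + s) •
        ((σ₁ (inU' (phi R ħ (-1) i (-s))) (1 ⊗ₜ v₁)) ⊗ₜ[Cu]
          (σ₂ (inU' (x R ħ 1 i (r + s))) (1 ⊗ₜ v₂))))
      (σ (inU' (x R ħ 1 i r)) ((1 ⊗ₜ v₁) ⊗ₜ[Cu] (1 ⊗ₜ v₂)) -
        (σ₁ (inU' (x R ħ 1 i r)) (1 ⊗ₜ v₁)) ⊗ₜ[Cu] (1 ⊗ₜ v₂))
  x_minus : ∀ (i : ι) (r : ℤ) (v₁ : W) (v₂ : W'),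
    HasUSum
      (fun s => uPow s •
        ((σ₁ (inU' (x R ħ (-1) i (r - s))) (1 ⊗ₜ v₁)) ⊗ₜ[Cu]
          (σ₂ (inU' (phi R ħ 1 i s)) (1 ⊗ₜ v₂))))
      (σ (inU' (x R ħ (-1) i r)) ((1 ⊗ₜ v₁) ⊗ₜ[Cu] (1 ⊗ₜ v₂)) -
        uPow r • ((1 ⊗ₜ v₁) ⊗ₜ[Cu] (σ₂ (inU' (x R ħ (-1) i r)) (1 ⊗ₜ v₂))))
  phi : ∀ (ε : ℤˣ) (i : ι) (m : ℕ) (v₁ : W) (v₂ : W'),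
    σ (inU' (phi R ħ ε i ((ε : ℤ) * m))) ((1 ⊗ₜ v₁) ⊗ₜ[Cu] (1 ⊗ₜ v₂)) =
      ∑ s ∈ Finset.range (m + 1), uPow ((ε : ℤ) * s) •
        ((σ₁ (inU' (phi R ħ ε i ((ε : ℤ) * (m - s)))) (1 ⊗ₜ v₁)) ⊗ₜ[Cu]
          (σ₂ (inU' (phi R ħ ε i ((ε : ℤ) * s))) (1 ⊗ₜ v₂)))
  k : ∀ (a : 𝔥) (v₁ : W) (v₂ : W'),
    σ (inU' (k R ħ a)) ((1 ⊗ₜ v₁) ⊗ₜ[Cu] (1 ⊗ₜ v₂)) =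
      (σ₁ (inU' (k R ħ a)) (1 ⊗ₜ v₁)) ⊗ₜ[Cu] (σ₂ (inU' (k R ħ a)) (1 ⊗ₜ v₂))

/-- The pseudo-weight `∑_{0 ≤ s ≤ m} u^{±s} Ψ^±_{i,±(m-s)} Ψ'^±_{i,±s}`. -/
def fusionWeight (Ψ Ψ' : ℤˣ → ι → ℕ → ℂ) (ε : ℤˣ) (i : ι) (m : ℕ) : LaurentPolynomial ℂ :=
  ∑ s ∈ Finset.range (m + 1),
    LaurentPolynomial.C (Ψ ε i (m - s) * Ψ' ε i s) * LaurentPolynomial.T ((ε : ℤ) * s)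

end Algebra

/-! ### The quantum affine algebra `U_q(sl̂_2)` and its usual tensor product -/

/-- The Cartan datum of type `A_1`. -/
def sl2Datum : CartanDatum Unit where
  C := Matrix.of fun _ _ => 2
  r := fun _ => 1
  diag := by simp
  offDiag := by simp
  zero_iff := by simp
  r_pos := by simp
  symm := by simp

/-- The realization of the Cartan matrix `(2)` on `𝔥 = ℚ α^∨`, with `α^∨ = 1` and `α(α^∨) = 2`. -/
def sl2Realization : Realization sl2Datum ℚ where
  root := fun _ => (2 : ℚ) • LinearMap.id
  coroot := fun _ => 1
  root_indep := by
    rw [linearIndependent_unique_iff]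
    intro h
    simpa using LinearMap.congr_fun h 1
  coroot_indep := by
    rw [linearIndependent_unique_iff]
    simp
  pairing := by simp [sl2Datum]
  finite := inferInstance
  finrank_eq := by
    have h : (sl2Datum.C.map (Int.cast : ℤ → ℚ)).rank = Fintype.card Unit := by
      apply Matrix.rank_of_isUnit
      rw [Matrix.isUnit_iff_isUnit_det]
      simp [sl2Datum]
    rw [h]
    simp

/-- `U_q(sl̂_2)` in its Drinfeld realization. -/
abbrev Usl2 (ħ : ℂ) := U sl2Realization ħ

section Sl2

variable {ħ : ℂ} {V V' : Type*} [AddCommGroup V] [Module ℂ V] [AddCommGroup V'] [Module ℂ V']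

/-- The elements `k_1^{±1} = k_{±α^∨}`. -/
def k1 (ħ : ℂ) (ε : ℤˣ) : Usl2 ħ := k sl2Realization ħ (((ε : ℤ) : ℚ))

/-- The Drinfeld-Jimbo generator `x_0^+ = x^-_{1,1} k_1⁻¹` of `U_q(sl̂_2)`. The other ones are
`x_0^- = k_1 x^+_{1,-1}`, `x_1^± = x^±_{1,0}`, `k_0 = k_1⁻¹` and `k_1`. -/
def e0 (ħ : ℂ) : Usl2 ħ := x sl2Realization ħ (-1) () 1 * k1 ħ (-1)

/-- The Drinfeld-Jimbo generator `x_0^- = k_1 x^+_{1,-1}` of `U_q(sl̂_2)`. -/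
def f0 (ħ : ℂ) : Usl2 ħ := k1 ħ 1 * x sl2Realization ħ 1 () (-1)

/-- `τ` is the usual tensor product module structure on `V ⊗ V'`, given on the Drinfeld-Jimbo
generators by the coproduct `Δ(k_a) = k_a ⊗ k_a`, `Δ(x_j^+) = x_j^+ ⊗ 1 + k_j ⊗ x_j^+`,
`Δ(x_j^-) = x_j^- ⊗ k_j⁻¹ + 1 ⊗ x_j^-` (`j = 0, 1`). -/
structure IsUsualTensor (ρ : Usl2 ħ →ₐ[ℂ] Module.End ℂ V) (ρ' : Usl2 ħ →ₐ[ℂ] Module.End ℂ V')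
    (τ : Usl2 ħ →ₐ[ℂ] Module.End ℂ (V ⊗[ℂ] V')) : Prop where
  k : ∀ a, τ (k sl2Realization ħ a) =
    TensorProduct.map (ρ (k sl2Realization ħ a)) (ρ' (k sl2Realization ħ a))
  e1 : τ (x sl2Realization ħ 1 () 0) =
    TensorProduct.map (ρ (x sl2Realization ħ 1 () 0)) 1 +
      TensorProduct.map (ρ (k1 ħ 1)) (ρ' (x sl2Realization ħ 1 () 0))
  f1 : τ (x sl2Realization ħ (-1) () 0) =
    TensorProduct.map (ρ (x sl2Realization ħ (-1) () 0)) (ρ' (k1 ħ (-1))) +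
      TensorProduct.map 1 (ρ' (x sl2Realization ħ (-1) () 0))
  e0 : τ (e0 ħ) = TensorProduct.map (ρ (e0 ħ)) 1 + TensorProduct.map (ρ (k1 ħ (-1))) (ρ' (e0 ħ))
  f0 : τ (f0 ħ) = TensorProduct.map (ρ (f0 ħ)) (ρ' (k1 ħ 1)) + TensorProduct.map 1 (ρ' (f0 ħ))

end Sl2

end QuantumFusion

end

/-! Existence. The deformed Drinfeld coproduct takes values in Laurent series in u with coefficients
in U ⊗ U. All relations except Serre are checked coefficient by coefficient (`IsPreRep.delta`). For
this the exponential formula for φ is replaced by its logarithmic derivative, a Newton recursion,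
under which the relation between φ and x is equivalent to a simple commutation relation between h
and x. Composing with the actions on V and V' gives formal series of endomorphisms of V ⊗ V'. The
Serre relations are not checked on the coproduct. The series act on a space graded by total weights,
each root string has only finitely many nonzero weight spaces, and integrability alone forces the
relations (`IsPreRep.serreRel`): the zero modes by a q-sl₂ argument, the other modes by commuting
with the h's.

Rationality. On finite dimensional weight spaces the mode x_{i,n±1} is obtained from x_{i,n} by a
fixed linear operator, a multiple of ad h_{i,±1}. The coefficients of the coproduct applied to a
vector therefore satisfy linear recurrences with constant coefficients, so they are expansions of
rational functions (`IsRecurrent.exists_coeffMap_eq`). Hence the action preserves ℂ(u) ⊗ (V ⊗ V')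
inside (V ⊗ V')((u)). Uniqueness follows because expansion in u is injective and U is generated by
the x, k and φ.

Cyclicity. One follows leading coefficients in u. When r ≤ -1 the lowest term of the coproduct of
x^-_{i,r} is u^r (1 ⊗ x^-_{i,r}); when r ≥ 1 it is x^-_{i,r} ⊗ φ^+_{i,0}, with φ^+_{i,0} invertible.
The same recurrences show that V' is spanned by lowering words with all modes ≤ -1 and V by words
with all modes ≥ 1 (`IsLHighestWeightVector.span_loweringWord`). Every vector of V ⊗ V' is thus a
sum of leading coefficients of elements of the submodule generated by v ⊗ v'. On each finite
dimensional total weight space, elements of the form b_j + O(u), for a basis b_j, again form a basis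
over ℂ(u) (`one_tmul_mem_of_leading`), so the submodule is everything (`eq_top_of_fuseAct_mem`).

Failure for the usual tensor product. Take the two dimensional evaluation modules of U_q(sl̂₂) at 1
and q². Their tensor product has a stable hyperplane, and every vector killed by x^+_0 and x^+_1
lies in it, so no such vector generates. -/

open scoped TensorProduct

noncomputable section

namespace QuantumFusion

/-! ### The Euler derivation on power series over a noncommutative algebra -/

section Euler

variable {𝓑 : Type*} [Ring 𝓑] [Algebra ℂ 𝓑]

/-- The derivation `t d/dt` of power series. -/
def eulerD (F : PowerSeries 𝓑) : PowerSeries 𝓑 :=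
  PowerSeries.mk fun m => (m : ℂ) • PowerSeries.coeff m F

@[simp] theorem coeff_eulerD (F : PowerSeries 𝓑) (m : ℕ) :
    PowerSeries.coeff m (eulerD F) = (m : ℂ) • PowerSeries.coeff m F := by
  simp [eulerD]

theorem eulerD_add (F G : PowerSeries 𝓑) : eulerD (F + G) = eulerD F + eulerD G := by
  ext m; simp

theorem eulerD_sub (F G : PowerSeries 𝓑) : eulerD (F - G) = eulerD F - eulerD G := by
  ext m; rw [coeff_eulerD, map_sub, map_sub, smul_sub, coeff_eulerD, coeff_eulerD]

theorem eulerD_smul (c : ℂ) (F : PowerSeries 𝓑) : eulerD (c • F) = c • eulerD F := by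
  ext m; rw [coeff_eulerD, PowerSeries.coeff_smul, PowerSeries.coeff_smul, coeff_eulerD, smul_comm]

theorem eulerD_C (a : 𝓑) : eulerD (PowerSeries.C a) = 0 := by
  ext m
  rw [coeff_eulerD, PowerSeries.coeff_C]
  split_ifs with h <;> simp [h]

theorem eulerD_mul (F G : PowerSeries 𝓑) :
    eulerD (F * G) = eulerD F * G + F * eulerD G := by
  ext m
  rw [coeff_eulerD, map_add, PowerSeries.coeff_mul, PowerSeries.coeff_mul, PowerSeries.coeff_mul,
    ← Finset.sum_add_distrib, Finset.smul_sum]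
  refine Finset.sum_congr rfl fun p hp => ?_
  rw [Finset.HasAntidiagonal.mem_antidiagonal] at hp
  rw [coeff_eulerD, coeff_eulerD, smul_mul_assoc, mul_smul_comm, ← add_smul, ← hp]
  push_cast
  rfl

theorem eulerD_sum {α : Type*} (s : Finset α) (F : α → PowerSeries 𝓑) :
    eulerD (∑ a ∈ s, F a) = ∑ a ∈ s, eulerD (F a) := by
  ext m; simp [Finset.smul_sum]

theorem eulerD_map {𝓒 : Type*} [Ring 𝓒] [Algebra ℂ 𝓒] (f : 𝓑 →ₐ[ℂ] 𝓒) (F : PowerSeries 𝓑) :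
    eulerD (PowerSeries.map (f : 𝓑 →+* 𝓒) F) = PowerSeries.map (f : 𝓑 →+* 𝓒) (eulerD F) := by
  ext m; simp

theorem eulerD_pow_succ (F : PowerSeries 𝓑) (hF : Commute F (eulerD F)) (n : ℕ) :
    eulerD (F ^ (n + 1)) = ((n : ℂ) + 1) • (eulerD F * F ^ n) := by
  induction n with
  | zero => simp
  | succ n ih =>
    have e : F ^ (n + 1) * eulerD F = eulerD F * F ^ (n + 1) := (hF.pow_left (n + 1)).eq
    rw [pow_succ, eulerD_mul, ih, e, smul_mul_assoc, mul_assoc, ← pow_succ]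
    push_cast
    rw [add_smul ((n : ℂ) + 1), one_smul]

/-- A series without constant term is divisible by t. This is why the finite sum in `expCoeff`
computes the full exponential. -/
theorem coeff_pow_of_lt {𝓑 : Type*} [Ring 𝓑] (F : PowerSeries 𝓑) (hF : PowerSeries.coeff 0 F = 0) (k : ℕ) :
    ∀ m < k, PowerSeries.coeff m (F ^ k) = 0 := by
  induction k with
  | zero => simp
  | succ k ih =>
    intro m hm
    rw [pow_succ, PowerSeries.coeff_mul]
    refine Finset.sum_eq_zero fun p hp => ?_
    rw [Finset.HasAntidiagonal.mem_antidiagonal] at hp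
    rcases Nat.eq_zero_or_pos p.2 with h | h
    · rw [h, hF, mul_zero]
    · rw [ih p.1 (by omega), zero_mul]

/-- The exponential `exp (c F)`. -/
def expSeries (c : ℂ) (F : PowerSeries 𝓑) : PowerSeries 𝓑 := PowerSeries.mk (expCoeff c F)

theorem expCoeff_eq_sum_range (c : ℂ) (F : PowerSeries 𝓑) (hF : PowerSeries.coeff 0 F = 0)
    {m N : ℕ} (h : m < N) : expCoeff c F m =
      PowerSeries.coeff m (∑ k ∈ Finset.range N, (c ^ k / (Nat.factorial k : ℂ)) • F ^ k) := by
  rw [map_sum, expCoeff]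
  refine Finset.sum_subset_zero_on_sdiff (by simpa using h) (fun k hk => ?_) fun k _ => by simp
  simp only [Finset.mem_sdiff, Finset.mem_range, not_lt] at hk
  rw [PowerSeries.coeff_smul, coeff_pow_of_lt F hF k m (by omega), smul_zero]

theorem expCoeff_zero (c : ℂ) (F : PowerSeries 𝓑) : expCoeff c F 0 = 1 := by
  simp [expCoeff]

/-- The coefficients need not commute, and the hypothesis that F commutes with its derivative is
what gives the usual derivative of F ^ k. The identity is proved on truncated exponentials, each
coefficient seeing only finitely many terms. -/
theorem eulerD_expSeries (c : ℂ) (F : PowerSeries 𝓑) (hF : PowerSeries.coeff 0 F = 0)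
    (hc : Commute F (eulerD F)) :
    eulerD (expSeries c F) = c • (eulerD F * expSeries c F) := by
  have key : ∀ N, eulerD (∑ k ∈ Finset.range (N + 1), (c ^ k / (Nat.factorial k : ℂ)) • F ^ k) =
      c • (eulerD F * ∑ k ∈ Finset.range N, (c ^ k / (Nat.factorial k : ℂ)) • F ^ k) := by
    intro N
    have h1 : eulerD (1 : PowerSeries 𝓑) = 0 := by
      rw [← map_one PowerSeries.C, eulerD_C]
    rw [eulerD_sum, Finset.sum_range_succ', Finset.mul_sum, Finset.smul_sum, eulerD_smul, pow_zero]
    erw [h1]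
    rw [smul_zero, add_zero]
    refine Finset.sum_congr rfl fun k _ => ?_
    rw [eulerD_smul, eulerD_pow_succ F hc, smul_smul, mul_smul_comm, smul_smul]
    congr 1
    rw [Nat.factorial_succ]
    have h2 : (Nat.factorial k : ℂ) ≠ 0 := Nat.cast_ne_zero.2 (Nat.factorial_ne_zero k)
    have h3 : (k : ℂ) + 1 ≠ 0 := by exact_mod_cast Nat.succ_ne_zero k
    push_cast
    field_simp
    rw [pow_succ']
  ext m
  have e := congrArg (PowerSeries.coeff m) (key (m + 1))
  rw [coeff_eulerD, ← expCoeff_eq_sum_range c F hF (by omega)] at e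
  rw [coeff_eulerD, expSeries, PowerSeries.coeff_mk, e, PowerSeries.coeff_smul,
    PowerSeries.coeff_smul, PowerSeries.coeff_mul, PowerSeries.coeff_mul]
  congr 1
  refine Finset.sum_congr rfl fun p hp => ?_
  rw [Finset.HasAntidiagonal.mem_antidiagonal] at hp
  rw [PowerSeries.coeff_mk, expCoeff_eq_sum_range c F hF (by omega : p.2 < m + 1)]

/-- A linear differential equation `t Z' = G Z` with `G(0) = 0` has at most one solution with given
constant term. -/
theorem eq_of_eulerD_eq {G Z Z' : PowerSeries 𝓑} (hG : PowerSeries.coeff 0 G = 0)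
    (h0 : PowerSeries.coeff 0 Z = PowerSeries.coeff 0 Z') (hZ : eulerD Z = G * Z)
    (hZ' : eulerD Z' = G * Z') : Z = Z' := by
  ext m
  induction m using Nat.strong_induction_on with
  | _ m ih =>
    rcases Nat.eq_zero_or_pos m with h | h
    · rw [h, h0]
    · have e1 := congrArg (PowerSeries.coeff m) hZ
      have e2 := congrArg (PowerSeries.coeff m) hZ'
      rw [coeff_eulerD, PowerSeries.coeff_mul] at e1 e2
      have : (m : ℂ) • PowerSeries.coeff m Z = (m : ℂ) • PowerSeries.coeff m Z' := by
        rw [e1, e2]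
        refine Finset.sum_congr rfl fun p hp => ?_
        rw [Finset.HasAntidiagonal.mem_antidiagonal] at hp
        -- The only term that contains the unknown coefficient of index m has p.1 = 0, and it is
        -- killed by G(0) = 0.
        rcases Nat.eq_zero_or_pos p.1 with h1 | h1
        · rw [h1, hG, zero_mul, zero_mul]
        · rw [ih p.2 (by omega)]
      have hm : (m : ℂ) ≠ 0 := by exact_mod_cast h.ne'
      exact smul_right_injective _ hm this

theorem map_expCoeff {𝓒 : Type*} [Ring 𝓒] [Algebra ℂ 𝓒] (f : 𝓑 →ₐ[ℂ] 𝓒) (c : ℂ)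
    (F : PowerSeries 𝓑) (m : ℕ) :
    f (expCoeff c F m) = expCoeff c (PowerSeries.map (f : 𝓑 →+* 𝓒) F) m := by
  simp only [expCoeff, map_sum, map_smul]
  refine Finset.sum_congr rfl fun k _ => ?_
  rw [← map_pow, PowerSeries.coeff_map]
  rfl

theorem commute_powerSeries {𝓑 : Type*} [Ring 𝓑] {F G : PowerSeries 𝓑}
    (h : ∀ m n, Commute (PowerSeries.coeff m F) (PowerSeries.coeff n G)) : Commute F G := by
  ext m
  rw [PowerSeries.coeff_mul, PowerSeries.coeff_mul, ← Finset.Nat.sum_antidiagonal_swap]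
  exact Finset.sum_congr rfl fun p _ => (h _ _).eq

end Euler

/-- The logarithmic derivative of `κ (1 - β t) / (1 - α t)`. -/
theorem eulerD_of_linear_fractional {α β κ : ℂ} {ψ : PowerSeries ℂ}
    (h : (1 - PowerSeries.C α * PowerSeries.X) * ψ =
      PowerSeries.C κ * (1 - PowerSeries.C β * PowerSeries.X)) :
    eulerD ψ = (PowerSeries.mk fun m => α ^ m - β ^ m) * ψ := by
  have hX : eulerD (PowerSeries.X : PowerSeries ℂ) = PowerSeries.X := by
    ext m
    rw [coeff_eulerD, PowerSeries.coeff_X]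
    split_ifs with hm <;> simp [hm]
  have h1 : eulerD (1 : PowerSeries ℂ) = 0 := by rw [← map_one PowerSeries.C, eulerD_C]
  have geo : ∀ a : ℂ, (1 - PowerSeries.C a * PowerSeries.X) *
      PowerSeries.mk (fun m => a ^ m) = 1 := by
    intro a
    ext m
    rw [sub_mul, one_mul, map_sub, mul_assoc, PowerSeries.coeff_C_mul, PowerSeries.coeff_mk,
      PowerSeries.coeff_one]
    cases m with
    | zero => simp
    | succ m => rw [PowerSeries.coeff_succ_X_mul]; simp [pow_succ']
  have hd := congrArg eulerD h
  rw [eulerD_mul, eulerD_mul, eulerD_sub, eulerD_sub, eulerD_mul, eulerD_mul, eulerD_C, eulerD_C,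
    eulerD_C, h1, hX] at hd
  have hne : (1 - PowerSeries.C α * PowerSeries.X : PowerSeries ℂ) ≠ 0 := by
    intro h0
    have := geo α
    rw [h0, zero_mul] at this
    exact zero_ne_one this
  have hne' : (1 - PowerSeries.C β * PowerSeries.X : PowerSeries ℂ) ≠ 0 := by
    intro h0
    have := geo β
    rw [h0, zero_mul] at this
    exact zero_ne_one this
  have hs : (PowerSeries.mk fun m => α ^ m - β ^ m : PowerSeries ℂ) =
      PowerSeries.mk (fun m => α ^ m) - PowerSeries.mk (fun m => β ^ m) := by
    ext m; simp
  rw [hs]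
  have ga := geo α
  have gb := geo β
  set P := (PowerSeries.mk (fun m => α ^ m) : PowerSeries ℂ)
  set S := (PowerSeries.mk (fun m => β ^ m) : PowerSeries ℂ)
  set X := (PowerSeries.X : PowerSeries ℂ)
  set a := PowerSeries.C α
  set b := PowerSeries.C β
  set k := PowerSeries.C κ
  -- With both linear denominators cleared, the identity is a combination of the hypothesis, its
  -- derivative and the two geometric series.
  apply mul_left_cancel₀ hne
  apply mul_left_cancel₀ hne'
  linear_combination (1 - b * X) * hd - (1 - b * X) * ψ * ga + (1 - a * X) * ψ * gb + b * X * h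

theorem structureSeries_spec (b : ℂ) :
    (1 - PowerSeries.C b * PowerSeries.X) * structureSeries b =
      PowerSeries.C b - PowerSeries.X := by
  rw [structureSeries, mul_left_comm, PowerSeries.mul_inv_cancel, mul_one]
  simp

theorem coeff_zero_structureSeries (b : ℂ) : PowerSeries.coeff 0 (structureSeries b) = b := by
  have := congrArg (PowerSeries.coeff 0) (structureSeries_spec b)
  simpa using this

/-- The structure function is b (1 - b⁻¹ t) / (1 - b t), whose logarithmic derivative has
coefficients b^m - b^{-m}. These are the constants of the commutator of h and x. -/
theorem eulerD_structureSeries {b : ℂ} (hb : b ≠ 0) :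
    eulerD (structureSeries b) =
      (PowerSeries.mk fun m => b ^ m - b⁻¹ ^ m) * structureSeries b := by
  refine eulerD_of_linear_fractional (κ := b) ?_
  rw [structureSeries_spec, mul_sub, mul_one, ← mul_assoc, ← map_mul, mul_inv_cancel₀ hb, map_one,
    one_mul]

/-! ### Powers of `q` -/

theorem qpow_add (ħ : ℂ) (a b : ℚ) : qpow ħ (a + b) = qpow ħ a * qpow ħ b := by
  simp only [qpow, ← Complex.exp_add]
  push_cast
  ring_nf

theorem qpow_zero (ħ : ℂ) : qpow ħ 0 = 1 := by simp [qpow]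

theorem qpow_ne_zero (ħ : ℂ) (a : ℚ) : qpow ħ a ≠ 0 := Complex.exp_ne_zero _

theorem qpow_neg (ħ : ℂ) (a : ℚ) : qpow ħ (-a) = (qpow ħ a)⁻¹ := by
  rw [← mul_eq_one_iff_eq_inv₀ (qpow_ne_zero ħ a), ← qpow_add, neg_add_cancel, qpow_zero]

theorem qpow_sub (ħ : ℂ) (a b : ℚ) : qpow ħ (a - b) = qpow ħ a * (qpow ħ b)⁻¹ := by
  rw [sub_eq_add_neg, qpow_add, qpow_neg]

theorem qpow_nat_mul (ħ : ℂ) (n : ℕ) (a : ℚ) : qpow ħ (n * a) = qpow ħ a ^ n := by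
  induction n with
  | zero => simp [qpow_zero]
  | succ n ih => rw [pow_succ, ← ih, ← qpow_add]; congr 1; push_cast; ring

/-- Raising q^a to the denominator of a gives an integral power of q, so rational powers reduce to
the hypothesis on integral ones. -/
theorem NotRootOfUnity.qpow_ne_one {ħ : ℂ} (hq : NotRootOfUnity ħ) {a : ℚ} (ha : a ≠ 0) :
    qpow ħ a ≠ 1 := by
  intro h
  have h1 : qpow ħ ((a.den : ℚ) * a) = 1 := by rw [qpow_nat_mul, h, one_pow]
  rw [Rat.den_mul_eq_num] at h1
  have h2 : a.num ≠ 0 := Rat.num_ne_zero.2 ha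
  refine hq a.num.natAbs (Int.natAbs_pos.2 h2) ?_
  rw [← qpow_nat_mul, mul_one]
  rcases Int.natAbs_eq a.num with h3 | h3
  · rw [h3] at h1
    simpa using h1
  · rw [h3] at h1
    rw [show ((a.num.natAbs : ℚ)) = -(((-(a.num.natAbs : ℤ) : ℤ)) : ℚ) by simp, qpow_neg, h1,
      inv_one]

theorem NotRootOfUnity.qpow_injective {ħ : ℂ} (hq : NotRootOfUnity ħ) :
    Function.Injective (qpow ħ) := by
  intro a b h
  by_contra hab
  refine hq.qpow_ne_one (sub_ne_zero.2 hab) ?_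
  rw [qpow_sub, h, mul_inv_cancel₀ (qpow_ne_zero ħ b)]

/-! ### The relations of the quantum affinization in logarithmic form -/

section

variable {ι : Type*} [Fintype ι] {𝔥 : Type*} [AddCommGroup 𝔥] [Module ℚ 𝔥]
  {A : CartanDatum ι} {R : Realization A 𝔥} {ħ : ℂ} {𝓑 : Type*} [Ring 𝓑] [Algebra ℂ 𝓑]

/-- The constant `± (q - q⁻¹)` of the exponential formula for `φ^±`. -/
def hConst (ħ : ℂ) (η : ℤˣ) : ℂ := ((η : ℤ) : ℂ) * (qpow ħ 1 - qpow ħ (-1))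

theorem hConst_ne_zero (hq : NotRootOfUnity ħ) (η : ℤˣ) : hConst ħ η ≠ 0 := by
  refine mul_ne_zero (by rcases Int.units_eq_one_or η with h | h <;> simp [h]) ?_
  rw [sub_ne_zero]
  intro h
  have := hq.qpow_injective h
  norm_num at this

/-- The power series `∑_m f (η m) t ^ m`. -/
def halfSeries (f : ℤ → 𝓑) (η : ℤˣ) : PowerSeries 𝓑 := PowerSeries.mk fun m => f ((η : ℤ) * m)

@[simp] theorem coeff_halfSeries {𝓑 : Type*} [Ring 𝓑] (f : ℤ → 𝓑) (η : ℤˣ) (m : ℕ) :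
    PowerSeries.coeff m (halfSeries f η) = f ((η : ℤ) * m) := by simp [halfSeries]

variable (R ħ) in
/-- The relations of the quantum affinization between the images of the generators in an algebra,
except the Serre relations. The relation between `φ` and `h` is replaced by its logarithmic
derivative, and the one between `φ` and `x` by the one between `h` and `x`. -/
structure IsPreRep (X : ℤˣ → ι → ℤ → 𝓑) (K : 𝔥 → 𝓑) (H : ι → ℤ → 𝓑) (P : ℤˣ → ι → ℤ → 𝓑) :
    Prop where
  k_add : ∀ a b, K a * K b = K (a + b)
  k_zero : K 0 = 1
  k_h : ∀ a i m, K a * H i m = H i m * K a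
  h_h : ∀ i j m n, H i m * H j n = H j n * H i m
  k_x : ∀ a (ε : ℤˣ) j r, K a * X ε j r = qpow ħ ((ε : ℤ) * R.root j a) • (X ε j r * K a)
  phi_zero : ∀ (ε : ℤˣ) i, P ε i 0 = K (((ε : ℤ) * (A.r i : ℤ)) • R.coroot i)
  phi_neg : ∀ (ε : ℤˣ) i n, (ε : ℤ) * n < 0 → P ε i n = 0
  newton : ∀ (ε : ℤˣ) i, eulerD (halfSeries (P ε i) ε) =
    hConst ħ ε • (eulerD (halfSeries (H i) ε) * halfSeries (P ε i) ε)
  h_x : ∀ (η ε : ℤˣ) i j (m : ℕ) r,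
    (hConst ħ η * m) • (H i ((η : ℤ) * m) * X ε j r - X ε j r * H i ((η : ℤ) * m)) =
      (qpow ħ ((η : ℤ) * (ε : ℤ) * A.B i j) ^ m - (qpow ħ ((η : ℤ) * (ε : ℤ) * A.B i j))⁻¹ ^ m) •
        X ε j (r + (η : ℤ) * m)
  x_pm_same : ∀ i r s, X 1 i r * X (-1) i s - X (-1) i s * X 1 i r =
    (qpow ħ (A.r i) - qpow ħ (-(A.r i)))⁻¹ • (P 1 i (r + s) - P (-1) i (r + s))
  x_pm_ne : ∀ i j, i ≠ j → ∀ r s, X 1 i r * X (-1) j s - X (-1) j s * X 1 i r = 0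
  x_x : ∀ (ε : ℤˣ) i j r s,
    X ε i (r + 1) * X ε j s - qpow ħ ((ε : ℤ) * A.B i j) • (X ε i r * X ε j (s + 1)) =
      qpow ħ ((ε : ℤ) * A.B i j) • (X ε j s * X ε i (r + 1)) - X ε j (s + 1) * X ε i r

/-- The Serre relations. -/
def SerreRel (A : CartanDatum ι) (ħ : ℂ) (X : ℤˣ → ι → ℤ → 𝓑) : Prop :=
  ∀ (ε : ℤˣ) (i j : ι), i ≠ j → ∀ s : ℕ, (s : ℤ) = 1 - A.C i j → ∀ (r : Fin s → ℤ) (r' : ℤ),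
    ∑ π : Equiv.Perm (Fin s), ∑ k ∈ Finset.range (s + 1),
      ((-1 : ℂ) ^ k * qBinom (qpow ħ (A.r i)) s k) •
        (((List.ofFn fun l => X ε i (r (π l))).take k).prod * X ε j r' *
          ((List.ofFn fun l => X ε i (r (π l))).drop k).prod) = 0

namespace IsPreRep

variable {X : ℤˣ → ι → ℤ → 𝓑} {K : 𝔥 → 𝓑} {H : ι → ℤ → 𝓑} {P : ℤˣ → ι → ℤ → 𝓑}

section

variable (h : IsPreRep R ħ X K H P)
include h

theorem k_mul_neg (a : 𝔥) : K a * K (-a) = 1 := by rw [h.k_add, add_neg_cancel, h.k_zero]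

theorem k_neg_mul (a : 𝔥) : K (-a) * K a = 1 := by rw [h.k_add, neg_add_cancel, h.k_zero]

/-- What commutes with `k` and `h` commutes with `φ`. -/
theorem commute_phi {y : 𝓑} (hk : ∀ a, Commute y (K a)) (hh : ∀ i m, Commute y (H i m))
    (ε : ℤˣ) (i : ι) (n : ℤ) : Commute y (P ε i n) := by
  rcases lt_or_ge ((ε : ℤ) * n) 0 with hn | hn
  · rw [h.phi_neg ε i n hn]; exact Commute.zero_right y
  obtain ⟨m, hm⟩ := Int.eq_ofNat_of_zero_le hn
  have hn' : n = (ε : ℤ) * m := by rw [← hm, ← mul_assoc, ← Units.val_mul, Int.units_mul_self]; simp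
  subst hn'
  clear hn hm
  induction m using Nat.strong_induction_on with
  | _ m ih =>
    rcases Nat.eq_zero_or_pos m with hm | hm
    · subst hm
      simpa [h.phi_zero] using hk _
    -- The Newton recursion writes m φ_m as a combination of products h_p φ_{m-p} with p ≥ 1.
    · have e := congrArg (PowerSeries.coeff m) (h.newton ε i)
      rw [coeff_eulerD, PowerSeries.coeff_smul, PowerSeries.coeff_mul] at e
      have hm' : (m : ℂ) ≠ 0 := by exact_mod_cast hm.ne'
      rw [coeff_halfSeries] at e
      have e2 : P ε i ((ε : ℤ) * m) = (m : ℂ)⁻¹ • ((m : ℂ) • P ε i ((ε : ℤ) * m)) := by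
        rw [smul_smul, inv_mul_cancel₀ hm', one_smul]
      rw [e2, e]
      refine Commute.smul_right (Commute.smul_right (Commute.sum_right _ _ _ fun p hp => ?_) _) _
      rw [Finset.HasAntidiagonal.mem_antidiagonal] at hp
      rw [coeff_eulerD, coeff_halfSeries, coeff_halfSeries]
      rcases Nat.eq_zero_or_pos p.1 with h1 | h1
      · rw [h1]; simp
      · exact ((hh _ _).smul_right _).mul_right (ih p.2 (by omega))

theorem h_phi (i : ι) (m : ℤ) (ε : ℤˣ) (j : ι) (n : ℤ) : Commute (H i m) (P ε j n) :=
  h.commute_phi (fun a => (h.k_h a i m).symm) (fun _ _ => h.h_h _ _ _ _) _ _ _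

theorem k_phi (a : 𝔥) (ε : ℤˣ) (j : ι) (n : ℤ) : Commute (K a) (P ε j n) :=
  h.commute_phi (fun b => by rw [commute_iff_eq, h.k_add, h.k_add, add_comm])
    (fun _ _ => h.k_h _ _ _) _ _ _

theorem phi_phi (ε : ℤˣ) (i : ι) (m : ℤ) (η : ℤˣ) (j : ι) (n : ℤ) :
    Commute (P ε i m) (P η j n) :=
  h.commute_phi (fun _ => (h.k_phi _ _ _ _).symm) (fun _ _ => (h.h_phi _ _ _ _ _).symm) _ _ _

theorem phi_zero_x (η ε : ℤˣ) (i j : ι) (r : ℤ) :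
    P η i 0 * X ε j r = qpow ħ ((η : ℤ) * (ε : ℤ) * A.B i j) • (X ε j r * P η i 0) := by
  rw [h.phi_zero, h.k_x]
  congr 2
  rw [map_zsmul, R.pairing, CartanDatum.B]
  simp only [zsmul_eq_mul]
  push_cast
  ring

/-- The relation between `φ` and `x`, in terms of power series. -/
theorem halfSeries_phi_mul_C (η ε : ℤˣ) (i j : ι) (r : ℤ) :
    halfSeries (P η i) η * PowerSeries.C (X ε j r) =
      (PowerSeries.mk fun s : ℕ =>
        PowerSeries.coeff s (structureSeries (qpow ħ ((η : ℤ) * (ε : ℤ) * A.B i j))) •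
          X ε j (r + (η : ℤ) * s)) * halfSeries (P η i) η := by
  set b := qpow ħ ((η : ℤ) * (ε : ℤ) * A.B i j) with hb
  set Y : PowerSeries 𝓑 := PowerSeries.mk fun s : ℕ =>
        PowerSeries.coeff s (structureSeries b) • X ε j (r + (η : ℤ) * s) with hY
  set G := hConst ħ η • eulerD (halfSeries (H i) η) with hG
  have hn : eulerD (halfSeries (P η i) η) = G * halfSeries (P η i) η := by
    rw [h.newton, hG, smul_mul_assoc]
  -- Coefficientwise, the relation between h and x says that Y has derivative [G, Y]. Hence φ x and
  -- Y φ solve the same equation Z' = G Z, with the same constant term.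
  have hYG : eulerD Y + Y * G = G * Y := by
    rw [← sub_eq_zero, sub_eq_add_neg, add_assoc, ← sub_eq_add_neg, ← neg_sub (G * Y),
      ← sub_eq_add_neg, sub_eq_zero]
    ext m
    rw [map_sub, PowerSeries.coeff_mul, PowerSeries.coeff_mul,
      ← Finset.Nat.sum_antidiagonal_swap (n := m), ← Finset.sum_sub_distrib, coeff_eulerD, hY,
      PowerSeries.coeff_mk, smul_smul, ← smul_eq_mul, ← coeff_eulerD,
      eulerD_structureSeries (qpow_ne_zero _ _), PowerSeries.coeff_mul, Finset.sum_smul,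
      ← Finset.Nat.sum_antidiagonal_swap (n := m)]
    refine Finset.sum_congr rfl fun p hp => ?_
    rw [Finset.HasAntidiagonal.mem_antidiagonal] at hp
    have e := h.h_x η ε i j p.2 (r + (η : ℤ) * p.1)
    rw [← hb, add_assoc, ← mul_add, ← Nat.cast_add, hp] at e
    simp only [Prod.fst_swap, Prod.snd_swap, PowerSeries.coeff_mk, hG, PowerSeries.coeff_smul,
      coeff_eulerD, coeff_halfSeries, smul_mul_assoc, mul_smul_comm, smul_smul]
    rw [mul_comm, ← smul_smul, ← e, smul_smul, smul_sub]
    congr 2 <;> ring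
  refine eq_of_eulerD_eq (G := G) (by simp [hG]) ?_ ?_ ?_
  · have hc : PowerSeries.constantCoeff (structureSeries b) = b := by
      simpa using coeff_zero_structureSeries b
    have e := h.phi_zero_x η ε i j r
    rw [← hb] at e
    simp [PowerSeries.coeff_mul, hY, hc, e]
  · rw [eulerD_mul, eulerD_C, mul_zero, add_zero, hn, mul_assoc]
  · rw [eulerD_mul, hn, ← mul_assoc, ← mul_assoc, ← add_mul, hYG]

theorem phi_x (η ε : ℤˣ) (i j : ι) (m : ℕ) (r : ℤ) :
    P η i ((η : ℤ) * m) * X ε j r =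
      ∑ s ∈ Finset.range (m + 1),
        PowerSeries.coeff s (structureSeries (qpow ħ ((η : ℤ) * (ε : ℤ) * A.B i j))) •
          (X ε j (r + (η : ℤ) * s) * P η i ((η : ℤ) * (m - s))) := by
  have e := congrArg (PowerSeries.coeff m) (h.halfSeries_phi_mul_C η ε i j r)
  rw [PowerSeries.coeff_mul_C, coeff_halfSeries, PowerSeries.coeff_mul,
    Finset.Nat.sum_antidiagonal_eq_sum_range_succ_mk] at e
  rw [e]
  refine Finset.sum_congr rfl fun s hs => ?_
  have hs' : s ≤ m := by simpa [Nat.lt_succ_iff] using hs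
  rw [PowerSeries.coeff_mk, coeff_halfSeries, smul_mul_assoc, Nat.cast_sub hs']

end

omit [Fintype ι] in
/-- The relation between `h` and `x` follows from the one between `φ` and `x`. -/
theorem h_x_of_phi_x (η ε : ℤˣ) (i j : ι)
    (hn : eulerD (halfSeries (P η i) η) =
      hConst ħ η • (eulerD (halfSeries (H i) η) * halfSeries (P η i) η))
    {k' : 𝓑} (hk : P η i 0 * k' = 1)
    (hphi : ∀ (m : ℕ) r, P η i ((η : ℤ) * m) * X ε j r =
      ∑ s ∈ Finset.range (m + 1),
        PowerSeries.coeff s (structureSeries (qpow ħ ((η : ℤ) * (ε : ℤ) * A.B i j))) •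
          (X ε j (r + (η : ℤ) * s) * P η i ((η : ℤ) * (m - s)))) (m : ℕ) (r : ℤ) :
    (hConst ħ η * m) • (H i ((η : ℤ) * m) * X ε j r - X ε j r * H i ((η : ℤ) * m)) =
      (qpow ħ ((η : ℤ) * (ε : ℤ) * A.B i j) ^ m - (qpow ħ ((η : ℤ) * (ε : ℤ) * A.B i j))⁻¹ ^ m) •
        X ε j (r + (η : ℤ) * m) := by
  set b := qpow ħ ((η : ℤ) * (ε : ℤ) * A.B i j) with hb
  have hb0 : b ≠ 0 := qpow_ne_zero _ _
  set Y : ℤ → PowerSeries 𝓑 := fun r => PowerSeries.mk fun s : ℕ =>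
        PowerSeries.coeff s (structureSeries b) • X ε j (r + (η : ℤ) * s) with hY
  have hser : ∀ r, halfSeries (P η i) η * PowerSeries.C (X ε j r) =
      Y r * halfSeries (P η i) η := by
    intro r
    ext m
    rw [PowerSeries.coeff_mul_C, coeff_halfSeries, PowerSeries.coeff_mul,
      Finset.Nat.sum_antidiagonal_eq_sum_range_succ_mk, hphi]
    refine Finset.sum_congr rfl fun s hs => ?_
    have hs' : s ≤ m := by simpa [Nat.lt_succ_iff] using hs
    rw [hY, PowerSeries.coeff_mk, coeff_halfSeries, smul_mul_assoc, Nat.cast_sub hs']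
  set G := hConst ħ η • eulerD (halfSeries (H i) η) with hG
  have hn' : eulerD (halfSeries (P η i) η) = G * halfSeries (P η i) η := by
    rw [hn, hG, smul_mul_assoc]
  -- The constant term of φ has the right inverse k', so φ can be cancelled on the right, from the
  -- lowest coefficient upwards.
  have cancel : ∀ Z : PowerSeries 𝓑, Z * halfSeries (P η i) η = 0 → Z = 0 := by
    intro Z hZ
    ext m
    induction m using Nat.strong_induction_on with
    | _ m ih =>
      have e := congrArg (PowerSeries.coeff m) hZ
      rw [PowerSeries.coeff_mul, map_zero, Finset.sum_eq_single (m, 0)] at e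
      · have e2 := congrArg (· * k') e
        simpa [mul_assoc, hk] using e2
      · intro p hp hne
        rw [Finset.HasAntidiagonal.mem_antidiagonal] at hp
        have : p.1 < m := by
          rcases p with ⟨p1, p2⟩
          simp only [ne_eq, Prod.mk.injEq, not_and] at hne hp ⊢
          by_contra hlt
          exact hne (by omega) (by omega)
        rw [ih _ this, map_zero, zero_mul]
      · intro hne
        exact absurd (by simp) hne
  have hYG : ∀ r, eulerD (Y r) = G * Y r - Y r * G := by
    intro r
    have e := congrArg eulerD (hser r)
    rw [eulerD_mul, eulerD_mul, eulerD_C, mul_zero, add_zero, hn', mul_assoc, hser,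
      ← mul_assoc, ← mul_assoc, ← add_mul] at e
    rw [← sub_eq_zero]
    apply cancel
    rw [sub_mul, sub_mul, e, add_mul]
    abel
  have hsum : ∀ m r, ∑ p ∈ Finset.HasAntidiagonal.antidiagonal m,
      PowerSeries.coeff p.2 (structureSeries b) •
        ((hConst ħ η * p.1) • (H i ((η : ℤ) * p.1) * X ε j (r + (η : ℤ) * p.2) -
          X ε j (r + (η : ℤ) * p.2) * H i ((η : ℤ) * p.1)) -
            (b ^ p.1 - b⁻¹ ^ p.1) • X ε j (r + (η : ℤ) * p.2 + (η : ℤ) * p.1)) = 0 := by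
    intro m r
    have e := congrArg (PowerSeries.coeff m) (hYG r)
    rw [map_sub, PowerSeries.coeff_mul, PowerSeries.coeff_mul,
      ← Finset.Nat.sum_antidiagonal_swap (n := m) (f := fun p : ℕ × ℕ =>
        PowerSeries.coeff p.1 (Y r) * PowerSeries.coeff p.2 G), ← Finset.sum_sub_distrib,
      coeff_eulerD, hY, PowerSeries.coeff_mk, smul_smul, ← smul_eq_mul, ← coeff_eulerD,
      eulerD_structureSeries hb0, PowerSeries.coeff_mul, Finset.sum_smul, eq_comm,
      ← sub_eq_zero, ← Finset.sum_sub_distrib] at e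
    rw [← e]
    refine Finset.sum_congr rfl fun p hp => ?_
    rw [Finset.HasAntidiagonal.mem_antidiagonal] at hp
    have e2 : (r + (η : ℤ) * p.2 + (η : ℤ) * p.1) = r + (η : ℤ) * m := by
      rw [← hp]; push_cast; ring
    rw [e2]
    simp only [Prod.fst_swap, Prod.snd_swap, PowerSeries.coeff_mk, hG, PowerSeries.coeff_smul,
      coeff_eulerD, coeff_halfSeries, smul_mul_assoc, mul_smul_comm, smul_smul, smul_sub]
    congr 1
    · congr 2 <;> ring
    · congr 1; ring
  suffices hs : ∀ m r, (hConst ħ η * (m : ℕ)) • (H i ((η : ℤ) * m) * X ε j r -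
          X ε j r * H i ((η : ℤ) * m)) - (b ^ m - b⁻¹ ^ m) • X ε j (r + (η : ℤ) * m) = 0 by
    exact sub_eq_zero.1 (hs m r)
  intro m
  induction m using Nat.strong_induction_on with
  | _ m ih =>
    intro r
    have e := hsum m r
    -- All terms with p.1 < m vanish by induction. The remaining one carries the constant term b of
    -- the structure series, which is nonzero.
    rw [Finset.sum_eq_single (m, 0)] at e
    · rw [coeff_zero_structureSeries, Nat.cast_zero, mul_zero, add_zero] at e
      exact (smul_eq_zero_iff_right hb0).1 e
    · intro p hp hne
      rw [Finset.HasAntidiagonal.mem_antidiagonal] at hp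
      have : p.1 < m := by
        rcases p with ⟨p1, p2⟩
        simp only [ne_eq, Prod.mk.injEq, not_and] at hne hp ⊢
        by_contra hlt
        exact hne (by omega) (by omega)
      rw [ih _ this, smul_zero]
    · intro hne
      exact absurd (by simp) hne

end IsPreRep

end

/-! ### Generators and universal property of the quantum affinization -/

section

variable {ι : Type*} [Fintype ι] {𝔥 : Type*} [AddCommGroup 𝔥] [Module ℚ 𝔥]
  {A : CartanDatum ι} {R : Realization A 𝔥} {ħ : ℂ} {𝓑 : Type*} [Ring 𝓑] [Algebra ℂ 𝓑]

theorem exists_eq_units_mul_nat (ε : ℤˣ) {n : ℤ} (hn : 0 ≤ (ε : ℤ) * n) :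
    n = (ε : ℤ) * (((ε : ℤ) * n).toNat : ℕ) := by
  rw [Int.toNat_of_nonneg hn, ← mul_assoc, ← Units.val_mul, Int.units_mul_self]
  simp

theorem units_mul_units_mul (ε : ℤˣ) (n : ℤ) : (ε : ℤ) * ((ε : ℤ) * n) = n := by
  rw [← mul_assoc, ← Units.val_mul, Int.units_mul_self]
  simp

variable (R ħ) in
/-- The generator `h_{i,m}`, and `0` for `m = 0`. -/
def hU (i : ι) (m : ℤ) : U R ħ :=
  if hm : m ≠ 0 then RingQuot.mkAlgHom ℂ (Rel R ħ) (fh i ⟨m, hm⟩) else 0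

/-- The exponential formula, in logarithmic form. -/
theorem eulerD_C_mul_expSeries {H : ℤ → 𝓑} {F : PowerSeries 𝓑} {κ : 𝓑} {c : ℂ} (η : ℤˣ)
    (hF0 : PowerSeries.coeff 0 F = 0)
    (hF : ∀ m : ℕ, m ≠ 0 → PowerSeries.coeff m F = H ((η : ℤ) * m))
    (hH : ∀ m n, H m * H n = H n * H m) (hκ : ∀ m, κ * H m = H m * κ) :
    eulerD (PowerSeries.C κ * expSeries c F) =
      c • (eulerD (halfSeries H η) * (PowerSeries.C κ * expSeries c F)) := by
  have e : eulerD F = eulerD (halfSeries H η) := by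
    ext m
    rw [coeff_eulerD, coeff_eulerD, coeff_halfSeries]
    rcases eq_or_ne m 0 with h | h
    · simp [h]
    · rw [hF m h]
  have hc : Commute F (eulerD F) := by
    refine commute_powerSeries fun m n => ?_
    rw [coeff_eulerD]
    refine Commute.smul_right ?_ _
    rcases eq_or_ne m 0 with h | h
    · rw [h, hF0]; exact Commute.zero_left _
    rcases eq_or_ne n 0 with h' | h'
    · rw [h', hF0]; exact Commute.zero_right _
    rw [hF m h, hF n h']
    exact hH _ _
  have hc2 : Commute (PowerSeries.C κ) (eulerD (halfSeries H η)) := by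
    refine commute_powerSeries fun m n => ?_
    rw [PowerSeries.coeff_C]
    split_ifs
    · rw [coeff_eulerD, coeff_halfSeries]
      exact Commute.smul_right (hκ _) _
    · exact Commute.zero_left _
  rw [eulerD_mul, eulerD_C, zero_mul, zero_add, eulerD_expSeries c F hF0 hc, mul_smul_comm, e,
    ← mul_assoc, ← mul_assoc, hc2.eq]

theorem U.rel {a b : FreeGen ι 𝔥} (h : Rel R ħ a b) :
    RingQuot.mkAlgHom ℂ (Rel R ħ) a = RingQuot.mkAlgHom ℂ (Rel R ħ) b :=
  RingQuot.mkAlgHom_rel ℂ h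

theorem phi_eq_of_nonneg (ε : ℤˣ) (i : ι) (m : ℕ) : phi R ħ ε i ((ε : ℤ) * m) =
    k R ħ (((ε : ℤ) * (A.r i : ℤ)) • R.coroot i) * expCoeff (hConst ħ ε)
      (PowerSeries.map (RingQuot.mkAlgHom ℂ (Rel R ħ) : FreeGen ι 𝔥 →+* U R ħ) (hSeries ε i)) m := by
  rw [phi, fphi, units_mul_units_mul, if_pos (by positivity), map_mul, map_expCoeff,
    Int.toNat_natCast]
  rfl

theorem U.k_h (a : 𝔥) (i : ι) (m : ℤ) : k R ħ a * hU R ħ i m = hU R ħ i m * k R ħ a := by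
  unfold hU
  split_ifs with hm
  · rw [k, ← map_mul, U.rel (Rel.k_h a i ⟨m, hm⟩), map_mul]
  · simp

theorem U.h_h (i j : ι) (m n : ℤ) : hU R ħ i m * hU R ħ j n = hU R ħ j n * hU R ħ i m := by
  unfold hU
  split_ifs with hm hn
  · rw [← map_mul, U.rel (Rel.h_h i j ⟨m, hm⟩ ⟨n, hn⟩), map_mul]
  all_goals simp

theorem U.newton (ε : ℤˣ) (i : ι) : eulerD (halfSeries (phi R ħ ε i) ε) =
    hConst ħ ε • (eulerD (halfSeries (hU R ħ i) ε) * halfSeries (phi R ħ ε i) ε) := by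
  have e : halfSeries (phi R ħ ε i) ε =
      PowerSeries.C (k R ħ (((ε : ℤ) * (A.r i : ℤ)) • R.coroot i)) * expSeries (hConst ħ ε)
      (PowerSeries.map (RingQuot.mkAlgHom ℂ (Rel R ħ) : FreeGen ι 𝔥 →+* U R ħ) (hSeries ε i)) := by
    ext m
    rw [coeff_halfSeries, phi_eq_of_nonneg, PowerSeries.coeff_C_mul, expSeries,
      PowerSeries.coeff_mk]
  rw [e]
  refine eulerD_C_mul_expSeries ε ?_ (fun m hm => ?_) (fun _ _ => U.h_h _ _ _ _)
    (fun _ => U.k_h _ _ _)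
  · simp [hSeries]
  · have hm' : (ε : ℤ) * m ≠ 0 := by simp [hm]
    rw [PowerSeries.coeff_map, hSeries, PowerSeries.coeff_mk, dif_pos hm', hU, dif_pos hm']
    rfl

theorem phi_zero_eq (ε : ℤˣ) (i : ι) :
    phi R ħ ε i 0 = k R ħ (((ε : ℤ) * (A.r i : ℤ)) • R.coroot i) := by
  have := phi_eq_of_nonneg (R := R) (ħ := ħ) ε i 0
  rw [expCoeff_zero, mul_one] at this
  simpa using this

theorem phi_eq_zero (ε : ℤˣ) (i : ι) (n : ℤ) (hn : (ε : ℤ) * n < 0) : phi R ħ ε i n = 0 := by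
  rw [phi, fphi, if_neg (not_le.2 hn), map_zero]

theorem U.k_add (a b : 𝔥) : k R ħ a * k R ħ b = k R ħ (a + b) := by
  rw [k, k, ← map_mul, U.rel (Rel.k_add a b)]; rfl

theorem U.k_zero : k R ħ 0 = 1 := by
  rw [k, U.rel Rel.k_zero, map_one]

variable (R ħ) in
/-- The generators of the quantum affinization satisfy its relations. -/
theorem isPreRep_U : IsPreRep R ħ (x R ħ) (k R ħ) (hU R ħ) (phi R ħ) where
  k_add := U.k_add
  k_zero := U.k_zero
  k_h := U.k_h
  h_h := U.h_h
  k_x a ε j r := by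
    rw [x, k, ← map_mul, U.rel (Rel.k_x a ε j r), map_smul, map_mul]
  phi_zero := phi_zero_eq
  phi_neg := phi_eq_zero
  newton := U.newton
  h_x η ε i j m r := by
    refine IsPreRep.h_x_of_phi_x η ε i j (U.newton η i)
      (k' := k R ħ (-(((η : ℤ) * (A.r i : ℤ)) • R.coroot i))) ?_ (fun m r => ?_) m r
    · rw [phi_zero_eq, U.k_add, add_neg_cancel, U.k_zero]
    · rw [phi, x, ← map_mul, U.rel (Rel.phi_x η ε i j m r), map_sum]
      simp only [map_smul, map_mul]
      rfl
  x_pm_same i r s := by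
    simp only [x, phi, ← map_mul, ← map_sub, U.rel (Rel.x_pm_same (R := R) (ħ := ħ) i r s), map_smul]
  x_pm_ne i j hij r s := by
    simp only [x, ← map_mul, ← map_sub, U.rel (Rel.x_pm_ne (R := R) (ħ := ħ) i j hij r s), map_zero]
  x_x ε i j r s := by
    simp only [x, ← map_mul, ← map_sub, ← map_smul, U.rel (Rel.x_x (R := R) (ħ := ħ) ε i j r s)]

theorem IsPreRep.map {𝓒 : Type*} [Ring 𝓒] [Algebra ℂ 𝓒] {X : ℤˣ → ι → ℤ → 𝓑} {K : 𝔥 → 𝓑}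
    {H : ι → ℤ → 𝓑} {P : ℤˣ → ι → ℤ → 𝓑} (h : IsPreRep R ħ X K H P) (f : 𝓑 →ₐ[ℂ] 𝓒) :
    IsPreRep R ħ (fun ε i r => f (X ε i r)) (fun a => f (K a)) (fun i m => f (H i m))
      (fun ε i n => f (P ε i n)) where
  k_add a b := by rw [← map_mul, h.k_add]
  k_zero := by rw [h.k_zero, map_one]
  k_h a i m := by rw [← map_mul, h.k_h, map_mul]
  h_h i j m n := by rw [← map_mul, h.h_h, map_mul]
  k_x a ε j r := by rw [← map_mul, h.k_x, map_smul, map_mul]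
  phi_zero ε i := by rw [h.phi_zero]
  phi_neg ε i n hn := by rw [h.phi_neg ε i n hn, map_zero]
  newton ε i := by
    have e1 : halfSeries (fun n => f (P ε i n)) ε =
        PowerSeries.map (f : 𝓑 →+* 𝓒) (halfSeries (P ε i) ε) := by ext; simp
    have e2 : halfSeries (fun n => f (H i n)) ε =
        PowerSeries.map (f : 𝓑 →+* 𝓒) (halfSeries (H i) ε) := by ext; simp
    rw [e1, e2, eulerD_map, h.newton, eulerD_map, ← map_mul]
    ext m
    rw [PowerSeries.coeff_map, PowerSeries.coeff_smul, PowerSeries.coeff_smul,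
      PowerSeries.coeff_map]
    exact map_smul f _ _
  h_x η ε i j m r := by
    rw [← map_mul, ← map_mul, ← map_sub, ← map_smul, h.h_x, map_smul]
  x_pm_same i r s := by
    rw [← map_mul, ← map_mul, ← map_sub, h.x_pm_same, map_smul, map_sub]
  x_pm_ne i j hij r s := by
    rw [← map_mul, ← map_mul, ← map_sub, h.x_pm_ne i j hij, map_zero]
  x_x ε i j r s := by
    simp only [← map_mul, ← map_sub, ← map_smul, h.x_x]

section Lift

variable {X : ℤˣ → ι → ℤ → 𝓑} {K : 𝔥 → 𝓑} {H : ι → ℤ → 𝓑} {P : ℤˣ → ι → ℤ → 𝓑}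

/-- The morphism from the free algebra with given values on the generators. -/
def freeLift (X : ℤˣ → ι → ℤ → 𝓑) (K : 𝔥 → 𝓑) (H : ι → ℤ → 𝓑) : FreeGen ι 𝔥 →ₐ[ℂ] 𝓑 :=
  FreeAlgebra.lift ℂ fun g => match g with
    | .x ε i r => X ε i r
    | .k a => K a
    | .h i m => H i m

omit [Fintype ι] [AddCommGroup 𝔥] [Module ℚ 𝔥] in
@[simp] theorem freeLift_fx (ε : ℤˣ) (i : ι) (r : ℤ) :
    freeLift X K H (fx ε i r) = X ε i r := by simp [freeLift, fx]

omit [Fintype ι] [AddCommGroup 𝔥] [Module ℚ 𝔥] in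
@[simp] theorem freeLift_fk (a : 𝔥) : freeLift X K H (fk a) = K a := by simp [freeLift, fk]

omit [Fintype ι] [AddCommGroup 𝔥] [Module ℚ 𝔥] in
@[simp] theorem freeLift_fh (i : ι) (m : {m : ℤ // m ≠ 0}) :
    freeLift X K H (fh i m) = H i m := by simp [freeLift, fh]

/-- The image of the exponential formula and the given series P satisfy the same Newton equation
with the same constant term, so they agree. This recovers the exponential definition of φ from the
logarithmic relations. -/
theorem IsPreRep.freeLift_fphi (h : IsPreRep R ħ X K H P) (ε : ℤˣ) (i : ι) (n : ℤ) :
    freeLift X K H (fphi R ħ ε i n) = P ε i n := by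
  rw [fphi]
  split_ifs with hn
  swap
  · rw [map_zero, h.phi_neg ε i n (not_le.1 hn)]
  conv_rhs => rw [exists_eq_units_mul_nat ε hn]
  set m := ((ε : ℤ) * n).toNat
  rw [map_mul, map_expCoeff, fki, freeLift_fk]
  set F := PowerSeries.map ((freeLift X K H : FreeGen ι 𝔥 →ₐ[ℂ] 𝓑) : FreeGen ι 𝔥 →+* 𝓑)
    (hSeries ε i) with hF
  have hF0 : PowerSeries.coeff 0 F = 0 := by simp [hF, hSeries]
  have e : PowerSeries.C (K (((ε : ℤ) * (A.r i : ℤ)) • R.coroot i)) * expSeries (hConst ħ ε) F =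
      halfSeries (P ε i) ε := by
    refine eq_of_eulerD_eq (G := hConst ħ ε • eulerD (halfSeries (H i) ε)) (by simp) ?_ ?_ ?_
    · rw [PowerSeries.coeff_C_mul, expSeries, PowerSeries.coeff_mk, expCoeff_zero, mul_one,
        coeff_halfSeries, Nat.cast_zero, mul_zero, h.phi_zero]
    · rw [smul_mul_assoc]
      refine eulerD_C_mul_expSeries ε hF0 (fun m hm => ?_) (fun _ _ => h.h_h _ _ _ _)
        (fun _ => h.k_h _ _ _)
      simp [hF, hSeries, hm, RingHom.coe_coe]
    · rw [smul_mul_assoc, h.newton]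
  have e2 := congrArg (PowerSeries.coeff m) e
  rw [PowerSeries.coeff_C_mul, expSeries, PowerSeries.coeff_mk, coeff_halfSeries] at e2
  exact e2

/-- `SerreRel` is stated for every Cartan matrix, so it provides the Serre relations in all the
cases where they are imposed. -/
theorem IsPreRep.freeLift_rel (h : IsPreRep R ħ X K H P) (hs : SerreRel A ħ X)
    ⦃a b : FreeGen ι 𝔥⦄ (hab : Rel R ħ a b) : freeLift X K H a = freeLift X K H b := by
  cases hab with
  | k_add a b => simp [h.k_add]
  | k_zero => simp [h.k_zero]
  | k_h a i m => simp [h.k_h]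
  | h_h i j m n => simp [h.h_h]
  | k_x a ε j r => simp [h.k_x]
  | phi_x η ε i j m r => simp [h.freeLift_fphi, h.phi_x]
  | x_pm_same i r s => simp [h.freeLift_fphi, h.x_pm_same]
  | x_pm_ne i j hij r s => simp [h.x_pm_ne i j hij]
  | x_x ε i j r s => simp [h.x_x]
  | serre hC ε i j hij s hs' r r' =>
    simpa [map_list_prod, List.map_take, List.map_drop, List.map_ofFn, Function.comp_def]
      using hs ε i j hij s hs' r r'

/-- The morphism from the quantum affinization given by elements satisfying its relations. -/
def IsPreRep.lift (h : IsPreRep R ħ X K H P) (hs : SerreRel A ħ X) : U R ħ →ₐ[ℂ] 𝓑 :=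
  RingQuot.liftAlgHom ℂ ⟨freeLift X K H, h.freeLift_rel hs⟩

variable (h : IsPreRep R ħ X K H P) (hs : SerreRel A ħ X)

@[simp] theorem IsPreRep.lift_x (ε : ℤˣ) (i : ι) (r : ℤ) : h.lift hs (x R ħ ε i r) = X ε i r := by
  simp [lift, x]

@[simp] theorem IsPreRep.lift_k (a : 𝔥) : h.lift hs (k R ħ a) = K a := by
  simp [lift, k]

@[simp] theorem IsPreRep.lift_phi (ε : ℤˣ) (i : ι) (n : ℤ) :
    h.lift hs (phi R ħ ε i n) = P ε i n := by
  simp [lift, phi, h.freeLift_fphi]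

end Lift

/-- The quantum affinization is generated by the `x^±_{i,r}`, the `k_a` and the `φ^±_{i,n}`. -/
theorem U.subalgebra_eq_top (hq : NotRootOfUnity ħ) (S : Subalgebra ℂ (U R ħ))
    (hx : ∀ ε i r, x R ħ ε i r ∈ S) (hk : ∀ a, k R ħ a ∈ S) (hphi : ∀ ε i n, phi R ħ ε i n ∈ S) :
    S = ⊤ := by
  have hh : ∀ (η : ℤˣ) i (m : ℕ), hU R ħ i ((η : ℤ) * m) ∈ S := by
    intro η i m
    induction m using Nat.strong_induction_on with
    | _ m ih =>
      rcases Nat.eq_zero_or_pos m with h | hm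
      · subst h
        simp [hU, zero_mem]
      -- The coefficient of index m isolates h_m φ_0 in terms of φ_m and of h_p with p < m. Since
      -- φ_0 is an invertible k and the constant is nonzero, h_m is recovered by induction.
      have e := congrArg (PowerSeries.coeff m) (U.newton (R := R) (ħ := ħ) η i)
      rw [PowerSeries.coeff_smul, PowerSeries.coeff_mul, coeff_eulerD,
        ← Finset.add_sum_erase _ _ (show ((m, 0) : ℕ × ℕ) ∈ _ by simp)] at e
      simp only [coeff_eulerD, coeff_halfSeries, Nat.cast_zero, mul_zero] at e
      set T := ∑ p ∈ (Finset.HasAntidiagonal.antidiagonal m).erase (m, 0),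
        (p.1 : ℂ) • hU R ħ i ((η : ℤ) * p.1) * phi R ħ η i ((η : ℤ) * p.2) with hT
      have hTS : T ∈ S := by
        refine sum_mem fun p hp => ?_
        rw [Finset.mem_erase, Finset.HasAntidiagonal.mem_antidiagonal] at hp
        have : p.1 < m := by
          rcases p with ⟨p1, p2⟩
          simp only [ne_eq, Prod.mk.injEq, not_and] at hp ⊢
          by_contra hlt
          exact hp.1 (by omega) (by omega)
        exact mul_mem (S.smul_mem (ih _ this) _) (hphi _ _ _)
      have hc : hConst ħ η * m ≠ 0 :=
        mul_ne_zero (hConst_ne_zero hq η) (by exact_mod_cast hm.ne')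
      have e3 : (hConst ħ η * m) • (hU R ħ i ((η : ℤ) * m) * phi R ħ η i 0) =
          (m : ℂ) • phi R ħ η i ((η : ℤ) * m) - hConst ħ η • T := by
        rw [e, smul_add, add_sub_cancel_right, smul_mul_assoc, smul_smul]
      have e4 : hU R ħ i ((η : ℤ) * m) = ((hConst ħ η * m)⁻¹ •
          ((hConst ħ η * m) • (hU R ħ i ((η : ℤ) * m) * phi R ħ η i 0))) *
            k R ħ (-(((η : ℤ) * (A.r i : ℤ)) • R.coroot i)) := by
        rw [smul_smul, inv_mul_cancel₀ hc, one_smul, mul_assoc, phi_zero_eq, U.k_add,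
          add_neg_cancel, U.k_zero, mul_one]
      rw [e4, e3]
      exact mul_mem (S.smul_mem (sub_mem (S.smul_mem (hphi _ _ _) _) (S.smul_mem hTS _)) _) (hk _)
  rw [eq_top_iff]
  rintro g -
  obtain ⟨a, rfl⟩ := RingQuot.mkAlgHom_surjective ℂ (Rel R ħ) g
  induction a using FreeAlgebra.induction with
  | grade0 r =>
    rw [AlgHom.commutes]
    exact S.algebraMap_mem r
  | grade1 g =>
    cases g with
    | x ε i r => exact hx ε i r
    | k a => exact hk a
    | h i m =>
      rcases lt_or_gt_of_ne m.2 with hm | hm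
      · have := hh (-1) i m.1.natAbs
        have e : ((-1 : ℤˣ) : ℤ) * (m.1.natAbs : ℤ) = m.1 := by
          rw [Int.natCast_natAbs, abs_of_neg hm]; simp
        rw [e, hU, dif_pos m.2] at this
        exact this
      · have := hh 1 i m.1.natAbs
        have e : ((1 : ℤˣ) : ℤ) * (m.1.natAbs : ℤ) = m.1 := by
          rw [Int.natCast_natAbs, abs_of_pos hm]; simp
        rw [e, hU, dif_pos m.2] at this
        exact this
  | mul a b ha hb => rw [map_mul]; exact mul_mem ha hb
  | add a b ha hb => rw [map_add]; exact add_mem ha hb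

theorem U.algHom_ext' (hq : NotRootOfUnity ħ) {f g : U R ħ →ₐ[ℂ] 𝓑}
    (hx : ∀ ε i r, f (x R ħ ε i r) = g (x R ħ ε i r)) (hk : ∀ a, f (k R ħ a) = g (k R ħ a))
    (hphi : ∀ ε i n, f (phi R ħ ε i n) = g (phi R ħ ε i n)) : f = g := by
  have h := U.subalgebra_eq_top hq (AlgHom.equalizer f g) hx hk hphi
  ext1
  ext y
  have : RingQuot.mkAlgHom ℂ (Rel R ħ) (FreeAlgebra.ι ℂ y) ∈ AlgHom.equalizer f g := by
    rw [h]; trivial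
  exact this

end

/-! ### Quantum integers and binomial coefficients -/

section QInt

variable {Q : ℂ}

theorem qInt_ne_zero (hQ0 : Q ≠ 0) (hQ : ∀ n : ℕ, 0 < n → Q ^ n ≠ 1) {n : ℤ} (hn : n ≠ 0) :
    qInt Q n ≠ 0 := by
  have key : ∀ m : ℤ, m ≠ 0 → Q ^ m - Q ^ (-m) ≠ 0 := by
    intro m hm h
    rw [sub_eq_zero] at h
    have h2 : Q ^ (2 * m) = 1 := by
      rw [two_mul, zpow_add₀ hQ0]
      nth_rw 1 [h]
      rw [← zpow_add₀ hQ0, neg_add_cancel, zpow_zero]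
    have h3 : Q ^ ((2 * m).natAbs) = 1 := by
      rcases Int.natAbs_eq (2 * m) with h4 | h4
      · rw [h4, zpow_natCast] at h2; exact h2
      · rw [h4, zpow_neg, zpow_natCast, inv_eq_one] at h2; exact h2
    exact hQ _ (by omega) h3
  refine div_ne_zero (key n hn) ?_
  simpa using key 1 one_ne_zero

theorem qFactorial_ne_zero (hQ0 : Q ≠ 0) (hQ : ∀ n : ℕ, 0 < n → Q ^ n ≠ 1) (n : ℕ) :
    qFactorial Q n ≠ 0 :=
  Finset.prod_ne_zero_iff.2 fun l _ => qInt_ne_zero hQ0 hQ (by omega)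

theorem qFactorial_succ (n : ℕ) : qFactorial Q (n + 1) = qFactorial Q n * qInt Q (n + 1) :=
  Finset.prod_range_succ _ _

theorem qBinom_zero_right (hQ0 : Q ≠ 0) (hQ : ∀ n : ℕ, 0 < n → Q ^ n ≠ 1) (n : ℕ) :
    qBinom Q n 0 = 1 := by
  rw [qBinom, Nat.sub_zero, show qFactorial Q 0 = 1 from Finset.prod_range_zero _, one_mul,
    div_self (qFactorial_ne_zero hQ0 hQ n)]

theorem qBinom_symm {n k : ℕ} (hk : k ≤ n) : qBinom Q n (n - k) = qBinom Q n k := by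
  rw [qBinom, qBinom, Nat.sub_sub_self hk, mul_comm]

theorem qBinom_self (hQ0 : Q ≠ 0) (hQ : ∀ n : ℕ, 0 < n → Q ^ n ≠ 1) (n : ℕ) :
    qBinom Q n n = 1 := by
  rw [← Nat.sub_zero n, Nat.sub_zero n, ← qBinom_symm le_rfl, Nat.sub_self,
    qBinom_zero_right hQ0 hQ]

theorem qInt_add (hQ0 : Q ≠ 0) (m n : ℤ) :
    qInt Q (m + n) = Q ^ n * qInt Q m + Q ^ (-m) * qInt Q n := by
  simp only [qInt, neg_add, zpow_add₀ hQ0, zpow_neg]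
  field_simp
  ring

/-- The `q`-Pascal rule. -/
theorem qBinom_succ (hQ0 : Q ≠ 0) (hQ : ∀ n : ℕ, 0 < n → Q ^ n ≠ 1) {n k : ℕ} (hk : k < n) :
    qBinom Q (n + 1) (k + 1) = Q ^ ((k : ℤ) + 1) * qBinom Q n (k + 1) +
      Q ^ ((k : ℤ) - n) * qBinom Q n k := by
  obtain ⟨d, rfl⟩ : ∃ d, n = k + d + 1 := ⟨n - k - 1, by omega⟩
  have e := qInt_add hQ0 ((d : ℤ) + 1) ((k : ℤ) + 1)
  simp only [qBinom]
  rw [show k + d + 1 + 1 - (k + 1) = d + 1 by omega, show k + d + 1 - (k + 1) = d by omega,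
    show k + d + 1 - k = d + 1 by omega, qFactorial_succ (k + d + 1), qFactorial_succ k,
    qFactorial_succ d]
  have e1 : (((k + d + 1 : ℕ) : ℤ) + 1) = (d : ℤ) + 1 + (k + 1) := by push_cast; ring
  have e2 : ((k : ℤ) - ((k + d + 1 : ℕ) : ℤ)) = -((d : ℤ) + 1) := by push_cast; ring
  rw [e1, e, e2]
  have h1 := qFactorial_ne_zero hQ0 hQ k
  have h2 := qFactorial_ne_zero hQ0 hQ d
  have h3 : qInt Q ((k : ℤ) + 1) ≠ 0 := qInt_ne_zero hQ0 hQ (by omega)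
  have h4 : qInt Q ((d : ℤ) + 1) ≠ 0 := qInt_ne_zero hQ0 hQ (by omega)
  generalize qInt Q ((k : ℤ) + 1) = u at *
  generalize qInt Q ((d : ℤ) + 1) = v at *
  generalize Q ^ ((k : ℤ) + 1) = s at *
  generalize Q ^ (-((d : ℤ) + 1)) = t at *
  field_simp

end QInt

/-! ### Iterated `q`-commutators -/

section QComm

variable {𝓑 : Type*} [Ring 𝓑] [Algebra ℂ 𝓑]

/-- The iterated `q`-commutator `(ad_q f)^n (y)`. -/
def qAd (Q : ℂ) (a : ℤ) (f y : 𝓑) : ℕ → 𝓑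
  | 0 => y
  | n + 1 => f * qAd Q a f y n - Q ^ (a - 2 * n) • (qAd Q a f y n * f)

variable {Q : ℂ} {a : ℤ} {e f y L L' : 𝓑}

/-- Here a is the weight of y for L, and f lowers weights by 2. So the scalar Q^(a - 2n) in the
definition of `qAd` is the weight of the n-th commutator. -/
theorem qAd_weight (hQ0 : Q ≠ 0) (hf : L * f = Q ^ (-2 : ℤ) • (f * L)) (hy : L * y = Q ^ a • (y * L))
    (n : ℕ) : L * qAd Q a f y n = Q ^ (a - 2 * n) • (qAd Q a f y n * L) := by
  induction n with
  | zero => simpa [qAd] using hy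
  | succ n ih =>
    have e : a - 2 * ((n + 1 : ℕ) : ℤ) = (a - 2 * n) + (-2) := by push_cast; ring
    rw [qAd, mul_sub, ← mul_assoc, hf, smul_mul_assoc, mul_assoc, ih, mul_smul_comm, mul_smul_comm,
      ← mul_assoc L, ih, smul_mul_assoc, mul_assoc _ L, hf, mul_smul_comm, sub_mul, smul_sub,
      smul_mul_assoc, e, zpow_add₀ hQ0]
    simp only [smul_smul, mul_assoc]
    congr 2
    · ring
    · ring

/-- The commutators (ad_q f)^n y behave like the vectors f^n applied to a highest weight vector of
weight a: commuting with e plays the role of being killed by e. The factor [a - n] vanishes at n =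
a. When Q is not a root of unity it vanishes nowhere else, so beyond a one can descend from n + 1 to
n. -/
theorem qAd_comm (hQ0 : Q ≠ 0) (hQ1 : Q - Q⁻¹ ≠ 0)
    (hLL : L * L' = 1) (hLL' : L' * L = 1)
    (hef : e * f - f * e = (Q - Q⁻¹)⁻¹ • (L - L'))
    (hf : L * f = Q ^ (-2 : ℤ) • (f * L)) (hy : L * y = Q ^ a • (y * L)) (hey : e * y = y * e)
    (n : ℕ) : e * qAd Q a f y (n + 1) - qAd Q a f y (n + 1) * e =
      (qInt Q (n + 1) * qInt Q (a - n)) • (qAd Q a f y n * L') := by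
  have hw := qAd_weight hQ0 hf hy
  have hw' : ∀ n, L' * qAd Q a f y n = Q ^ (-(a - 2 * n)) • (qAd Q a f y n * L') := by
    intro n
    have h1 : L' * (L * qAd Q a f y n) * L' = qAd Q a f y n * L' := by
      rw [← mul_assoc, hLL', one_mul]
    rw [hw n, mul_smul_comm, smul_mul_assoc, mul_assoc, mul_assoc, hLL, mul_one] at h1
    rw [← h1, smul_smul, ← zpow_add₀ hQ0, neg_add_cancel, zpow_zero, one_smul]
  have hf' : L' * f = Q ^ (2 : ℤ) • (f * L') := by
    have h1 : L' * (L * f) * L' = f * L' := by rw [← mul_assoc, hLL', one_mul]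
    rw [hf, mul_smul_comm, smul_mul_assoc, mul_assoc, mul_assoc, hLL, mul_one] at h1
    rw [← h1, smul_smul, ← zpow_add₀ hQ0, show (2 : ℤ) + -2 = 0 by norm_num, zpow_zero, one_smul]
  have hef' : e * f = f * e + (Q - Q⁻¹)⁻¹ • (L - L') := by rw [← hef]; abel
  have step : ∀ n (Z : 𝓑), e * qAd Q a f y n - qAd Q a f y n * e = Z →
      e * qAd Q a f y (n + 1) - qAd Q a f y (n + 1) * e =
        f * Z - Q ^ (a - 2 * n) • (Z * f) + qInt Q (a - 2 * n) • (qAd Q a f y n * L') := by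
    intro n Z hZ
    have hZ' : e * qAd Q a f y n = qAd Q a f y n * e + Z := by rw [← hZ]; abel
    have h1 : e * (f * qAd Q a f y n) = f * qAd Q a f y n * e + f * Z +
        (Q - Q⁻¹)⁻¹ • (Q ^ (a - 2 * n) • (qAd Q a f y n * L) -
          Q ^ (-(a - 2 * n)) • (qAd Q a f y n * L')) := by
      rw [← mul_assoc, hef', add_mul, mul_assoc, hZ', mul_add, smul_mul_assoc, sub_mul, hw, hw',
        ← mul_assoc]
    have h2 : e * (qAd Q a f y n * f) = qAd Q a f y n * f * e + Z * f +
        (Q - Q⁻¹)⁻¹ • (qAd Q a f y n * L - qAd Q a f y n * L') := by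
      rw [← mul_assoc, hZ', add_mul, mul_assoc, hef', mul_add, mul_smul_comm, mul_sub, ← mul_assoc]
      abel
    rw [qAd, mul_sub, mul_smul_comm, h1, h2, sub_mul, smul_mul_assoc, qInt]
    have h3 : ((Q ^ (a - 2 * n) - Q ^ (-(a - 2 * n))) / (Q - Q⁻¹)) =
        (Q - Q⁻¹)⁻¹ * Q ^ (a - 2 * n) - (Q - Q⁻¹)⁻¹ * Q ^ (-(a - 2 * n)) := by
      rw [div_eq_inv_mul, mul_sub]
    rw [h3]
    simp only [smul_add, smul_sub, sub_smul, smul_smul, mul_comm (Q ^ (a - 2 * (n : ℤ)))]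
    abel
  induction n with
  | zero =>
    have := step 0 0 (by rw [qAd, hey, sub_self])
    rw [this]
    have h1 : qInt Q 1 = 1 := by simp [qInt, div_self hQ1]
    simp [h1]
  | succ n ih =>
    rw [step (n + 1) _ ih]
    have h1 : f * ((qInt Q (n + 1) * qInt Q (a - n)) • (qAd Q a f y n * L')) -
        Q ^ (a - 2 * ((n + 1 : ℕ) : ℤ)) • ((qInt Q (n + 1) * qInt Q (a - n)) •
          (qAd Q a f y n * L') * f) =
        (qInt Q (n + 1) * qInt Q (a - n)) • (qAd Q a f y (n + 1) * L') := by
      have e : a - 2 * (n : ℤ) = (a - 2 * ((n + 1 : ℕ) : ℤ)) + 2 := by push_cast; ring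
      rw [qAd, e, zpow_add₀ hQ0]
      simp only [mul_smul_comm, smul_mul_assoc, mul_assoc, hf', sub_mul, smul_sub, smul_smul]
      congr 2
      ring
    rw [h1, ← add_smul]
    congr 1
    have e1 : qInt Q (((n + 1 : ℕ) : ℤ) + 1) * qInt Q (a - ((n + 1 : ℕ) : ℤ)) =
        qInt Q (n + 1) * qInt Q (a - n) + qInt Q (a - 2 * ((n + 1 : ℕ) : ℤ)) := by
      have hQ2 : Q ^ 2 - 1 ≠ 0 := by
        intro h
        apply hQ1
        field_simp
        rw [h, mul_zero]
      have hn : Q ^ n ≠ 0 := pow_ne_zero _ hQ0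
      have ha : Q ^ a ≠ 0 := zpow_ne_zero _ hQ0
      simp only [qInt]
      push_cast
      simp only [neg_sub, neg_add, mul_add, mul_one, sub_add_eq_sub_sub, zpow_add₀ hQ0,
        zpow_sub₀ hQ0, zpow_neg, zpow_one, zpow_natCast, zpow_two, two_mul]
      field_simp
      ring
    rw [e1]

/-- The expansion follows from the q-Pascal rule. For n = a + 1 the exponents k (a - n + 1) are all
zero, and what remains is, up to sign and reversal of k, the Serre combination. -/
theorem qAd_eq_sum (hQ0 : Q ≠ 0) (hQ : ∀ n : ℕ, 0 < n → Q ^ n ≠ 1) (n : ℕ) :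
    qAd Q a f y n = ∑ k ∈ Finset.range (n + 1),
      ((-1 : ℂ) ^ k * Q ^ (k * (a - n + 1)) * qBinom Q n k) • (f ^ (n - k) * y * f ^ k) := by
  induction n with
  | zero => simp [qAd, qBinom_zero_right hQ0 hQ]
  | succ n ih =>
    have h1 : f * qAd Q a f y n = ∑ k ∈ Finset.range n,
        ((-1 : ℂ) ^ (k + 1) * Q ^ (((k + 1 : ℕ) : ℤ) * (a - n + 1)) * qBinom Q n (k + 1)) •
          (f ^ (n - k) * y * f ^ (k + 1)) + f ^ (n + 1) * y := by
      rw [ih, Finset.sum_range_succ', mul_add, Finset.mul_sum]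
      congr 1
      · refine Finset.sum_congr rfl fun k hk => ?_
        rw [Finset.mem_range] at hk
        rw [mul_smul_comm, ← mul_assoc, ← mul_assoc, ← pow_succ',
          show n - (k + 1) + 1 = n - k by omega]
      · simp [qBinom_zero_right hQ0 hQ, pow_succ', mul_assoc]
    have h2 : qAd Q a f y n * f = ∑ k ∈ Finset.range n,
        ((-1 : ℂ) ^ k * Q ^ ((k : ℤ) * (a - n + 1)) * qBinom Q n k) •
          (f ^ (n - k) * y * f ^ (k + 1)) +
        ((-1 : ℂ) ^ n * Q ^ ((n : ℤ) * (a - n + 1))) • (y * f ^ (n + 1)) := by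
      rw [ih, Finset.sum_range_succ, add_mul, Finset.sum_mul]
      congr 1
      · refine Finset.sum_congr rfl fun k hk => ?_
        rw [smul_mul_assoc, mul_assoc (f ^ (n - k) * y), ← pow_succ]
      · simp [qBinom_self hQ0 hQ, pow_succ, mul_assoc]
    rw [qAd, h1, h2, Finset.sum_range_succ', Finset.sum_range_succ, smul_add, Finset.smul_sum]
    have h3 : ∀ A B C D : 𝓑, A + B - (C + D) = (A - C) + (-D) + B := fun A B C D => by abel
    rw [h3, ← Finset.sum_sub_distrib]
    congr 1
    · congr 1
      · refine Finset.sum_congr rfl fun k hk => ?_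
        rw [Finset.mem_range] at hk
        rw [smul_smul, ← sub_smul, show n + 1 - (k + 1) = n - k by omega, qBinom_succ hQ0 hQ hk]
        congr 1
        have e1 : Q ^ (((k + 1 : ℕ) : ℤ) * (a - n + 1)) =
            Q ^ (((k + 1 : ℕ) : ℤ) * (a - ((n + 1 : ℕ) : ℤ) + 1)) * Q ^ ((k : ℤ) + 1) := by
          rw [← zpow_add₀ hQ0]; congr 1; push_cast; ring
        have e2 : Q ^ (a - 2 * (n : ℤ)) * Q ^ ((k : ℤ) * (a - n + 1)) =
            Q ^ (((k + 1 : ℕ) : ℤ) * (a - ((n + 1 : ℕ) : ℤ) + 1)) * Q ^ ((k : ℤ) - n) := by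
          rw [← zpow_add₀ hQ0, ← zpow_add₀ hQ0]; congr 1; push_cast; ring
        rw [e1]
        linear_combination (-(-1) ^ k * qBinom Q n k) * e2
      · rw [smul_smul, ← neg_smul, qBinom_self hQ0 hQ, Nat.sub_self, pow_zero, one_mul, mul_one]
        congr 1
        have e2 : Q ^ (a - 2 * (n : ℤ)) * Q ^ ((n : ℤ) * (a - n + 1)) =
            Q ^ (((n + 1 : ℕ) : ℤ) * (a - ((n + 1 : ℕ) : ℤ) + 1)) := by
          rw [← zpow_add₀ hQ0]; congr 1; push_cast; ring
        rw [← e2]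
        ring
    · simp [qBinom_zero_right hQ0 hQ]

/-- If some `(ad_q f)^N (y)` with `N > a` lies in a left ideal that is stable under right
multiplication by `e` and `L`, then so does `(ad_q f)^(a+1) (y)`. -/
theorem qAd_mem_of_mem (hQ0 : Q ≠ 0) (hQ : ∀ n : ℕ, 0 < n → Q ^ n ≠ 1) {a : ℕ}
    (hLL : L * L' = 1) (hLL' : L' * L = 1)
    (hef : e * f - f * e = (Q - Q⁻¹)⁻¹ • (L - L'))
    (hf : L * f = Q ^ (-2 : ℤ) • (f * L)) (hy : L * y = Q ^ (a : ℤ) • (y * L)) (hey : e * y = y * e)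
    (I : Ideal 𝓑) (hIe : ∀ D ∈ I, D * e ∈ I) (hIL : ∀ D ∈ I, D * L ∈ I) (N : ℕ)
    (hN : qAd Q a f y (a + 1 + N) ∈ I) : qAd Q a f y (a + 1) ∈ I := by
  have hQ1 : Q - Q⁻¹ ≠ 0 := by
    intro h
    rw [sub_eq_zero] at h
    refine hQ 2 (by norm_num) ?_
    rw [pow_two]; nth_rw 2 [h]; exact mul_inv_cancel₀ hQ0
  induction N with
  | zero => exact hN
  | succ N ih =>
    apply ih
    have h1 := qAd_comm hQ0 hQ1 hLL hLL' hef hf hy hey (a + 1 + N)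
    -- The index n = a + 1 + N exceeds a, so neither factor [n + 1] nor [a - n] vanishes, and one
    -- can divide by β.
    set β := qInt Q (((a + 1 + N : ℕ) : ℤ) + 1) * qInt Q ((a : ℤ) - ((a + 1 + N : ℕ) : ℤ)) with hβ
    have hβ0 : β ≠ 0 := mul_ne_zero (qInt_ne_zero hQ0 hQ (by omega)) (qInt_ne_zero hQ0 hQ (by omega))
    have h2 : β • (qAd Q a f y (a + 1 + N) * L') ∈ I := by
      rw [← h1]
      exact sub_mem (I.mul_mem_left _ hN) (hIe _ hN)
    have h3 : algebraMap ℂ 𝓑 β⁻¹ * (β • (qAd Q a f y (a + 1 + N) * L')) ∈ I := I.mul_mem_left _ h2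
    rw [← Algebra.smul_def, smul_smul, inv_mul_cancel₀ hβ0, one_smul] at h3
    have h4 := hIL _ h3
    rwa [mul_assoc, hLL', mul_one] at h4

end QComm

/-! ### The Serre relations follow from integrability -/

section

variable {𝓑 : Type*} [Ring 𝓑] [Algebra ℂ 𝓑]

/-- A derivation that shifts modes, applied to a product of modes. -/
theorem comm_list_prod {O : Type*} [DecidableEq O] {H : 𝓑} {Y : O → ℤ → 𝓑} {β : O → ℂ} {m : ℤ}
    (hH : ∀ o n, H * Y o n - Y o n * H = β o • Y o (n + m)) (l : List O) (hl : l.Nodup)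
    (n : O → ℤ) :
    H * (l.map fun o => Y o (n o)).prod - (l.map fun o => Y o (n o)).prod * H =
      ∑ o ∈ l.toFinset, β o • (l.map fun o' => Y o' (Function.update n o (n o + m) o')).prod := by
  induction l with
  | nil => simp
  | cons a l ih =>
    rw [List.nodup_cons] at hl
    have ha : a ∉ l.toFinset := by simpa using hl.1
    have e1 : (l.map fun o' => Y o' (Function.update n a (n a + m) o')) =
        l.map fun o => Y o (n o) := by
      refine List.map_congr_left fun o ho => ?_
      rw [Function.update_of_ne]
      rintro rfl
      exact hl.1 ho
    rw [List.toFinset_cons, Finset.sum_insert ha]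
    simp only [List.map_cons, List.prod_cons, Function.update_self, e1]
    have e2 : ∑ o ∈ l.toFinset, β o • (Y a (Function.update n o (n o + m) a) *
        (l.map fun o' => Y o' (Function.update n o (n o + m) o')).prod) =
        Y a (n a) * ∑ o ∈ l.toFinset, β o •
          (l.map fun o' => Y o' (Function.update n o (n o + m) o')).prod := by
      rw [Finset.mul_sum]
      refine Finset.sum_congr rfl fun o ho => ?_
      rw [Function.update_of_ne (by rintro rfl; exact ha ho), mul_smul_comm]
    rw [e2, ← ih hl.2, ← smul_mul_assoc, ← hH]
    noncomm_ring

variable {s : ℕ}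

/-- The order of the factors in a term of the Serre relations; `none` stands for the factor of the
second kind. -/
def serreWord (π : Equiv.Perm (Fin s)) (k : ℕ) : List (Option (Fin s)) :=
  ((List.ofFn π).take k).map some ++ none :: ((List.ofFn π).drop k).map some

theorem nodup_serreWord (π : Equiv.Perm (Fin s)) (k : ℕ) : (serreWord π k).Nodup := by
  have h : ((List.ofFn π).take k ++ (List.ofFn π).drop k).Nodup := by
    rw [List.take_append_drop]
    exact List.nodup_ofFn.2 π.injective
  have h2 := h.map (Option.some_injective _)
  rw [List.map_append] at h2
  rw [serreWord, List.nodup_middle, List.nodup_cons]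
  refine ⟨?_, h2⟩
  rw [← List.map_append]
  simp

theorem toFinset_serreWord (π : Equiv.Perm (Fin s)) (k : ℕ) :
    (serreWord π k).toFinset = Finset.univ := by
  ext o
  have h : ∀ b, b ∈ (List.ofFn π).take k ++ (List.ofFn π).drop k := by
    intro b
    rw [List.take_append_drop, List.mem_ofFn]
    exact π.surjective b
  cases o with
  | none => simp [serreWord]
  | some b =>
    have := h b
    rw [List.mem_append] at this
    simp only [serreWord, List.mem_toFinset, List.mem_append, List.mem_cons, List.mem_map,
      Finset.mem_univ, iff_true]
    rcases this with h1 | h1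
    · exact Or.inl ⟨b, h1, rfl⟩
    · exact Or.inr (Or.inr ⟨b, h1, rfl⟩)

theorem serreWord_mul (σ π : Equiv.Perm (Fin s)) (k : ℕ) :
    serreWord (σ * π) k = (serreWord π k).map (Option.map σ) := by
  have : List.ofFn (σ * π) = (List.ofFn π).map σ := by
    rw [List.map_ofFn]; rfl
  simp only [serreWord, this, ← List.map_take, ← List.map_drop, List.map_append, List.map_cons,
    List.map_map]
  rfl

/-- The left hand side of the Serre relations. -/
def serreSum (c : ℕ → ℂ) (Y : Option (Fin s) → ℤ → 𝓑) (n : Option (Fin s) → ℤ) : 𝓑 :=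
  ∑ π : Equiv.Perm (Fin s), ∑ k ∈ Finset.range (s + 1),
    c k • ((serreWord π k).map fun o => Y o (n o)).prod

/-- The commutator with H is a derivation, and every word of the Serre sum contains each index
exactly once. The result is therefore one shifted Serre sum for each index. -/
theorem serreSum_comm {c : ℕ → ℂ} {H : 𝓑} {Y : Option (Fin s) → ℤ → 𝓑} {β : Option (Fin s) → ℂ}
    {m : ℤ} (hH : ∀ o n, H * Y o n - Y o n * H = β o • Y o (n + m)) (n : Option (Fin s) → ℤ) :
    H * serreSum c Y n - serreSum c Y n * H =
      ∑ o, β o • serreSum c Y (Function.update n o (n o + m)) := by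
  simp only [serreSum, Finset.mul_sum, Finset.sum_mul, ← Finset.sum_sub_distrib, Finset.smul_sum]
  conv_rhs => rw [Finset.sum_comm]
  refine Finset.sum_congr rfl fun π _ => ?_
  conv_rhs => rw [Finset.sum_comm]
  refine Finset.sum_congr rfl fun k _ => ?_
  rw [mul_smul_comm, smul_mul_assoc, ← smul_sub, comm_list_prod hH _ (nodup_serreWord π k),
    toFinset_serreWord, Finset.smul_sum]
  exact Finset.sum_congr rfl fun o _ => smul_comm _ _ _

/-- The sum runs over all permutations, so a relabelling of the modes of the equal factors is
absorbed in the summation. -/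
theorem serreSum_perm (c : ℕ → ℂ) {Y : Option (Fin s) → ℤ → 𝓑} {Y0 : ℤ → 𝓑}
    (hY : ∀ b, Y (some b) = Y0) (σ : Equiv.Perm (Fin s)) (n : Option (Fin s) → ℤ) :
    serreSum c Y (fun o => n (Option.map σ o)) = serreSum c Y n := by
  unfold serreSum
  conv_rhs => rw [← Equiv.sum_comp (Equiv.mulLeft σ)]
  refine Finset.sum_congr rfl fun π _ => Finset.sum_congr rfl fun k _ => ?_
  rw [Equiv.coe_mulLeft, serreWord_mul, List.map_map]
  congr 3
  funext o
  cases o <;> simp [hY]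

/-- If the Serre relations hold for the zero modes, they hold for all modes. -/
theorem serreSum_eq_zero {c : ℕ → ℂ} {Y : Option (Fin s) → ℤ → 𝓑} {Y0 : ℤ → 𝓑}
    (hY : ∀ b, Y (some b) = Y0) {H : ℤ → 𝓑} {β : ℤ → ℂ} {β' : ℤ → ℂ}
    (hβ : ∀ m, m ≠ 0 → β m ≠ 0)
    (hH : ∀ m, m ≠ 0 → ∀ n, H m * Y0 n - Y0 n * H m = β m • Y0 (n + m))
    (hH' : ∀ m, m ≠ 0 → ∀ n, H m * Y none n - Y none n * H m = β' m • Y none (n + m))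
    (h0 : ∀ n : Option (Fin s) → ℤ, (∀ b, n (some b) = 0) → serreSum c Y n = 0)
    (n : Option (Fin s) → ℤ) : serreSum c Y n = 0 := by
  -- The induction is on a finite set T outside of which the modes of the repeated factor vanish;
  -- the mode of the single factor is left free.
  suffices key : ∀ (T : Finset (Fin s)) (n : Option (Fin s) → ℤ),
      (∀ b, b ∉ T → n (some b) = 0) → serreSum c Y n = 0 from
    key Finset.univ n fun b hb => absurd (Finset.mem_univ b) hb
  intro T
  induction T using Finset.induction_on with
  | empty => exact fun n hn => h0 n fun b => hn b (by simp)
  | insert a T ha ih =>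
    intro n hn
    rcases eq_or_ne (n (some a)) 0 with hna | hna
    · refine ih n fun b hb => ?_
      rcases eq_or_ne b a with rfl | hba
      · exact hna
      · exact hn b (by simp [hba, hb])
    set m := n (some a) with hm
    -- The mode at a is reset to 0, so the induction hypothesis kills the Serre sum of n0. Commuting
    -- that zero with H m then moves m back onto the indices one at a time.
    set n0 := Function.update n (some a) 0 with hn0
    have hn0' : ∀ b, b ∉ T → n0 (some b) = 0 := by
      intro b hb
      rcases eq_or_ne b a with rfl | hba
      · simp [hn0]
      · rw [hn0, Function.update_of_ne (by simpa using hba)]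
        exact hn b (by simp [hba, hb])
    have e := serreSum_comm (c := c) (H := H m) (Y := Y)
      (β := fun o => o.elim (β' m) fun _ => β m) (m := m) (by
        intro o n
        cases o with
        | none => exact hH' m hna n
        | some b => rw [hY]; exact hH m hna n) n0
    rw [ih n0 hn0', mul_zero, zero_mul, sub_zero, Fintype.sum_option,
      ih (Function.update n0 none (n0 none + m)) (fun b hb => by
        rw [Function.update_of_ne (by simp)]; exact hn0' b hb), smul_zero, zero_add] at e
    -- Placing m at any index b outside T gives the modes n up to the transposition of a and b,
    -- hence the same Serre sum.
    have e2 : ∀ b, b ∈ Finset.univ \ T →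
        serreSum c Y (Function.update n0 (some b) (n0 (some b) + m)) = serreSum c Y n := by
      intro b hb
      rw [Finset.mem_sdiff] at hb
      rw [hn0' b hb.2, zero_add, ← serreSum_perm c hY (Equiv.swap a b) n]
      congr 1
      funext o
      cases o with
      | none => rw [Function.update_of_ne (by simp), hn0, Function.update_of_ne (by simp)]; rfl
      | some d =>
        rw [Option.map_some]
        rcases eq_or_ne d b with rfl | hdb
        · rw [Function.update_self, Equiv.swap_apply_right]
        · rw [Function.update_of_ne (by simpa using hdb)]
          rcases eq_or_ne d a with rfl | hda
          · rw [Equiv.swap_apply_left, hn0, Function.update_self]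
            exact (hn b (by simp [hdb.symm, hb.2])).symm
          · rw [Equiv.swap_apply_of_ne_of_ne hda hdb, hn0,
              Function.update_of_ne (by simpa using hda)]
    -- Shifts at indices of T vanish by induction. Those outside T are all equal, and there is at
    -- least one of them, namely a, so a nonzero multiple of the wanted sum is zero.
    rw [← Finset.sum_sdiff (Finset.subset_univ T), add_comm, Finset.sum_eq_zero (s := T),
      zero_add, Finset.sum_congr rfl (g := fun _ => β m • serreSum c Y n), Finset.sum_const,
      ← Nat.cast_smul_eq_nsmul ℂ, smul_smul] at e
    · refine (smul_eq_zero_iff_right (mul_ne_zero ?_ (hβ m hna))).1 e.symm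
      have : a ∈ Finset.univ \ T := by simp [ha]
      exact_mod_cast (Finset.card_pos.2 ⟨a, this⟩).ne'
    · intro b hb
      rw [e2 b hb]
      rfl
    · intro b hb
      rw [ih _ fun d hd => ?_, smul_zero]
      rw [Function.update_of_ne (by simp only [ne_eq, Option.some.injEq]; rintro rfl; exact hd hb)]
      exact hn0' d hd

end

section

variable {ι : Type*} [Fintype ι] {𝔥 : Type*} [AddCommGroup 𝔥] [Module ℚ 𝔥]
  {A : CartanDatum ι} {R : Realization A 𝔥} {ħ : ℂ} {𝓑 : Type*} [Ring 𝓑] [Algebra ℂ 𝓑]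
  {X : ℤˣ → ι → ℤ → 𝓑} {K : 𝔥 → 𝓑} {H : ι → ℤ → 𝓑} {P : ℤˣ → ι → ℤ → 𝓑}

theorem exists_units_mul_nat {m : ℤ} (hm : m ≠ 0) :
    ∃ (η : ℤˣ) (n : ℕ), n ≠ 0 ∧ m = (η : ℤ) * n := by
  rcases lt_or_gt_of_ne hm with h | h
  · exact ⟨-1, m.natAbs, by omega, by rw [Int.natCast_natAbs, abs_of_neg h]; simp⟩
  · exact ⟨1, m.natAbs, by omega, by rw [Int.natCast_natAbs, abs_of_pos h]; simp⟩

omit [Fintype ι] in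
theorem CartanDatum.B_self (A : CartanDatum ι) (i : ι) : A.B i i = 2 * A.r i := by
  rw [CartanDatum.B, A.diag, mul_comm]

theorem pow_sub_inv_pow_ne_zero (hq : NotRootOfUnity ħ) {c : ℚ} (hc : c ≠ 0) {m : ℕ}
    (hm : m ≠ 0) : qpow ħ c ^ m - (qpow ħ c)⁻¹ ^ m ≠ 0 := by
  rw [← qpow_neg, ← qpow_nat_mul, ← qpow_nat_mul, sub_ne_zero]
  intro h
  have h2 := hq.qpow_injective h
  have hm' : (m : ℚ) ≠ 0 := by exact_mod_cast hm
  rw [mul_right_inj' hm'] at h2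
  apply hc
  linarith

/-- The action of `h_{i,m}` on the modes. -/
theorem IsPreRep.exists_h_comm (h : IsPreRep R ħ X K H P) (hq : NotRootOfUnity ħ) (ε : ℤˣ)
    (i j : ι) {m : ℤ} (hm : m ≠ 0) : ∃ β : ℂ, (A.B i j ≠ 0 → β ≠ 0) ∧
      ∀ n, H i m * X ε j n - X ε j n * H i m = β • X ε j (n + m) := by
  obtain ⟨η, l, hl, rfl⟩ := exists_units_mul_nat hm
  set b := qpow ħ ((η : ℤ) * (ε : ℤ) * A.B i j) with hb
  have hc : hConst ħ η * l ≠ 0 := mul_ne_zero (hConst_ne_zero hq η) (by exact_mod_cast hl)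
  refine ⟨(hConst ħ η * l)⁻¹ * (b ^ l - b⁻¹ ^ l), fun hB => mul_ne_zero (inv_ne_zero hc) ?_,
    fun n => ?_⟩
  · refine pow_sub_inv_pow_ne_zero hq (mul_ne_zero (mul_ne_zero ?_ ?_) (by exact_mod_cast hB)) hl
    · exact_mod_cast η.ne_zero
    · exact_mod_cast ε.ne_zero
  · rw [← smul_smul, ← h.h_x, smul_smul, inv_mul_cancel₀ hc, one_smul]

omit [Fintype ι] in
theorem qpow_r_pow_ne_one (hq : NotRootOfUnity ħ) (A : CartanDatum ι) (i : ι) (n : ℕ)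
    (hn : 0 < n) : qpow ħ (A.r i) ^ n ≠ 1 := by
  rw [← qpow_nat_mul]
  refine hq.qpow_ne_one (mul_ne_zero ?_ ?_)
  · exact_mod_cast hn.ne'
  · exact_mod_cast (A.r_pos i).ne'

theorem qpow_mul_int (ħ : ℂ) (a : ℚ) (n : ℤ) : qpow ħ (a * n) = qpow ħ a ^ n := by
  obtain ⟨m, rfl | rfl⟩ := n.eq_nat_or_neg
  · rw [zpow_natCast, ← qpow_nat_mul]; congr 1; push_cast; ring
  · rw [zpow_neg, zpow_natCast, ← qpow_nat_mul, ← qpow_neg]; congr 1; push_cast; ring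

/-- The Serre relations hold on integrable modules. -/
theorem IsPreRep.serreRel (h : IsPreRep R ħ X K H P) (hq : NotRootOfUnity ħ)
    {M : Type*} [AddCommGroup M] [Module 𝓑 M] (W : Module.Dual ℚ 𝔥 → AddSubgroup M)
    (hC : ∀ (c : ℂ) ω, ∀ w ∈ W ω, algebraMap ℂ 𝓑 c • w ∈ W ω)
    (hX : ∀ (ε : ℤˣ) i r ω, ∀ w ∈ W ω, X ε i r • w ∈ W (ω + (ε : ℤ) • R.root i))
    (hK : ∀ a ω, ∀ w ∈ W ω, K a • w ∈ W ω)
    (hint : ∀ ω i, ∃ N : ℕ, ∀ r : ℕ, N ≤ r →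
      W (ω + r • R.root i) = ⊥ ∧ W (ω - r • R.root i) = ⊥)
    (hfaith : ∀ D : 𝓑, (∀ ω, ∀ w ∈ W ω, D • w = 0) → D = 0) : SerreRel A ħ X := by
  intro ε i j hij s hs n n'
  obtain ⟨a, rfl⟩ : ∃ a, s = a + 1 := ⟨s - 1, by have := A.offDiag i j hij; omega⟩
  have ha : A.C i j = -(a : ℤ) := by push_cast at hs; omega
  set Q := qpow ħ (A.r i) with hQdef
  have hQ0 : Q ≠ 0 := qpow_ne_zero _ _
  have hQ := qpow_r_pow_ne_one hq A i
  have hint' : ∀ ω i, ∃ N : ℕ, ∀ z : ℤ, N ≤ z.natAbs → W (ω + z • R.root i) = ⊥ := by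
    intro ω i
    obtain ⟨N, hN⟩ := hint ω i
    refine ⟨N, fun z hz => ?_⟩
    rcases Int.natAbs_eq z with hz' | hz'
    · rw [hz', natCast_zsmul]; exact (hN _ hz).1
    · rw [hz', neg_smul, natCast_zsmul, ← sub_eq_add_neg]; exact (hN _ hz).2
  -- zero modes
  have zero : ∀ r', qAd Q a (X ε i 0) (X ε j r') (a + 1) = 0 := by
    intro r'
    set f := X ε i 0
    set y := X ε j r'
    -- The triple (e, f, L) is chosen so that f lowers weights for L = φ^{-ε}_{i,0} whatever the
    -- sign ε is. For this L the element y has weight a = -C_{i,j}, which is nonnegative, and it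
    -- commutes with e.
    set e := X (-ε) i 0
    set L := P (-ε) i 0
    set L' := P ε i 0
    have hLL : L * L' = 1 := by
      simp only [L, L', h.phi_zero]
      rw [Units.val_neg, neg_mul, neg_smul, h.k_neg_mul]
    have hLL' : L' * L = 1 := by
      simp only [L, L', h.phi_zero]
      rw [Units.val_neg, neg_mul, neg_smul, h.k_mul_neg]
    have hef : e * f - f * e = (Q - Q⁻¹)⁻¹ • (L - L') := by
      have e1 := h.x_pm_same i 0 0
      rw [qpow_neg, ← hQdef, add_zero] at e1
      rcases Int.units_eq_one_or ε with rfl | rfl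
      · rw [← neg_sub, e1, ← smul_neg, neg_sub]
      · simp only [e, f, L, L', neg_neg]
        exact e1
    have hε : ((-ε : ℤˣ) : ℤ) * (ε : ℤ) = -1 := by
      rw [Units.val_neg, neg_mul, ← Units.val_mul, Int.units_mul_self]; simp
    have hεq : (((-ε : ℤˣ) : ℤ) : ℚ) * ((ε : ℤ) : ℚ) = -1 := by exact_mod_cast hε
    have hf : L * f = Q ^ (-2 : ℤ) • (f * L) := by
      rw [h.phi_zero_x, hεq, A.B_self, hQdef, ← qpow_mul_int]
      congr 2; push_cast; ring
    have hy : L * y = Q ^ (a : ℤ) • (y * L) := by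
      rw [h.phi_zero_x, hεq, CartanDatum.B, ha, hQdef, ← qpow_mul_int]
      congr 2; push_cast; ring
    have hey : e * y = y * e := by
      rcases Int.units_eq_one_or ε with rfl | rfl
      · exact (sub_eq_zero.1 (h.x_pm_ne j i hij.symm r' 0)).symm
      · exact sub_eq_zero.1 (by simpa only [e, neg_neg] using h.x_pm_ne i j hij 0 r')
    have hmap : ∀ (m : ℕ) ω, ∀ w ∈ W ω, qAd Q a f y m • w ∈
        W (ω + (ε : ℤ) • R.root j + ((ε : ℤ) * m) • R.root i) := by
      intro m
      induction m with
      | zero => intro ω w hw; simpa [qAd] using hX ε j r' ω w hw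
      | succ m ih =>
        intro ω w hw
        rw [qAd, sub_smul, mul_smul, Algebra.smul_def, mul_smul, mul_smul]
        refine sub_mem ?_ (hC _ _ _ ?_)
        · have := hX ε i 0 _ _ (ih ω w hw)
          convert this using 2
          push_cast
          module
        · rw [mul_smul]
          have := ih _ _ (hX ε i 0 ω w hw)
          convert this using 2
          push_cast
          module
    apply hfaith
    intro ω w hw
    -- This is the left ideal of elements that kill the whole i-string through ω. It is stable under
    -- right multiplication by e and L because these preserve the string.
    let I : Ideal 𝓑 :=
      { carrier := {D | ∀ z : ℤ, ∀ w ∈ W (ω + z • R.root i), D • w = 0}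
        add_mem' := fun {D D'} hD hD' z w hw => by rw [add_smul, hD z w hw, hD' z w hw, add_zero]
        zero_mem' := fun z w _ => zero_smul _ _
        smul_mem' := fun c D hD z w hw => by rw [smul_eq_mul, mul_smul, hD z w hw, smul_zero] }
    obtain ⟨N1, hN1⟩ := hint' ω i
    obtain ⟨N2, hN2⟩ := hint' (ω + (ε : ℤ) • R.root j) i
    -- The (a + 1 + N1 + N2)-th commutator is zero on the string. If |z| ≥ N1 its source vanishes;
    -- otherwise its target lies more than N2 steps away from ω ± α_j on the i-string and vanishes
    -- too.
    have hmem := qAd_mem_of_mem hQ0 hQ hLL hLL' hef hf hy hey I (fun D hD z w hw => by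
        rw [mul_smul]
        refine hD (z + ((-ε : ℤˣ) : ℤ)) _ ?_
        have := hX (-ε) i 0 _ _ hw
        convert this using 2
        module) (fun D hD z w hw => by
        rw [mul_smul]
        refine hD z _ ?_
        simp only [L, h.phi_zero]
        exact hK _ _ _ hw) (N1 + N2) (fun z w hw => by
        rcases le_or_gt N1 z.natAbs with hz | hz
        · rw [hN1 z hz, AddSubgroup.mem_bot] at hw
          rw [hw, smul_zero]
        · have h1 := hmap (a + 1 + (N1 + N2)) _ w hw
          have h2 : W (ω + (ε : ℤ) • R.root j +
              (z + (ε : ℤ) * (a + 1 + (N1 + N2) : ℕ)) • R.root i) = ⊥ := by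
            refine hN2 _ ?_
            rcases Int.units_eq_one_or ε with rfl | rfl
            · push_cast; omega
            · push_cast; omega
          have h3 : ω + z • R.root i + (ε : ℤ) • R.root j +
              ((ε : ℤ) * (a + 1 + (N1 + N2) : ℕ)) • R.root i =
              ω + (ε : ℤ) • R.root j + (z + (ε : ℤ) * (a + 1 + (N1 + N2) : ℕ)) • R.root i := by
            module
          rw [h3, h2, AddSubgroup.mem_bot] at h1
          exact h1)
    exact hmem 0 w (by simpa using hw)
  -- all modes
  let Y : Option (Fin (a + 1)) → ℤ → 𝓑 := fun o => o.elim (X ε j) fun _ => X ε i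
  have hH1 : ∀ m : ℤ, ∃ β : ℂ, m ≠ 0 → β ≠ 0 ∧
      ∀ n, H i m * X ε i n - X ε i n * H i m = β • X ε i (n + m) := by
    intro m
    by_cases hm : m ≠ 0
    · obtain ⟨β, h1, h2⟩ := h.exists_h_comm hq ε i i hm
      refine ⟨β, fun _ => ⟨h1 ?_, h2⟩⟩
      rw [A.B_self]
      have := A.r_pos i
      positivity
    · exact ⟨0, fun h => absurd h hm⟩
  have hH2 : ∀ m : ℤ, ∃ β : ℂ, m ≠ 0 →
      ∀ n, H i m * X ε j n - X ε j n * H i m = β • X ε j (n + m) := by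
    intro m
    by_cases hm : m ≠ 0
    · obtain ⟨β, h1, h2⟩ := h.exists_h_comm hq ε i j hm
      exact ⟨β, fun _ => h2⟩
    · exact ⟨0, fun h => absurd h hm⟩
  choose β hβ using hH1
  choose β' hβ' using hH2
  have key := serreSum_eq_zero (c := fun k => (-1 : ℂ) ^ k * qBinom Q (a + 1) k) (Y := Y)
    (Y0 := X ε i) (fun b => rfl) (H := H i) (β := β) (β' := β') (fun m hm => (hβ m hm).1)
    (fun m hm => (hβ m hm).2) (fun m hm => hβ' m hm) (by
      intro n0 hn0
      have e0 : ∀ (π : Equiv.Perm (Fin (a + 1))), ∑ k ∈ Finset.range (a + 1 + 1),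
          ((-1 : ℂ) ^ k * qBinom Q (a + 1) k) •
            ((serreWord π k).map fun o => Y o (n0 o)).prod = 0 := by
        intro π
        have e1 : ∀ k ∈ Finset.range (a + 1 + 1), ((serreWord π k).map fun o => Y o (n0 o)).prod =
            X ε i 0 ^ k * X ε j (n0 none) * X ε i 0 ^ (a + 1 - k) := by
          intro k hk
          have hk' : k ≤ a + 1 := by simpa [Nat.lt_succ_iff] using hk
          have e2 : ((fun o => Y o (n0 o)) ∘ some) = fun _ : Fin (a + 1) => X ε i 0 := by
            funext b
            simp [Y, hn0]
          rw [serreWord, List.map_append, List.map_cons, List.map_map, List.map_map, e2,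
            List.map_const', List.map_const', List.prod_append, List.prod_cons,
            List.prod_replicate, List.prod_replicate, List.length_take, List.length_drop,
            List.length_ofFn, min_eq_left hk', mul_assoc]
          rfl
        -- When all repeated modes are zero, every permutation gives the same sum. The reversal of k
        -- turns it into (-1)^(a+1) times the expansion of the vanishing commutator.
        rw [Finset.sum_congr rfl fun k hk => by rw [e1 k hk], ← Finset.sum_range_reflect]
        have e3 := zero (n0 none)
        rw [qAd_eq_sum hQ0 hQ] at e3
        have e4 : (-1 : ℂ) ^ (a + 1) • ∑ k ∈ Finset.range (a + 1 + 1),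
          ((-1 : ℂ) ^ k * Q ^ ((k : ℤ) * ((a : ℤ) - ((a + 1 : ℕ) : ℤ) + 1)) *
            qBinom Q (a + 1) k) •
            (X ε i 0 ^ (a + 1 - k) * X ε j (n0 none) * X ε i 0 ^ k) = 0 := by
          rw [e3, smul_zero]
        rw [← e4, Finset.smul_sum]
        refine Finset.sum_congr rfl fun k hk => ?_
        have hk' : k ≤ a + 1 := by simpa [Nat.lt_succ_iff] using hk
        rw [show a + 1 + 1 - 1 - k = a + 1 - k by omega, Nat.sub_sub_self hk', qBinom_symm hk',
          smul_smul]
        congr 1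
        have e5 : (k : ℤ) * ((a : ℤ) - ((a + 1 : ℕ) : ℤ) + 1) = 0 := by push_cast; ring
        rw [e5, zpow_zero, mul_one, ← mul_assoc]
        congr 1
        obtain ⟨d, hd⟩ : ∃ d, a + 1 = k + d := ⟨a + 1 - k, by omega⟩
        rw [hd, show k + d - k = d by omega, pow_add, mul_right_comm, ← pow_add, ← two_mul,
          pow_mul]
        simp
      exact Finset.sum_eq_zero fun π _ => e0 π) (fun o => o.elim n' n)
  rw [← key]
  refine Finset.sum_congr rfl fun π _ => Finset.sum_congr rfl fun k _ => ?_
  congr 1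
  rw [serreWord, List.map_append, List.map_cons, List.map_map, List.map_map, List.prod_append,
    List.prod_cons, mul_assoc]
  have e6 : (List.ofFn fun l => X ε i (n (π l))) = (List.ofFn π).map fun b => X ε i (n b) := by
    rw [List.map_ofFn]; rfl
  rw [e6, ← List.map_take, ← List.map_drop]
  rfl

end

/-! ### The deformed Drinfeld coproduct -/

section Convolution

variable {𝓑 : Type*} [Ring 𝓑]

theorem finite_support_coeff_mul (A B : HahnSeries ℤ 𝓑) (n : ℤ) :
    (Function.support fun k => A.coeff k * B.coeff (n - k)).Finite := by
  refine Set.Finite.subset (Finset.finite_toSet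
    ((Finset.antidiagonal A.isPWO_support B.isPWO_support n).image Prod.fst)) fun k hk => ?_
  rw [Finset.mem_coe, Finset.mem_image]
  refine ⟨(k, n - k), ?_, rfl⟩
  rw [Finset.mem_antidiagonal]
  exact ⟨left_ne_zero_of_mul hk, right_ne_zero_of_mul hk, by simp⟩

/-- Summing over all of ℤ instead of over the supports allows reindexing by translations in the
verifications below. -/
theorem coeff_mul_eq_finsum (A B : HahnSeries ℤ 𝓑) (n : ℤ) :
    (A * B).coeff n = ∑ᶠ k, A.coeff k * B.coeff (n - k) := by
  classical
  have hinj : Set.InjOn Prod.fst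
      (Finset.antidiagonal A.isPWO_support B.isPWO_support n : Set (ℤ × ℤ)) := by
    rintro ⟨a, b⟩ hab ⟨c, d⟩ hcd h
    rw [Finset.mem_coe, Finset.mem_antidiagonal] at hab hcd
    simp only at h hab hcd
    ext <;> simp <;> omega
  rw [HahnSeries.coeff_mul, finsum_eq_sum_of_support_subset
    (s := (Finset.antidiagonal A.isPWO_support B.isPWO_support n).image Prod.fst),
    Finset.sum_image hinj]
  · refine Finset.sum_congr rfl fun p hp => ?_
    rw [Finset.mem_antidiagonal] at hp
    rw [← hp.2.2, add_sub_cancel_left]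
  · intro k hk
    rw [Finset.mem_coe, Finset.mem_image]
    refine ⟨(k, n - k), ?_, rfl⟩
    rw [Finset.mem_antidiagonal]
    exact ⟨left_ne_zero_of_mul hk, right_ne_zero_of_mul hk, by simp⟩

theorem coeff_mul_eq_finsum' (A B : HahnSeries ℤ 𝓑) (n : ℤ) :
    (A * B).coeff n = ∑ᶠ k, A.coeff (n - k) * B.coeff k := by
  rw [coeff_mul_eq_finsum, ← finsum_comp_equiv (Equiv.subLeft n)]
  simp

theorem finite_support_coeff_mul' (A B : HahnSeries ℤ 𝓑) (n : ℤ) :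
    (Function.support fun k => A.coeff (n - k) * B.coeff k).Finite := by
  have := (finite_support_coeff_mul A B n).preimage (f := fun k => n - k)
    (sub_right_injective.injOn)
  refine this.subset fun k hk => ?_
  simpa using hk

end Convolution

section

variable {ι : Type*} [Fintype ι] {𝔥 : Type*} [AddCommGroup 𝔥] [Module ℚ 𝔥]
  {A : CartanDatum ι} {R : Realization A 𝔥} {ħ : ℂ} {𝓐 : Type*} [Ring 𝓐] [Algebra ℂ 𝓐]
  {X : ℤˣ → ι → ℤ → 𝓐} {K : 𝔥 → 𝓐} {H : ι → ℤ → 𝓐} {P : ℤˣ → ι → ℤ → 𝓐}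

omit [Fintype ι] in
theorem CartanDatum.B_symm (A : CartanDatum ι) (i j : ι) : A.B i j = A.B j i := A.symm i j

namespace IsPreRep

variable (h : IsPreRep R ħ X K H P)
include h

/-- The relation between `φ` and `x`, with a uniform range of summation. -/
theorem phi_x_range (η ε : ℤˣ) (i j : ι) (n r : ℤ) {N : ℕ} (hN : (η : ℤ) * n < N) :
    P η i n * X ε j r = ∑ s ∈ Finset.range N,
        PowerSeries.coeff s (structureSeries (qpow ħ ((η : ℤ) * (ε : ℤ) * A.B i j))) •
          (X ε j (r + (η : ℤ) * s) * P η i (n - (η : ℤ) * s)) := by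
  have hη : (η : ℤ) * (η : ℤ) = 1 := by rw [← Units.val_mul, Int.units_mul_self]; rfl
  rcases lt_or_ge ((η : ℤ) * n) 0 with hn | hn
  · rw [h.phi_neg η i n hn, zero_mul]
    refine (Finset.sum_eq_zero fun s _ => ?_).symm
    rw [h.phi_neg η i, mul_zero, smul_zero]
    rw [mul_sub, ← mul_assoc, hη]
    omega
  · obtain ⟨m, hm⟩ : ∃ m : ℕ, n = (η : ℤ) * m := ⟨_, exists_eq_units_mul_nat η hn⟩
    subst hm
    rw [units_mul_units_mul] at hN
    rw [h.phi_x]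
    refine Finset.sum_subset_zero_on_sdiff (by
      rw [Finset.range_subset_range]; omega) (fun s hs => ?_) fun s _ => ?_
    · rw [Finset.mem_sdiff, Finset.mem_range, Finset.mem_range] at hs
      rw [h.phi_neg η i, mul_zero, smul_zero]
      rw [← mul_sub, units_mul_units_mul]
      omega
    · rw [mul_sub]

/-- `(w - q^{εB} z) φ_i^η(z) x_j^ε(w) = (q^{εB} w - z) x_j^ε(w) φ_i^η(z)`. -/
theorem phi_x_exchange (η ε : ℤˣ) (i j : ι) (p q : ℤ) :
    P η i (p + 1) * X ε j q - qpow ħ ((ε : ℤ) * A.B i j) • (P η i p * X ε j (q + 1)) =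
      qpow ħ ((ε : ℤ) * A.B i j) • (X ε j q * P η i (p + 1)) - X ε j (q + 1) * P η i p := by
  -- This form clears the denominator of the structure function in the direction of expansion given
  -- by η. For η = -1 the parameter is inverted and the modes shift the other way.
  have key : ∀ n r : ℤ, P η i n * X ε j r - qpow ħ ((η : ℤ) * (ε : ℤ) * A.B i j) •
      (P η i (n - (η : ℤ)) * X ε j (r + (η : ℤ))) =
      qpow ħ ((η : ℤ) * (ε : ℤ) * A.B i j) • (X ε j r * P η i n) -
        X ε j (r + (η : ℤ)) * P η i (n - (η : ℤ)) := by
    intro n r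
    have hη : (η : ℤ) * (η : ℤ) = 1 := by rw [← Units.val_mul, Int.units_mul_self]; rfl
    set c := qpow ħ ((η : ℤ) * (ε : ℤ) * A.B i j) with hc
    obtain ⟨N, hN⟩ : ∃ N : ℕ, (η : ℤ) * n < N := ⟨((η : ℤ) * n).toNat + 1, by omega⟩
    rw [h.phi_x_range η ε i j n r (N := N + 1 + 1) (by push_cast; omega),
      h.phi_x_range η ε i j (n - (η : ℤ)) (r + (η : ℤ)) (N := N + 1) (by
        rw [mul_sub, hη]; push_cast; omega), ← hc, Finset.smul_sum, Finset.sum_range_succ',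
      add_sub_right_comm, ← Finset.sum_sub_distrib]
    -- Multiplying the structure series by 1 - c t gives c - t, so among the positive powers of t
    -- only the first one contributes.
    have e : ∀ s : ℕ, PowerSeries.coeff (s + 1) (structureSeries c) •
        (X ε j (r + (η : ℤ) * ((s + 1 : ℕ) : ℤ)) * P η i (n - (η : ℤ) * ((s + 1 : ℕ) : ℤ))) -
        c • PowerSeries.coeff s (structureSeries c) •
        (X ε j (r + (η : ℤ) + (η : ℤ) * s) * P η i (n - (η : ℤ) - (η : ℤ) * s)) =
        (if s = 0 then (-1 : ℂ) else 0) •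
        (X ε j (r + (η : ℤ) + (η : ℤ) * s) * P η i (n - (η : ℤ) - (η : ℤ) * s)) := by
      intro s
      have e1 := congrArg (PowerSeries.coeff (s + 1)) (structureSeries_spec c)
      rw [sub_mul, one_mul, mul_assoc, map_sub, PowerSeries.coeff_C_mul,
        PowerSeries.coeff_succ_X_mul, map_sub, PowerSeries.coeff_C, if_neg (by omega),
        PowerSeries.coeff_X, zero_sub] at e1
      have e2 : (if s = 0 then (-1 : ℂ) else 0) = -(if s + 1 = 1 then 1 else 0) := by
        by_cases hs : s = 0 <;> simp [hs]
      rw [e2, ← e1, show r + (η : ℤ) * ((s + 1 : ℕ) : ℤ) = r + (η : ℤ) + (η : ℤ) * s by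
        push_cast; ring, show n - (η : ℤ) * ((s + 1 : ℕ) : ℤ) = n - (η : ℤ) - (η : ℤ) * s by
        push_cast; ring, sub_smul, smul_smul]
    rw [Finset.sum_congr rfl fun s _ => e s, Finset.sum_eq_single 0 (by
      intro s _ hs; rw [if_neg hs, zero_smul]) (by simp), coeff_zero_structureSeries]
    simp only [if_true, Nat.cast_zero, mul_zero, add_zero, sub_zero, neg_smul, one_smul]
    abel
  rcases Int.units_eq_one_or η with rfl | rfl
  · have e := key (p + 1) q
    simpa using e
  · have e := key p (q + 1)
    simp only [Units.val_neg, Units.val_one, Int.cast_neg, Int.cast_one, neg_mul, one_mul,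
      sub_neg_eq_add, add_neg_cancel_right, qpow_neg] at e
    have hb : qpow ħ ((ε : ℤ) * A.B i j) ≠ 0 := qpow_ne_zero _ _
    -- Multiplying by -q^{εB} brings the relation expanded in w / z to the same shape as the one
    -- expanded in z / w.
    have e2 := congrArg (fun y => -(qpow ħ ((ε : ℤ) * A.B i j) • y)) e
    simp only [smul_sub, smul_smul, mul_inv_cancel₀ hb, one_smul, neg_sub] at e2
    exact e2

end IsPreRep

end

section

variable {ι : Type*} [Fintype ι] {𝔥 : Type*} [AddCommGroup 𝔥] [Module ℚ 𝔥]
  {A : CartanDatum ι} {R : Realization A 𝔥} {ħ : ℂ} {𝓐 : Type*} [Ring 𝓐] [Algebra ℂ 𝓐]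
  {X : ℤˣ → ι → ℤ → 𝓐} {K : 𝔥 → 𝓐} {H : ι → ℤ → 𝓐} {P : ℤˣ → ι → ℤ → 𝓐}

open HahnSeries (single)

/-- `∑_n u^n φ^-_{i,r-n} ⊗ x^+_{i,n}`. -/
def IsPreRep.plusTail (h : IsPreRep R ħ X K H P) (i : ι) (r : ℤ) : HahnSeries ℤ (𝓐 ⊗[ℂ] 𝓐) :=
  HahnSeries.ofSuppBddBelow (fun n => P (-1) i (r - n) ⊗ₜ X 1 i n) ⟨r, fun n hn => by
    by_contra hlt
    refine hn ?_
    dsimp only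
    rw [h.phi_neg (-1) i (r - n) (by simp; omega), TensorProduct.zero_tmul]⟩

/-- `∑_n u^n x^-_{i,r-n} ⊗ φ^+_{i,n}`. -/
def IsPreRep.minusTail (h : IsPreRep R ħ X K H P) (i : ι) (r : ℤ) : HahnSeries ℤ (𝓐 ⊗[ℂ] 𝓐) :=
  HahnSeries.ofSuppBddBelow (fun n => X (-1) i (r - n) ⊗ₜ P 1 i n) ⟨0, fun n hn => by
    by_contra hlt
    refine hn ?_
    dsimp only
    rw [h.phi_neg 1 i n (by simp; omega), TensorProduct.tmul_zero]⟩

/-- The deformed coproduct of `x^±_{i,r}`. -/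
def IsPreRep.deltaX (h : IsPreRep R ħ X K H P) (ε : ℤˣ) (i : ι) (r : ℤ) :
    HahnSeries ℤ (𝓐 ⊗[ℂ] 𝓐) :=
  if ε = 1 then single 0 (X 1 i r ⊗ₜ 1) + h.plusTail i r
  else single r (1 ⊗ₜ X (-1) i r) + h.minusTail i r

/-- The deformed coproduct of `k_a`. -/
def deltaK (K : 𝔥 → 𝓐) (a : 𝔥) : HahnSeries ℤ (𝓐 ⊗[ℂ] 𝓐) := single 0 (K a ⊗ₜ K a)

/-- The deformed coproduct of `h_{i,m}`. -/
def deltaH (H : ι → ℤ → 𝓐) (i : ι) (m : ℤ) : HahnSeries ℤ (𝓐 ⊗[ℂ] 𝓐) :=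
  single 0 (H i m ⊗ₜ 1) + single m (1 ⊗ₜ H i m)

/-- The deformed coproduct of `φ^±_{i,n}`. -/
def deltaPhi (P : ℤˣ → ι → ℤ → 𝓐) (ε : ℤˣ) (i : ι) (n : ℤ) : HahnSeries ℤ (𝓐 ⊗[ℂ] 𝓐) :=
  if 0 ≤ (ε : ℤ) * n then ∑ s ∈ Finset.range (((ε : ℤ) * n).toNat + 1),
    single ((ε : ℤ) * s) (P ε i (n - (ε : ℤ) * s) ⊗ₜ P ε i ((ε : ℤ) * s)) else 0

theorem single_sub_single {𝓑 : Type*} [Ring 𝓑] (n : ℤ) (a b : 𝓑) :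
    single n a - single n b = single n (a - b) := by
  ext m; simp only [HahnSeries.coeff_sub, HahnSeries.coeff_single]; split_ifs <;> simp

theorem smul_single {𝓑 : Type*} [Ring 𝓑] [Algebra ℂ 𝓑] (c : ℂ) (n : ℤ) (a : 𝓑) :
    c • single n a = single n (c • a) := by
  ext m; simp only [HahnSeries.coeff_smul, HahnSeries.coeff_single]; split_ifs <;> simp

theorem deltaPhi_natural {ι : Type*} (P : ℤˣ → ι → ℤ → 𝓐) (ε : ℤˣ) (i : ι) (m : ℕ) :
    deltaPhi P ε i ((ε : ℤ) * m) = ∑ s ∈ Finset.range (m + 1),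
      single ((ε : ℤ) * s) (P ε i ((ε : ℤ) * (m - s)) ⊗ₜ P ε i ((ε : ℤ) * s)) := by
  rw [deltaPhi, units_mul_units_mul, if_pos (by positivity), Int.toNat_natCast]
  refine Finset.sum_congr rfl fun s _ => ?_
  rw [mul_sub]

namespace IsPreRep

variable (h : IsPreRep R ħ X K H P)
include h

theorem coeff_deltaPhi (ε : ℤˣ) (i : ι) (n k : ℤ) :
    (deltaPhi P ε i n).coeff k = P ε i (n - k) ⊗ₜ P ε i k := by
  rcases lt_or_ge ((ε : ℤ) * k) 0 with hk | hk
  · rw [h.phi_neg ε i k hk, TensorProduct.tmul_zero, deltaPhi]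
    split_ifs
    · rw [HahnSeries.coeff_sum]
      refine Finset.sum_eq_zero fun s _ => HahnSeries.coeff_single_of_ne ?_
      rintro rfl
      rw [units_mul_units_mul] at hk
      omega
    · rfl
  rcases lt_or_ge ((ε : ℤ) * (n - k)) 0 with hnk | hnk
  · rw [h.phi_neg ε i _ hnk, TensorProduct.zero_tmul, deltaPhi]
    split_ifs
    · rw [HahnSeries.coeff_sum]
      refine Finset.sum_eq_zero fun s hs => HahnSeries.coeff_single_of_ne ?_
      rintro rfl
      rw [mul_sub, units_mul_units_mul] at hnk
      rw [Finset.mem_range] at hs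
      omega
    · rfl
  rw [mul_sub] at hnk
  rw [deltaPhi, if_pos (by omega), HahnSeries.coeff_sum,
    Finset.sum_eq_single ((ε : ℤ) * k).toNat]
  · rw [← exists_eq_units_mul_nat ε hk, HahnSeries.coeff_single_same]
  · intro s _ hs
    refine HahnSeries.coeff_single_of_ne ?_
    rintro rfl
    rw [units_mul_units_mul] at hs
    simp at hs
  · intro hs
    rw [Finset.mem_range] at hs
    omega

@[simp] theorem coeff_plusTail (i : ι) (r n : ℤ) :
    (h.plusTail i r).coeff n = P (-1) i (r - n) ⊗ₜ X 1 i n := rfl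

@[simp] theorem coeff_minusTail (i : ι) (r n : ℤ) :
    (h.minusTail i r).coeff n = X (-1) i (r - n) ⊗ₜ P 1 i n := rfl

theorem deltaX_one (i : ι) (r : ℤ) :
    h.deltaX 1 i r = single 0 (X 1 i r ⊗ₜ 1) + h.plusTail i r := by simp [deltaX]

theorem deltaX_neg_one (i : ι) (r : ℤ) :
    h.deltaX (-1) i r = single r (1 ⊗ₜ X (-1) i r) + h.minusTail i r := by
  rw [deltaX, if_neg (by decide)]

theorem deltaK_deltaX (a : 𝔥) (ε : ℤˣ) (j : ι) (r : ℤ) : deltaK K a * h.deltaX ε j r =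
    qpow ħ ((ε : ℤ) * R.root j a) • (h.deltaX ε j r * deltaK K a) := by
  have hcp : ∀ ε i n, K a * P ε i n = P ε i n * K a := fun ε i n => (h.k_phi a ε i n).eq
  rcases Int.units_eq_one_or ε with rfl | rfl
  · have e := h.k_x a 1 j
    rw [deltaX_one, deltaK, mul_add, add_mul, smul_add]
    congr 1
    · rw [HahnSeries.single_mul_single, HahnSeries.single_mul_single, smul_single,
        Algebra.TensorProduct.tmul_mul_tmul, Algebra.TensorProduct.tmul_mul_tmul, e, mul_one,
        one_mul, add_zero, TensorProduct.smul_tmul']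
    · ext n
      rw [HahnSeries.coeff_single_zero_mul, HahnSeries.coeff_smul,
        HahnSeries.coeff_mul_single_zero, coeff_plusTail, Algebra.TensorProduct.tmul_mul_tmul,
        Algebra.TensorProduct.tmul_mul_tmul, e, hcp, TensorProduct.tmul_smul]
  · have e := h.k_x a (-1) j
    rw [deltaX_neg_one, deltaK, mul_add, add_mul, smul_add]
    congr 1
    · rw [HahnSeries.single_mul_single, HahnSeries.single_mul_single, smul_single,
        Algebra.TensorProduct.tmul_mul_tmul, Algebra.TensorProduct.tmul_mul_tmul, e, mul_one,
        one_mul, add_zero, zero_add, TensorProduct.tmul_smul]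
    · ext n
      rw [HahnSeries.coeff_single_zero_mul, HahnSeries.coeff_smul,
        HahnSeries.coeff_mul_single_zero, coeff_minusTail, Algebra.TensorProduct.tmul_mul_tmul,
        Algebra.TensorProduct.tmul_mul_tmul, e, hcp, TensorProduct.smul_tmul']

/-- Since h commutes with φ, each of the two parts of Δ(h) acts only on the terms of Δ(x) where x
sits in its own tensor factor. The factor u^m attached to 1 ⊗ h matches the shift of the mode in the
second factor. -/
theorem deltaH_deltaX (i : ι) (m : ℤ) (ε : ℤˣ) (j : ι) {β : ℂ}
    (hβ : ∀ r, H i m * X ε j r - X ε j r * H i m = β • X ε j (r + m)) (r : ℤ) :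
    deltaH H i m * h.deltaX ε j r - h.deltaX ε j r * deltaH H i m = β • h.deltaX ε j (r + m) := by
  have hcp : ∀ ε j n, H i m * P ε j n = P ε j n * H i m := fun ε j n => (h.h_phi i m ε j n).eq
  rcases Int.units_eq_one_or ε with rfl | rfl
  · have e1 : single 0 (H i m ⊗ₜ 1) * single 0 (X 1 j r ⊗ₜ 1) -
        single 0 (X 1 j r ⊗ₜ 1) * single 0 (H i m ⊗ₜ 1) =
          β • (single 0 (X 1 j (r + m) ⊗ₜ 1) : HahnSeries ℤ (𝓐 ⊗[ℂ] 𝓐)) := by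
      rw [HahnSeries.single_mul_single, HahnSeries.single_mul_single, smul_single,
        single_sub_single]
      simp only [Algebra.TensorProduct.tmul_mul_tmul, mul_one, add_zero]
      rw [← TensorProduct.sub_tmul, hβ, TensorProduct.smul_tmul']
    have e2 : single m (1 ⊗ₜ H i m) * single 0 (X 1 j r ⊗ₜ 1) =
        (single 0 (X 1 j r ⊗ₜ 1) * single m (1 ⊗ₜ H i m) : HahnSeries ℤ (𝓐 ⊗[ℂ] 𝓐)) := by
      simp only [HahnSeries.single_mul_single, Algebra.TensorProduct.tmul_mul_tmul, mul_one,
        one_mul, add_zero, zero_add]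
    have e3 : single 0 (H i m ⊗ₜ 1) * h.plusTail j r = h.plusTail j r * single 0 (H i m ⊗ₜ 1) := by
      ext n
      rw [HahnSeries.coeff_single_zero_mul, HahnSeries.coeff_mul_single_zero, coeff_plusTail,
        Algebra.TensorProduct.tmul_mul_tmul, Algebra.TensorProduct.tmul_mul_tmul, hcp, mul_one,
        one_mul]
    have e4 : single m (1 ⊗ₜ H i m) * h.plusTail j r - h.plusTail j r * single m (1 ⊗ₜ H i m) =
        β • h.plusTail j (r + m) := by
      ext n
      rw [HahnSeries.coeff_sub, HahnSeries.coeff_single_mul, HahnSeries.coeff_mul_single,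
        HahnSeries.coeff_smul, coeff_plusTail, coeff_plusTail,
        Algebra.TensorProduct.tmul_mul_tmul, Algebra.TensorProduct.tmul_mul_tmul, mul_one,
        one_mul, ← TensorProduct.tmul_sub, hβ, TensorProduct.tmul_smul,
        show r - (n - m) = r + m - n by ring, sub_add_cancel]
    rw [deltaX_one, deltaX_one, deltaH, smul_add, ← e1, ← e4]
    simp only [mul_add, add_mul, e2, e3]
    abel
  · have e1 : single m (1 ⊗ₜ H i m) * single r (1 ⊗ₜ X (-1) j r) -
        single r (1 ⊗ₜ X (-1) j r) * single m (1 ⊗ₜ H i m) =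
          β • (single (r + m) (1 ⊗ₜ X (-1) j (r + m)) : HahnSeries ℤ (𝓐 ⊗[ℂ] 𝓐)) := by
      rw [HahnSeries.single_mul_single, HahnSeries.single_mul_single, smul_single, add_comm m r,
        single_sub_single]
      simp only [Algebra.TensorProduct.tmul_mul_tmul, mul_one]
      rw [← TensorProduct.tmul_sub, hβ, TensorProduct.tmul_smul]
    have e2 : single 0 (H i m ⊗ₜ 1) * single r (1 ⊗ₜ X (-1) j r) =
        (single r (1 ⊗ₜ X (-1) j r) * single 0 (H i m ⊗ₜ 1) : HahnSeries ℤ (𝓐 ⊗[ℂ] 𝓐)) := by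
      simp only [HahnSeries.single_mul_single, Algebra.TensorProduct.tmul_mul_tmul, mul_one,
        one_mul, add_zero, zero_add]
    have e3 : single m (1 ⊗ₜ H i m) * h.minusTail j r =
        h.minusTail j r * single m (1 ⊗ₜ H i m) := by
      ext n
      rw [HahnSeries.coeff_single_mul, HahnSeries.coeff_mul_single, coeff_minusTail,
        Algebra.TensorProduct.tmul_mul_tmul, Algebra.TensorProduct.tmul_mul_tmul, hcp, mul_one,
        one_mul]
    have e4 : single 0 (H i m ⊗ₜ 1) * h.minusTail j r - h.minusTail j r * single 0 (H i m ⊗ₜ 1) =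
        β • h.minusTail j (r + m) := by
      ext n
      rw [HahnSeries.coeff_sub, HahnSeries.coeff_single_zero_mul,
        HahnSeries.coeff_mul_single_zero, HahnSeries.coeff_smul, coeff_minusTail, coeff_minusTail,
        Algebra.TensorProduct.tmul_mul_tmul, Algebra.TensorProduct.tmul_mul_tmul, mul_one,
        one_mul, ← TensorProduct.sub_tmul, hβ, TensorProduct.smul_tmul',
        show r - n + m = r + m - n by ring]
    rw [deltaX_neg_one, deltaX_neg_one, deltaH, smul_add, ← e1, ← e4]
    simp only [mul_add, add_mul, e2, e3]
    abel

/-- The double tails commute. -/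
theorem plusTail_minusTail (i j : ι) (r s : ℤ) :
    h.plusTail i r * h.minusTail j s = h.minusTail j s * h.plusTail i r := by
  ext n
  rw [coeff_mul_eq_finsum, coeff_mul_eq_finsum']
  obtain ⟨N, hN⟩ : ∃ N : ℕ, n - r < N := ⟨(n - r).toNat + 1, by omega⟩
  -- In one order φ^-_i moves past x^-_j in the first factor, in the other φ^+_j moves past x^+_i in
  -- the second. The products of signs are + in both cases and B is symmetric, so the same structure
  -- series occurs twice.
  set g := fun c : ℕ => PowerSeries.coeff c (structureSeries (qpow ħ (A.B i j))) with hg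
  have e1 : ∀ k, (h.plusTail i r).coeff k * (h.minusTail j s).coeff (n - k) =
      ∑ c ∈ Finset.range N, g c • ((X (-1) j (s - (n - k) - c) * P (-1) i (r - k + c)) ⊗ₜ
        (X 1 i k * P 1 j (n - k))) := by
    intro k
    rw [coeff_plusTail, coeff_minusTail, Algebra.TensorProduct.tmul_mul_tmul]
    rcases le_or_gt k n with hk | hk
    · rw [h.phi_x_range (-1) (-1) i j (r - k) (s - (n - k)) (N := N) (by simp; omega),
        TensorProduct.sum_tmul]
      refine Finset.sum_congr rfl fun c _ => ?_
      rw [TensorProduct.smul_tmul', hg]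
      simp [sub_eq_add_neg]
    · rw [h.phi_neg 1 j (n - k) (by simp; omega)]
      simp
  have e2 : ∀ k, (h.minusTail j s).coeff (n - k) * (h.plusTail i r).coeff k =
      ∑ c ∈ Finset.range N, g c • ((X (-1) j (s - (n - k)) * P (-1) i (r - k)) ⊗ₜ
        (X 1 i (k + c) * P 1 j (n - k - c))) := by
    intro k
    rw [coeff_plusTail, coeff_minusTail, Algebra.TensorProduct.tmul_mul_tmul]
    rcases le_or_gt r k with hk | hk
    · rw [h.phi_x_range 1 1 j i (n - k) k (N := N) (by simp; omega), TensorProduct.tmul_sum]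
      refine Finset.sum_congr rfl fun c _ => ?_
      rw [TensorProduct.tmul_smul, hg, A.B_symm i j]
      simp
    · rw [h.phi_neg (-1) i (r - k) (by simp; omega)]
      simp
  have fin : ∀ c : ℕ, (Function.support fun k => g c • ((X (-1) j (s - (n - k) - c) *
      P (-1) i (r - k + c)) ⊗ₜ[ℂ] (X 1 i k * P 1 j (n - k)))).Finite := by
    intro c
    refine (Set.finite_Icc (r + c) n).subset fun k hk => ?_
    by_contra hk'
    refine hk ?_
    rw [Set.mem_Icc, not_and_or, not_le, not_le] at hk'
    rcases hk' with h1 | h1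
    · dsimp only
      rw [h.phi_neg (-1) i _ (by simp; omega), mul_zero, TensorProduct.zero_tmul, smul_zero]
    · dsimp only
      rw [h.phi_neg 1 j _ (by simp; omega), mul_zero, TensorProduct.tmul_zero, smul_zero]
  have fin' : ∀ c : ℕ, (Function.support fun k => g c • ((X (-1) j (s - (n - k)) *
      P (-1) i (r - k)) ⊗ₜ[ℂ] (X 1 i (k + c) * P 1 j (n - k - c)))).Finite := by
    intro c
    refine (Set.finite_Icc r n).subset fun k hk => ?_
    by_contra hk'
    refine hk ?_
    rw [Set.mem_Icc, not_and_or, not_le, not_le] at hk'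
    rcases hk' with h1 | h1
    · dsimp only
      rw [h.phi_neg (-1) i _ (by simp; omega), mul_zero, TensorProduct.zero_tmul, smul_zero]
    · dsimp only
      rw [h.phi_neg 1 j _ (by simp; omega), mul_zero, TensorProduct.tmul_zero, smul_zero]
  rw [finsum_congr e1, finsum_congr e2, finsum_sum_comm _ _ fun c _ => fin c,
    finsum_sum_comm _ _ fun c _ => fin' c]
  refine Finset.sum_congr rfl fun c _ => ?_
  -- For a fixed term c of the structure series, the two sums differ by the translation of the power
  -- of u by c.
  rw [← finsum_comp_equiv (Equiv.addRight (c : ℤ))]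
  refine finsum_congr fun k => ?_
  simp only [Equiv.coe_addRight]
  rw [show s - (n - (k + c)) - c = s - (n - k) by ring, show r - (k + c) + c = r - k by ring,
    show n - (k + (c : ℤ)) = n - k - c by ring]

/-- The commutator of x^+ ⊗ 1 with the tail of Δ(x^-) produces (φ^+ - φ^-) ⊗ φ^+, and the tail of
Δ(x^+) with 1 ⊗ x^- produces φ^- ⊗ (φ^+ - φ^-). The terms φ^- ⊗ φ^+ cancel, and the two tails
commute with each other. Allowing κ = 0 treats distinct nodes at the same time. -/
theorem deltaX_comm (i j : ι) (r s : ℤ) {κ : ℂ}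
    (hκ : ∀ r s, X 1 i r * X (-1) j s - X (-1) j s * X 1 i r =
      κ • (P 1 i (r + s) - P (-1) i (r + s))) (hij : i = j ∨ κ = 0) :
    h.deltaX 1 i r * h.deltaX (-1) j s - h.deltaX (-1) j s * h.deltaX 1 i r =
      κ • (deltaPhi P 1 i (r + s) - deltaPhi P (-1) i (r + s)) := by
  have e1 : single 0 (X 1 i r ⊗ₜ 1) * single s (1 ⊗ₜ X (-1) j s) =
      (single s (1 ⊗ₜ X (-1) j s) * single 0 (X 1 i r ⊗ₜ 1) : HahnSeries ℤ (𝓐 ⊗[ℂ] 𝓐)) := by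
    simp only [HahnSeries.single_mul_single, Algebra.TensorProduct.tmul_mul_tmul, mul_one,
      one_mul, add_zero, zero_add]
  have e2 : (single 0 (X 1 i r ⊗ₜ 1) * h.minusTail j s - h.minusTail j s * single 0 (X 1 i r ⊗ₜ 1)) +
      (h.plusTail i r * single s (1 ⊗ₜ X (-1) j s) - single s (1 ⊗ₜ X (-1) j s) * h.plusTail i r) =
      κ • (deltaPhi P 1 i (r + s) - deltaPhi P (-1) i (r + s)) := by
    ext n
    simp only [HahnSeries.coeff_add, HahnSeries.coeff_sub,
      HahnSeries.coeff_single_mul, HahnSeries.coeff_mul_single,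
      HahnSeries.coeff_smul, coeff_plusTail, coeff_minusTail, h.coeff_deltaPhi, sub_zero,
      Algebra.TensorProduct.tmul_mul_tmul, mul_one, one_mul]
    rw [← TensorProduct.sub_tmul, ← TensorProduct.tmul_sub, hκ, hκ, sub_add_cancel,
      ← add_sub_assoc, sub_sub_eq_add_sub]
    rcases hij with rfl | rfl
    · simp only [TensorProduct.tmul_smul, ← TensorProduct.smul_tmul', TensorProduct.sub_tmul,
        TensorProduct.tmul_sub, smul_sub]
      abel
    · simp
  rw [deltaX_one, deltaX_neg_one, ← e2]
  simp only [mul_add, add_mul, e1, h.plusTail_minusTail]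
  abel

end IsPreRep

end

section

variable {𝓑 : Type*} [Ring 𝓑] [Algebra ℂ 𝓑]

/-- An exchange relation between Laurent series, from a relation between coefficients. -/
theorem exchange_of_coeff {A₁ B₁ A₂ B₂ : HahnSeries ℤ 𝓑} (b : ℂ) (d : ℤ)
    (h : ∀ n k, A₁.coeff (k + d) * B₁.coeff (n - (k + d)) - b • (A₂.coeff k * B₂.coeff (n - k)) =
      b • (B₁.coeff (n - (k + d)) * A₁.coeff (k + d)) - B₂.coeff (n - k) * A₂.coeff k) :
    A₁ * B₁ - b • (A₂ * B₂) = b • (B₁ * A₁) - B₂ * A₂ := by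
  ext n
  have hinj : Function.Injective (fun k : ℤ => k + d) := add_left_injective d
  have f1 := (finite_support_coeff_mul A₁ B₁ n).preimage (f := fun k : ℤ => k + d)
    hinj.injOn
  have f2 := (finite_support_coeff_mul' B₁ A₁ n).preimage (f := fun k : ℤ => k + d)
    hinj.injOn
  have f3 := finite_support_coeff_mul A₂ B₂ n
  have f4 := finite_support_coeff_mul' B₂ A₂ n
  rw [HahnSeries.coeff_sub, HahnSeries.coeff_sub, HahnSeries.coeff_smul, HahnSeries.coeff_smul,
    coeff_mul_eq_finsum A₁, coeff_mul_eq_finsum A₂, coeff_mul_eq_finsum' B₁,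
    coeff_mul_eq_finsum' B₂, ← finsum_comp_equiv (Equiv.addRight d),
    ← finsum_comp_equiv (Equiv.addRight d) (f := fun k => B₁.coeff (n - k) * A₁.coeff k),
    smul_finsum, smul_finsum, ← finsum_sub_distrib, ← finsum_sub_distrib]
  · exact finsum_congr fun k => h n k
  · exact f2.subset (fun k hk hk0 => hk (by
      have : B₁.coeff (n - (k + d)) * A₁.coeff (k + d) = 0 := hk0
      simp [this]))
  · exact f4
  · exact f1
  · exact f3.subset (fun k hk hk0 => hk (by
      have : A₂.coeff k * B₂.coeff (n - k) = 0 := hk0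
      simp [this]))

end

/-! ### Exchange relations and Newton recursion for the coproduct -/

section

variable {ι : Type*} [Fintype ι] {𝔥 : Type*} [AddCommGroup 𝔥] [Module ℚ 𝔥]
  {A : CartanDatum ι} {R : Realization A 𝔥} {ħ : ℂ} {𝓐 : Type*} [Ring 𝓐] [Algebra ℂ 𝓐]
  {X : ℤˣ → ι → ℤ → 𝓐} {K : 𝔥 → 𝓐} {H : ι → ℤ → 𝓐} {P : ℤˣ → ι → ℤ → 𝓐}

open HahnSeries (single)

namespace IsPreRep

variable (h : IsPreRep R ħ X K H P)
include h

/-- The φ^- in the first factor commute among themselves, so only the exchange relation of the x^+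
in the second factor is needed. The power of u records the mode of x^+, which is why the
coefficients are compared with a shift by 1. For the other tail the x^- sit in the first factor and
no shift occurs. -/
theorem plusTail_exchange (i j : ι) (r s : ℤ) :
    h.plusTail i (r + 1) * h.plusTail j s -
        qpow ħ (A.B i j) • (h.plusTail i r * h.plusTail j (s + 1)) =
      qpow ħ (A.B i j) • (h.plusTail j s * h.plusTail i (r + 1)) -
        h.plusTail j (s + 1) * h.plusTail i r := by
  refine exchange_of_coeff _ 1 fun n k => ?_
  have e := h.x_x 1 i j k (n - (k + 1))
  rw [show n - (k + 1) + 1 = n - k by ring] at e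
  simp only [coeff_plusTail, Algebra.TensorProduct.tmul_mul_tmul]
  rw [show s - (n - (k + 1)) = s + 1 - (n - k) by ring, show r + 1 - (k + 1) = r - k by ring,
    (h.phi_phi (-1) j (s + 1 - (n - k)) (-1) i (r - k)).eq, ← TensorProduct.tmul_smul,
    ← TensorProduct.tmul_smul, ← TensorProduct.tmul_sub, ← TensorProduct.tmul_sub]
  congr 1
  simpa using e

theorem minusTail_exchange (i j : ι) (r s : ℤ) :
    h.minusTail i (r + 1) * h.minusTail j s -
        qpow ħ (-(A.B i j)) • (h.minusTail i r * h.minusTail j (s + 1)) =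
      qpow ħ (-(A.B i j)) • (h.minusTail j s * h.minusTail i (r + 1)) -
        h.minusTail j (s + 1) * h.minusTail i r := by
  refine exchange_of_coeff _ 0 fun n k => ?_
  have e := h.x_x (-1) i j (r - k) (s - (n - k))
  simp only [coeff_minusTail, Algebra.TensorProduct.tmul_mul_tmul, add_zero]
  rw [show s + 1 - (n - k) = s - (n - k) + 1 by ring, show r + 1 - k = r - k + 1 by ring,
    (h.phi_phi 1 j (n - k) 1 i k).eq, TensorProduct.smul_tmul', TensorProduct.smul_tmul',
    ← TensorProduct.sub_tmul, ← TensorProduct.sub_tmul]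
  congr 1
  simpa using e

/-- The product of two coproducts has four parts. Those with both x in the same factor use the
exchange relation of x with x; the two mixed parts use the exchange relation of φ with x. -/
theorem deltaX_exchange (ε : ℤˣ) (i j : ι) (r s : ℤ) :
    h.deltaX ε i (r + 1) * h.deltaX ε j s -
        qpow ħ ((ε : ℤ) * A.B i j) • (h.deltaX ε i r * h.deltaX ε j (s + 1)) =
      qpow ħ ((ε : ℤ) * A.B i j) • (h.deltaX ε j s * h.deltaX ε i (r + 1)) -
        h.deltaX ε j (s + 1) * h.deltaX ε i r := by
  rcases Int.units_eq_one_or ε with rfl | rfl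
  · have hb : qpow ħ (((1 : ℤˣ) : ℤ) * A.B i j) = qpow ħ (A.B i j) := by simp
    rw [hb]
    set b := qpow ħ (A.B i j) with hbdef
    have e1 : single 0 (X 1 i (r + 1) ⊗ₜ 1) * single 0 (X 1 j s ⊗ₜ 1) -
        b • (single 0 (X 1 i r ⊗ₜ 1) * single 0 (X 1 j (s + 1) ⊗ₜ 1)) =
        b • (single 0 (X 1 j s ⊗ₜ 1) * single 0 (X 1 i (r + 1) ⊗ₜ 1)) -
        (single 0 (X 1 j (s + 1) ⊗ₜ 1) * single 0 (X 1 i r ⊗ₜ 1) : HahnSeries ℤ (𝓐 ⊗[ℂ] 𝓐)) := by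
      simp only [HahnSeries.single_mul_single, smul_single, single_sub_single,
        Algebra.TensorProduct.tmul_mul_tmul, mul_one, TensorProduct.smul_tmul',
        ← TensorProduct.sub_tmul]
      congr 2
      have e := h.x_x 1 i j r s
      rwa [hb] at e
    have e2 : single 0 (X 1 i (r + 1) ⊗ₜ 1) * h.plusTail j s -
        b • (single 0 (X 1 i r ⊗ₜ 1) * h.plusTail j (s + 1)) =
        b • (h.plusTail j s * single 0 (X 1 i (r + 1) ⊗ₜ 1)) -
        h.plusTail j (s + 1) * single 0 (X 1 i r ⊗ₜ 1) := by
      ext n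
      have e := h.phi_x_exchange (-1) 1 j i (s - n) r
      rw [A.B_symm j i, hb, show s - n + 1 = s + 1 - n by ring] at e
      simp only [HahnSeries.coeff_sub, HahnSeries.coeff_smul, HahnSeries.coeff_single_mul, sub_zero,
        HahnSeries.coeff_mul_single, coeff_plusTail, Algebra.TensorProduct.tmul_mul_tmul, mul_one,
        one_mul, TensorProduct.smul_tmul', ← TensorProduct.sub_tmul]
      congr 1
      rw [sub_eq_sub_iff_add_eq_add] at e ⊢
      exact (add_comm _ _).trans (e.trans (add_comm _ _))
    have e3 : h.plusTail i (r + 1) * single 0 (X 1 j s ⊗ₜ 1) -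
        b • (h.plusTail i r * single 0 (X 1 j (s + 1) ⊗ₜ 1)) =
        b • (single 0 (X 1 j s ⊗ₜ 1) * h.plusTail i (r + 1)) -
        single 0 (X 1 j (s + 1) ⊗ₜ 1) * h.plusTail i r := by
      ext n
      have e := h.phi_x_exchange (-1) 1 i j (r - n) s
      rw [hb, show r - n + 1 = r + 1 - n by ring] at e
      simp only [HahnSeries.coeff_sub, HahnSeries.coeff_smul, HahnSeries.coeff_single_mul, sub_zero,
        HahnSeries.coeff_mul_single, coeff_plusTail, Algebra.TensorProduct.tmul_mul_tmul, mul_one,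
        one_mul, TensorProduct.smul_tmul', ← TensorProduct.sub_tmul]
      rw [e]
    have e4 := h.plusTail_exchange i j r s
    rw [← hbdef] at e4
    have e5 := congrArg₂ (· + ·) (congrArg₂ (· + ·) e1 e2) (congrArg₂ (· + ·) e3 e4)
    simp only [deltaX_one, mul_add, add_mul, smul_add]
    refine Eq.trans ?_ (e5.trans ?_) <;> abel
  · have hb : qpow ħ (((-1 : ℤˣ) : ℤ) * A.B i j) = qpow ħ (-(A.B i j)) := by simp
    rw [hb]
    set b := qpow ħ (-(A.B i j)) with hbdef
    have e1 : single (r + 1) (1 ⊗ₜ X (-1) i (r + 1)) * single s (1 ⊗ₜ X (-1) j s) -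
        b • (single r (1 ⊗ₜ X (-1) i r) * single (s + 1) (1 ⊗ₜ X (-1) j (s + 1))) =
        b • (single s (1 ⊗ₜ X (-1) j s) * single (r + 1) (1 ⊗ₜ X (-1) i (r + 1))) -
        (single (s + 1) (1 ⊗ₜ X (-1) j (s + 1)) * single r (1 ⊗ₜ X (-1) i r) :
          HahnSeries ℤ (𝓐 ⊗[ℂ] 𝓐)) := by
      simp only [HahnSeries.single_mul_single, smul_single]
      rw [show r + 1 + s = r + s + 1 by ring, show r + (s + 1) = r + s + 1 by ring,
        show s + (r + 1) = r + s + 1 by ring, show s + 1 + r = r + s + 1 by ring]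
      simp only [single_sub_single, Algebra.TensorProduct.tmul_mul_tmul, mul_one,
        ← TensorProduct.tmul_smul, ← TensorProduct.tmul_sub]
      congr 2
      have e := h.x_x (-1) i j r s
      rwa [hb] at e
    have e2 : single (r + 1) (1 ⊗ₜ X (-1) i (r + 1)) * h.minusTail j s -
        b • (single r (1 ⊗ₜ X (-1) i r) * h.minusTail j (s + 1)) =
        b • (h.minusTail j s * single (r + 1) (1 ⊗ₜ X (-1) i (r + 1))) -
        h.minusTail j (s + 1) * single r (1 ⊗ₜ X (-1) i r) := by
      ext n
      have e := h.phi_x_exchange 1 (-1) j i (n - (r + 1)) r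
      rw [A.B_symm j i, hb, show n - (r + 1) + 1 = n - r by ring] at e
      simp only [HahnSeries.coeff_sub, HahnSeries.coeff_smul, HahnSeries.coeff_single_mul,
        HahnSeries.coeff_mul_single, coeff_minusTail, Algebra.TensorProduct.tmul_mul_tmul, mul_one,
        one_mul, ← TensorProduct.tmul_smul]
      rw [show s + 1 - (n - r) = s - (n - (r + 1)) by ring, ← TensorProduct.tmul_sub,
        ← TensorProduct.tmul_sub]
      congr 1
      rw [sub_eq_sub_iff_add_eq_add] at e ⊢
      exact (add_comm _ _).trans (e.trans (add_comm _ _))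
    have e3 : h.minusTail i (r + 1) * single s (1 ⊗ₜ X (-1) j s) -
        b • (h.minusTail i r * single (s + 1) (1 ⊗ₜ X (-1) j (s + 1))) =
        b • (single s (1 ⊗ₜ X (-1) j s) * h.minusTail i (r + 1)) -
        single (s + 1) (1 ⊗ₜ X (-1) j (s + 1)) * h.minusTail i r := by
      ext n
      have e := h.phi_x_exchange 1 (-1) i j (n - (s + 1)) s
      rw [hb, show n - (s + 1) + 1 = n - s by ring] at e
      simp only [HahnSeries.coeff_sub, HahnSeries.coeff_smul, HahnSeries.coeff_single_mul,
        HahnSeries.coeff_mul_single, coeff_minusTail, Algebra.TensorProduct.tmul_mul_tmul, mul_one,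
        one_mul, ← TensorProduct.tmul_smul]
      rw [show r + 1 - (n - s) = r - (n - (s + 1)) by ring, ← TensorProduct.tmul_sub,
        ← TensorProduct.tmul_sub, e]
    have e4 := h.minusTail_exchange i j r s
    rw [← hbdef] at e4
    have e5 := congrArg₂ (· + ·) (congrArg₂ (· + ·) e1 e2) (congrArg₂ (· + ·) e3 e4)
    simp only [deltaX_neg_one, mul_add, add_mul, smul_add]
    refine Eq.trans ?_ (e5.trans ?_) <;> abel

/-- The differential equation of `φ`, transported by a graded morphism. -/
theorem newton_graded {𝓑 : Type*} [Ring 𝓑] [Algebra ℂ 𝓑] (ψ : ℕ → 𝓐 →ₗ[ℂ] 𝓑)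
    (hψ : ∀ a b y z, ψ a y * ψ b z = ψ (a + b) (y * z)) (ε : ℤˣ) (i : ι) :
    eulerD (PowerSeries.mk fun m => ψ m (P ε i ((ε : ℤ) * m))) =
      hConst ħ ε • (eulerD (PowerSeries.mk fun m => ψ m (H i ((ε : ℤ) * m))) *
        PowerSeries.mk fun m => ψ m (P ε i ((ε : ℤ) * m))) := by
  ext m
  have e := congrArg (ψ m) (congrArg (PowerSeries.coeff m) (h.newton ε i))
  rw [coeff_eulerD, PowerSeries.coeff_smul, PowerSeries.coeff_mul, map_smul, map_smul, map_sum,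
    coeff_halfSeries] at e
  rw [coeff_eulerD, PowerSeries.coeff_mk, e, PowerSeries.coeff_smul, PowerSeries.coeff_mul]
  congr 1
  refine Finset.sum_congr rfl fun p hp => ?_
  rw [Finset.HasAntidiagonal.mem_antidiagonal] at hp
  rw [coeff_eulerD, coeff_eulerD, PowerSeries.coeff_mk, PowerSeries.coeff_mk, ← LinearMap.map_smul (ψ p.1), hψ, hp,
    coeff_halfSeries, coeff_halfSeries]

/-- The coproduct of φ(z) is the product of the commuting series φ(z) ⊗ 1 and 1 ⊗ φ(uz), so
logarithmic derivatives add. This is exactly the coproduct chosen for h. -/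
theorem delta_newton (ε : ℤˣ) (i : ι) :
    eulerD (halfSeries (deltaPhi P ε i) ε) =
      hConst ħ ε • (eulerD (halfSeries (deltaH H i) ε) * halfSeries (deltaPhi P ε i) ε) := by
  let ψ₁ : ℕ → 𝓐 →ₗ[ℂ] HahnSeries ℤ (𝓐 ⊗[ℂ] 𝓐) := fun _ =>
    { toFun := fun a => single 0 (a ⊗ₜ 1)
      map_add' := fun a b => by rw [TensorProduct.add_tmul, HahnSeries.single_add]
      map_smul' := fun c a => by rw [← TensorProduct.smul_tmul', ← smul_single, RingHom.id_apply] }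
  let ψ₂ : ℕ → 𝓐 →ₗ[ℂ] HahnSeries ℤ (𝓐 ⊗[ℂ] 𝓐) := fun m =>
    { toFun := fun a => single ((ε : ℤ) * m) (1 ⊗ₜ a)
      map_add' := fun a b => by rw [TensorProduct.tmul_add, HahnSeries.single_add]
      map_smul' := fun c a => by rw [TensorProduct.tmul_smul, ← smul_single, RingHom.id_apply] }
  have n1 := h.newton_graded ψ₁ (fun a b y z => by
    simp only [ψ₁, LinearMap.coe_mk, AddHom.coe_mk, HahnSeries.single_mul_single,
      Algebra.TensorProduct.tmul_mul_tmul, mul_one, add_zero]) ε i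
  have n2 := h.newton_graded ψ₂ (fun a b y z => by
    simp only [ψ₂, LinearMap.coe_mk, AddHom.coe_mk, HahnSeries.single_mul_single,
      Algebra.TensorProduct.tmul_mul_tmul, mul_one, Nat.cast_add, mul_add]) ε i
  set F₁ := PowerSeries.mk fun m => ψ₁ m (P ε i ((ε : ℤ) * m))
  set F₂ := PowerSeries.mk fun m => ψ₂ m (P ε i ((ε : ℤ) * m))
  set G₁ := PowerSeries.mk fun m => ψ₁ m (H i ((ε : ℤ) * m))
  set G₂ := PowerSeries.mk fun m => ψ₂ m (H i ((ε : ℤ) * m))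
  have eP : halfSeries (deltaPhi P ε i) ε = F₁ * F₂ := by
    ext1 m
    rw [coeff_halfSeries, PowerSeries.coeff_mul,
      ← Finset.Nat.sum_antidiagonal_swap (n := m), Finset.Nat.sum_antidiagonal_eq_sum_range_succ_mk,
      deltaPhi_natural]
    refine Finset.sum_congr rfl fun s hs => ?_
    have hs' : s ≤ m := by simpa [Nat.lt_succ_iff] using hs
    simp only [F₁, F₂, Prod.fst_swap, Prod.snd_swap, PowerSeries.coeff_mk, ψ₁, ψ₂,
      LinearMap.coe_mk, AddHom.coe_mk, HahnSeries.single_mul_single,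
      Algebra.TensorProduct.tmul_mul_tmul, mul_one, one_mul, zero_add, Nat.cast_sub hs']
  have eH : halfSeries (deltaH H i) ε = G₁ + G₂ := by
    ext1 m
    rw [coeff_halfSeries, map_add]
    simp only [G₁, G₂, PowerSeries.coeff_mk]
    rfl
  have hc : Commute F₁ (eulerD G₂) := by
    refine commute_powerSeries fun m n => ?_
    rw [coeff_eulerD]
    refine Commute.smul_right ?_ _
    simp only [F₁, G₂, PowerSeries.coeff_mk, ψ₁, ψ₂, LinearMap.coe_mk, AddHom.coe_mk,
      commute_iff_eq, HahnSeries.single_mul_single, Algebra.TensorProduct.tmul_mul_tmul, mul_one,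
      one_mul, zero_add, add_zero]
  rw [eP, eH, eulerD_mul, n1, n2, eulerD_add, mul_smul_comm, ← mul_assoc, hc.eq, smul_mul_assoc,
    ← smul_add, add_mul, mul_assoc, mul_assoc]

/-- The deformed coproduct satisfies the relations of the quantum affinization. -/
theorem delta (hq : NotRootOfUnity ħ) :
    IsPreRep R ħ h.deltaX (deltaK K) (deltaH H) (deltaPhi P) where
  k_add a b := by
    rw [deltaK, deltaK, HahnSeries.single_mul_single, Algebra.TensorProduct.tmul_mul_tmul,
      h.k_add, add_zero, deltaK]
  k_zero := by rw [deltaK, h.k_zero]; rfl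
  k_h a i m := by
    rw [deltaK, deltaH]
    simp only [mul_add, add_mul, HahnSeries.single_mul_single,
      Algebra.TensorProduct.tmul_mul_tmul, h.k_h, mul_one, one_mul, zero_add, add_zero]
  h_h i j m n := by
    rw [deltaH, deltaH]
    simp only [mul_add, add_mul, HahnSeries.single_mul_single,
      Algebra.TensorProduct.tmul_mul_tmul, h.h_h i j m n, mul_one, one_mul, zero_add, add_zero,
      add_comm m n]
    abel
  k_x := h.deltaK_deltaX
  phi_zero ε i := by
    have := deltaPhi_natural P ε i 0
    rw [Nat.cast_zero, mul_zero] at this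
    rw [this]
    simp [h.phi_zero, deltaK]
  phi_neg ε i n hn := by rw [deltaPhi, if_neg (not_le.2 hn)]
  newton := h.delta_newton
  h_x η ε i j m r := by
    rcases Nat.eq_zero_or_pos m with rfl | hm
    · simp only [Nat.cast_zero, mul_zero, pow_zero, sub_self]
      ext n
      rw [HahnSeries.coeff_smul, HahnSeries.coeff_smul, zero_smul, zero_smul]
    have hc : hConst ħ η * m ≠ 0 :=
      mul_ne_zero (hConst_ne_zero hq η) (by exact_mod_cast hm.ne')
    rw [h.deltaH_deltaX i ((η : ℤ) * m) ε j (β := (hConst ħ η * m)⁻¹ *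
      (qpow ħ ((η : ℤ) * (ε : ℤ) * A.B i j) ^ m - (qpow ħ ((η : ℤ) * (ε : ℤ) * A.B i j))⁻¹ ^ m))
      (fun r => by rw [← smul_smul, ← h.h_x, smul_smul, inv_mul_cancel₀ hc, one_smul]),
      smul_smul, mul_inv_cancel_left₀ hc]
  x_pm_same i r s := h.deltaX_comm i i r s (h.x_pm_same i) (Or.inl rfl)
  x_pm_ne i j hij r s := by
    rw [h.deltaX_comm i j r s (κ := 0) (fun r s => by rw [h.x_pm_ne i j hij, zero_smul])
      (Or.inr rfl)]
    ext n
    rw [HahnSeries.coeff_smul, zero_smul, HahnSeries.coeff_zero]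
  x_x := h.deltaX_exchange

end IsPreRep

end

/-! ### Laurent expansions of elements of `ℂ(u) ⊗ E` -/

open HahnSeries (single)

section HahnMap

variable {𝓐 𝓑 : Type*} [Ring 𝓐] [Algebra ℂ 𝓐] [Ring 𝓑] [Algebra ℂ 𝓑]

/-- The coefficientwise application of a ring morphism. -/
def hahnRingMap (f : 𝓐 →+* 𝓑) : HahnSeries ℤ 𝓐 →+* HahnSeries ℤ 𝓑 where
  toFun D := D.map f
  map_one' := by
    ext n
    simp only [HahnSeries.map_coeff, HahnSeries.coeff_one]
    split_ifs <;> simp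
  map_mul' D E := HahnSeries.map_mul (f : 𝓐 →ₙ+* 𝓑)
  map_zero' := by ext n; simp
  map_add' D E := by ext n; simp

/-- The coefficientwise application of an algebra morphism. -/
def hahnMap (f : 𝓐 →ₐ[ℂ] 𝓑) : HahnSeries ℤ 𝓐 →ₐ[ℂ] HahnSeries ℤ 𝓑 where
  __ := hahnRingMap f.toRingHom
  commutes' c := by
    ext n
    change f ((algebraMap ℂ (HahnSeries ℤ 𝓐) c).coeff n) = _
    simp only [HahnSeries.algebraMap_apply, HahnSeries.C_apply, HahnSeries.coeff_single]
    split_ifs <;> simp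

@[simp] theorem coeff_hahnMap (f : 𝓐 →ₐ[ℂ] 𝓑) (D : HahnSeries ℤ 𝓐) (n : ℤ) :
    (hahnMap f D).coeff n = f (D.coeff n) := rfl

end HahnMap

section Expansion

variable {E E' : Type*} [AddCommGroup E] [Module ℂ E] [AddCommGroup E'] [Module ℂ E']

/-- The coefficient of `u ^ n`. -/
def coeffMap (E : Type*) [AddCommGroup E] [Module ℂ E] (n : ℤ) : Cu ⊗[ℂ] E →ₗ[ℂ] E :=
  (TensorProduct.lid ℂ E).toLinearMap ∘ₗ LinearMap.rTensor E (uCoeff n)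

@[simp] theorem coeffMap_tmul (n : ℤ) (f : Cu) (e : E) :
    coeffMap E n (f ⊗ₜ e) = uCoeff n f • e := by simp [coeffMap]

theorem coeffMap_baseChange (n : ℤ) (g : E →ₗ[ℂ] E') (y : Cu ⊗[ℂ] E) :
    coeffMap E' n (g.baseChange Cu y) = g (coeffMap E n y) := by
  induction y with
  | zero => simp
  | tmul f e => simp
  | add y z hy hz => simp only [map_add, hy, hz]

theorem uCoeff_one (n : ℤ) : uCoeff n 1 = if n = 0 then 1 else 0 := by
  simp [uCoeff, HahnSeries.coeff_one]

theorem coeffMap_one_tmul (n : ℤ) (e : E) :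
    coeffMap E n (1 ⊗ₜ e) = if n = 0 then e else 0 := by
  rw [coeffMap_tmul, uCoeff_one]; split_ifs <;> simp

theorem exists_coeffMap_eq_zero (y : Cu ⊗[ℂ] E) : ∃ N : ℤ, ∀ n < N, coeffMap E n y = 0 := by
  induction y with
  | zero => exact ⟨0, by simp⟩
  | tmul f e =>
    refine ⟨(cuToLaurent f).order, fun n hn => ?_⟩
    rw [coeffMap_tmul]
    have : uCoeff n f = 0 := HahnSeries.coeff_eq_zero_of_lt_order hn
    rw [this, zero_smul]
  | add y z hy hz =>
    obtain ⟨N, hN⟩ := hy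
    obtain ⟨N', hN'⟩ := hz
    exact ⟨min N N', fun n hn => by
      rw [map_add, hN n (lt_min_iff.1 hn).1, hN' n (lt_min_iff.1 hn).2, add_zero]⟩

/-- In coordinates for a basis of E, this is the injectivity of the Laurent expansion of a rational
function. -/
theorem eq_zero_of_coeffMap_eq_zero {y : Cu ⊗[ℂ] E} (h : ∀ n, coeffMap E n y = 0) : y = 0 := by
  have b := Module.Basis.ofVectorSpace ℂ E
  have key : ∀ (y : Cu ⊗[ℂ] E) n i,
      uCoeff n ((b.baseChange Cu).repr y i) = b.repr (coeffMap E n y) i := by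
    intro y n i
    induction y with
    | zero => simp
    | tmul f e => simp [mul_comm]
    | add y z hy hz => simp only [map_add, Finsupp.add_apply, hy, hz]
  apply (b.baseChange Cu).repr.injective
  ext i
  rw [map_zero, Finsupp.zero_apply]
  apply (cuToLaurent).injective
  ext n
  have := key y n i
  rw [h n, map_zero, Finsupp.zero_apply] at this
  rw [map_zero, HahnSeries.coeff_zero]
  exact this

/-- The Laurent expansion of an element of `ℂ(u) ⊗ E`. -/
def toHahn : Cu ⊗[ℂ] E →+ HahnModule ℤ (Module.End ℂ E) E where
  toFun y := HahnModule.of _ (HahnSeries.ofSuppBddBelow (fun n => coeffMap E n y) (by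
    obtain ⟨N, hN⟩ := exists_coeffMap_eq_zero y
    exact ⟨N, fun n hn => by
      by_contra hlt
      exact hn (hN n (not_le.1 hlt))⟩))
  map_zero' := by
    ext n
    change coeffMap E n 0 = 0
    rw [map_zero]
  map_add' y z := by
    ext n
    exact map_add (coeffMap E n) y z

/-- The coefficients of an element of the module of formal series. -/
def hcoeff (z : HahnModule ℤ (Module.End ℂ E) E) (n : ℤ) : E :=
  ((HahnModule.of (Module.End ℂ E)).symm z).coeff n

@[simp] theorem hcoeff_toHahn (y : Cu ⊗[ℂ] E) (n : ℤ) : hcoeff (toHahn y) n = coeffMap E n y := rfl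

@[simp] theorem hcoeff_zero (n : ℤ) : hcoeff (0 : HahnModule ℤ (Module.End ℂ E) E) n = 0 := rfl

theorem hahnModule_ext {y z : HahnModule ℤ (Module.End ℂ E) E} (h : ∀ n, hcoeff y n = hcoeff z n) :
    y = z := HahnModule.ext _ _ (funext h)

theorem toHahn_injective : Function.Injective (toHahn (E := E)) := by
  rw [injective_iff_map_eq_zero]
  intro y hy
  refine eq_zero_of_coeffMap_eq_zero fun n => ?_
  rw [← hcoeff_toHahn, hy, hcoeff_zero]

theorem hcoeff_smul (D : HahnSeries ℤ (Module.End ℂ E)) (z : HahnModule ℤ (Module.End ℂ E) E)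
    (n : ℤ) : hcoeff (D • z) n = ∑ᶠ k, D.coeff k (hcoeff z (n - k)) := by
  classical
  have hfin := Set.VAddAntidiagonal.finite_of_isPWO D.isPWO_support
      ((HahnModule.of _).symm z).isPWO_support n
  have hinj : Set.InjOn Prod.fst (Finset.VAddAntidiagonal n hfin : Set (ℤ × ℤ)) := by
    rintro ⟨a, b⟩ hab ⟨c, d⟩ hcd h
    rw [Finset.mem_coe, Finset.mem_vaddAntidiagonal] at hab hcd
    simp only [vadd_eq_add] at h hab hcd
    ext <;> simp <;> omega
  rw [hcoeff, HahnModule.coeff_smul, finsum_eq_sum_of_support_subset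
    (s := (Finset.VAddAntidiagonal n hfin).image Prod.fst), Finset.sum_image hinj]
  · refine Finset.sum_congr rfl fun p hp => ?_
    rw [Finset.mem_vaddAntidiagonal, vadd_eq_add] at hp
    rw [← hp.2.2, add_sub_cancel_left]
    rfl
  · intro k hk
    rw [Finset.mem_coe, Finset.mem_image]
    refine ⟨(k, n - k), ?_, rfl⟩
    rw [Finset.mem_vaddAntidiagonal]
    refine ⟨fun h0 => hk ?_, fun h0 => hk ?_, by simp⟩
    · simp [h0]
    · exact (congrArg _ h0).trans (map_zero _)

theorem hahn_mul_smul (D D' : HahnSeries ℤ (Module.End ℂ E))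
    (z : HahnModule ℤ (Module.End ℂ E) E) : (D * D') • z = D • D' • z := mul_smul D D' z

theorem hahn_add_smul (D D' : HahnSeries ℤ (Module.End ℂ E))
    (z : HahnModule ℤ (Module.End ℂ E) E) : (D + D') • z = D • z + D' • z := add_smul D D' z

theorem hahn_smul_add (D : HahnSeries ℤ (Module.End ℂ E))
    (z w : HahnModule ℤ (Module.End ℂ E) E) : D • (z + w) = D • z + D • w := smul_add D z w

theorem hahn_one_smul (z : HahnModule ℤ (Module.End ℂ E) E) :
    (1 : HahnSeries ℤ (Module.End ℂ E)) • z = z := one_smul _ z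

theorem hahn_zero_smul (z : HahnModule ℤ (Module.End ℂ E) E) :
    (0 : HahnSeries ℤ (Module.End ℂ E)) • z = 0 :=
  HahnModule.zero_smul'

theorem hahn_smul_zero (D : HahnSeries ℤ (Module.End ℂ E)) :
    D • (0 : HahnModule ℤ (Module.End ℂ E) E) = 0 := smul_zero D

/-- The coefficients of `D • e` for a constant `e`. -/
theorem hcoeff_smul_one_tmul (D : HahnSeries ℤ (Module.End ℂ E)) (e : E) (n : ℤ) :
    hcoeff (D • toHahn (1 ⊗ₜ e)) n = D.coeff n e := by
  rw [hcoeff_smul, finsum_eq_single _ n]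
  · rw [hcoeff_toHahn, sub_self, coeffMap_one_tmul, if_pos rfl]
  · intro k hk
    rw [hcoeff_toHahn, coeffMap_one_tmul, if_neg (by omega), map_zero]

theorem hcoeff_single_smul (m : ℤ) (D : Module.End ℂ E) (z : HahnModule ℤ (Module.End ℂ E) E)
    (n : ℤ) : hcoeff ((single m D : HahnSeries ℤ (Module.End ℂ E)) • z) n =
      D (hcoeff z (n - m)) := by
  rw [hcoeff_smul, finsum_eq_single _ m]
  · simp
  · intro k hk
    simp [HahnSeries.coeff_single_of_ne hk]

/-- Rational functions as central formal series of endomorphisms. -/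
def cuHahn (E : Type*) [AddCommGroup E] [Module ℂ E] : Cu →+* HahnSeries ℤ (Module.End ℂ E) :=
  (hahnRingMap (algebraMap ℂ (Module.End ℂ E))).comp cuToLaurent

theorem coeff_cuHahn (f : Cu) (n : ℤ) :
    (cuHahn E f).coeff n = algebraMap ℂ (Module.End ℂ E) (uCoeff n f) := rfl

/-- Centrality of the rational functions makes the action of formal series linear over ℂ(u), so
rationality can be tested on constant vectors. -/
theorem cuHahn_mul_comm (f : Cu) (D : HahnSeries ℤ (Module.End ℂ E)) :
    cuHahn E f * D = D * cuHahn E f := by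
  ext1
  funext n
  rw [coeff_mul_eq_finsum, coeff_mul_eq_finsum']
  refine finsum_congr fun k => ?_
  rw [coeff_cuHahn, Algebra.commutes]

theorem cuToLaurent_uPow (m : ℤ) : cuToLaurent (uPow m) = single m 1 := by
  rw [uPow, map_zpow₀]
  have : cuToLaurent RatFunc.X = single 1 1 := by
    simp [cuToLaurent]
  rw [this]
  exact (RatFunc.single_zpow m).symm

theorem uCoeff_uPow (m n : ℤ) : uCoeff n (uPow m) = if n = m then 1 else 0 := by
  change (cuToLaurent (uPow m)).coeff n = _
  rw [cuToLaurent_uPow, HahnSeries.coeff_single]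
  congr

theorem cuHahn_uPow (m : ℤ) : cuHahn E (uPow m) = single m 1 := by
  ext1
  funext n
  rw [coeff_cuHahn, uCoeff_uPow, HahnSeries.coeff_single]
  split_ifs <;> simp

theorem toHahn_smul (f : Cu) (y : Cu ⊗[ℂ] E) : toHahn (f • y) = cuHahn E f • toHahn y := by
  have key : ∀ (g : Cu) (e : E), toHahn (g ⊗ₜ e) = cuHahn E g • toHahn (1 ⊗ₜ e) := by
    intro g e
    refine hahnModule_ext fun n => ?_
    rw [hcoeff_smul_one_tmul, hcoeff_toHahn, coeffMap_tmul, coeff_cuHahn,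
      Module.algebraMap_end_apply]
  induction y with
  | zero => rw [smul_zero, map_zero, hahn_smul_zero]
  | tmul g e => rw [TensorProduct.smul_tmul', smul_eq_mul, key, key g, map_mul, hahn_mul_smul]
  | add y z hy hz => rw [smul_add, map_add, map_add, hy, hz, hahn_smul_add]

theorem coeffMap_uPow_smul (m n : ℤ) (y : Cu ⊗[ℂ] E) :
    coeffMap E n (uPow m • y) = coeffMap E (n - m) y := by
  rw [← hcoeff_toHahn, toHahn_smul, cuHahn_uPow, hcoeff_single_smul]
  rfl

theorem smul_toHahn_smul (f : Cu) (D : HahnSeries ℤ (Module.End ℂ E)) (y : Cu ⊗[ℂ] E) :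
    D • toHahn (f • y) = cuHahn E f • D • toHahn y := by
  rw [toHahn_smul, ← hahn_mul_smul, ← hahn_mul_smul, cuHahn_mul_comm]

theorem cuHahn_algebraMap (c : ℂ) :
    cuHahn E (algebraMap ℂ Cu c) = algebraMap ℂ (HahnSeries ℤ (Module.End ℂ E)) c := by
  refine HahnSeries.ext (funext fun n => ?_)
  have : uCoeff n (algebraMap ℂ Cu c) = if n = 0 then c else 0 := by
    rw [Algebra.algebraMap_eq_smul_one, map_smul, uCoeff_one, smul_eq_mul, mul_ite, mul_one,
      mul_zero]
  rw [coeff_cuHahn, this, HahnSeries.algebraMap_apply, HahnSeries.C_apply,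
    HahnSeries.coeff_single]
  split_ifs <;> simp

variable (E) in
/-- The formal series of endomorphisms of `E` that preserve `ℂ(u) ⊗ E`. -/
def rationalEnd : Subalgebra ℂ (HahnSeries ℤ (Module.End ℂ E)) where
  carrier := {D | ∀ y : Cu ⊗[ℂ] E, ∃ z, toHahn z = D • toHahn y}
  mul_mem' {D D'} hD hD' y := by
    obtain ⟨z, hz⟩ := hD' y
    obtain ⟨w, hw⟩ := hD z
    exact ⟨w, by rw [hw, hz, hahn_mul_smul]⟩
  add_mem' {D D'} hD hD' y := by
    obtain ⟨z, hz⟩ := hD y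
    obtain ⟨w, hw⟩ := hD' y
    exact ⟨z + w, by rw [map_add, hz, hw, hahn_add_smul]⟩
  algebraMap_mem' c y := by
    exact ⟨algebraMap ℂ Cu c • y, by rw [toHahn_smul, cuHahn_algebraMap]⟩

/-- By linearity over ℂ(u), preserving ℂ(u) ⊗ E only has to be tested on constants from a spanning
set, where the action just lists the coefficients of D. -/
theorem mem_rationalEnd_iff {D : HahnSeries ℤ (Module.End ℂ E)} {S : Set E}
    (hS : Submodule.span ℂ S = ⊤) :
    D ∈ rationalEnd E ↔ ∀ e ∈ S, ∃ z : Cu ⊗[ℂ] E, ∀ n, coeffMap E n z = D.coeff n e := by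
  constructor
  · intro hD e _
    obtain ⟨z, hz⟩ := hD (1 ⊗ₜ e)
    exact ⟨z, fun n => by rw [← hcoeff_toHahn, hz, hcoeff_smul_one_tmul]⟩
  · intro hD y
    have key : ∀ e : E, ∃ z : Cu ⊗[ℂ] E, toHahn z = D • toHahn (1 ⊗ₜ e) := by
      intro e
      have he : e ∈ Submodule.span ℂ S := hS ▸ Submodule.mem_top
      induction he using Submodule.span_induction with
      | mem e he =>
        obtain ⟨z, hz⟩ := hD e he
        exact ⟨z, hahnModule_ext fun n => by rw [hcoeff_toHahn, hz, hcoeff_smul_one_tmul]⟩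
      | zero => exact ⟨0, by simp⟩
      | add e e' _ _ h h' =>
        obtain ⟨z, hz⟩ := h
        obtain ⟨z', hz'⟩ := h'
        exact ⟨z + z', by rw [map_add, hz, hz', TensorProduct.tmul_add, map_add, hahn_smul_add]⟩
      | smul c e _ h =>
        obtain ⟨z, hz⟩ := h
        refine ⟨algebraMap ℂ Cu c • z, ?_⟩
        rw [toHahn_smul, hz, ← smul_toHahn_smul, algebraMap_smul, TensorProduct.tmul_smul]
    induction y with
    | zero => exact ⟨0, by simp⟩
    | tmul f e =>
      obtain ⟨z, hz⟩ := key e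
      refine ⟨f • z, ?_⟩
      rw [toHahn_smul, hz, ← smul_toHahn_smul, TensorProduct.smul_tmul', smul_eq_mul, mul_one]
    | add y z hy hz =>
      obtain ⟨y', hy'⟩ := hy
      obtain ⟨z', hz'⟩ := hz
      exact ⟨y' + z', by rw [map_add, hy', hz', map_add, hahn_smul_add]⟩

/-- The action of a formal series of endomorphisms that preserves `ℂ(u) ⊗ E`. -/
def rationalActFun (D : rationalEnd E) (y : Cu ⊗[ℂ] E) : Cu ⊗[ℂ] E := (D.2 y).choose

theorem toHahn_rationalActFun (D : rationalEnd E) (y : Cu ⊗[ℂ] E) :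
    toHahn (rationalActFun D y) = (D : HahnSeries ℤ (Module.End ℂ E)) • toHahn y :=
  (D.2 y).choose_spec

/-- The action on `ℂ(u) ⊗ E` of the formal series that preserve it. -/
def rationalAct : rationalEnd E →ₐ[ℂ] Module.End Cu (Cu ⊗[ℂ] E) where
  toFun D :=
    { toFun := rationalActFun D
      map_add' := fun y z => toHahn_injective (by
        simp only [map_add, toHahn_rationalActFun, hahn_smul_add])
      map_smul' := fun f y => toHahn_injective (by
        simp only [RingHom.id_apply, toHahn_smul, toHahn_rationalActFun, ← hahn_mul_smul,
          cuHahn_mul_comm]) }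
  map_one' := LinearMap.ext fun y => toHahn_injective (by
    simp only [LinearMap.coe_mk, AddHom.coe_mk, toHahn_rationalActFun, OneMemClass.coe_one,
      hahn_one_smul, Module.End.one_apply])
  map_mul' D D' := LinearMap.ext fun y => toHahn_injective (by
    simp only [LinearMap.coe_mk, AddHom.coe_mk, toHahn_rationalActFun, MulMemClass.coe_mul,
      hahn_mul_smul, Module.End.mul_apply])
  map_zero' := LinearMap.ext fun y => toHahn_injective (by
    simp only [LinearMap.coe_mk, AddHom.coe_mk, toHahn_rationalActFun, ZeroMemClass.coe_zero,
      hahn_zero_smul, LinearMap.zero_apply, map_zero])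
  map_add' D D' := LinearMap.ext fun y => toHahn_injective (by
    simp only [LinearMap.coe_mk, AddHom.coe_mk, toHahn_rationalActFun, AddMemClass.coe_add,
      hahn_add_smul, LinearMap.add_apply, map_add])
  commutes' c := LinearMap.ext fun y => toHahn_injective (by
    rw [Module.algebraMap_end_apply, ← algebraMap_smul Cu c y, toHahn_smul, cuHahn_algebraMap]
    exact toHahn_rationalActFun _ _)

theorem toHahn_rationalAct (D : rationalEnd E) (y : Cu ⊗[ℂ] E) :
    toHahn (rationalAct D y) = (D : HahnSeries ℤ (Module.End ℂ E)) • toHahn y :=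
  toHahn_rationalActFun D y

end Expansion

/-! ### Recurrent sequences are expansions of rational functions -/

section Recurrent

variable {E E' E'' : Type*} [AddCommGroup E] [Module ℂ E] [AddCommGroup E'] [Module ℂ E']
  [AddCommGroup E''] [Module ℂ E'']

/-- A sequence satisfies a linear recurrence with constant coefficients: it lies in a finite
dimensional space of sequences stable under the shift. -/
def IsRecurrent (a : ℕ → E) : Prop :=
  ∃ S : Submodule ℂ (ℕ → E), S.FG ∧ (∀ b ∈ S, (fun n => b (n + 1)) ∈ S) ∧ a ∈ S

theorem IsRecurrent.add {a b : ℕ → E} (ha : IsRecurrent a) (hb : IsRecurrent b) :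
    IsRecurrent fun n => a n + b n := by
  obtain ⟨S, hS, hS', haS⟩ := ha
  obtain ⟨T, hT, hT', hbT⟩ := hb
  refine ⟨S ⊔ T, hS.sup hT, fun c hc => ?_, Submodule.add_mem_sup haS hbT⟩
  obtain ⟨s, hs, t, ht, rfl⟩ := Submodule.mem_sup.1 hc
  exact Submodule.add_mem_sup (hS' s hs) (hT' t ht)

theorem IsRecurrent.map {a : ℕ → E} (ha : IsRecurrent a) (g : E →ₗ[ℂ] E') :
    IsRecurrent fun n => g (a n) := by
  obtain ⟨S, hS, hS', haS⟩ := ha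
  refine ⟨S.map (g.compLeft ℕ), hS.map _, ?_, ⟨a, haS, rfl⟩⟩
  rintro _ ⟨b, hb, rfl⟩
  exact ⟨_, hS' b hb, rfl⟩

/-- The shift acts on both sequences simultaneously, so it preserves the finite dimensional space
spanned by termwise products. This is used for the tensor products of modes of x and φ. -/
theorem IsRecurrent.map₂ {a : ℕ → E} {b : ℕ → E'} (ha : IsRecurrent a) (hb : IsRecurrent b)
    (g : E →ₗ[ℂ] E' →ₗ[ℂ] E'') : IsRecurrent fun n => g (a n) (b n) := by
  obtain ⟨S, hS, hS', haS⟩ := ha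
  obtain ⟨T, hT, hT', hbT⟩ := hb
  let G : (ℕ → E) →ₗ[ℂ] (ℕ → E') →ₗ[ℂ] (ℕ → E'') := LinearMap.mk₂ ℂ (fun s t n => g (s n) (t n))
    (fun _ _ _ => by ext; simp) (fun _ _ _ => by ext; simp) (fun _ _ _ => by ext; simp)
    (fun _ _ _ => by ext; simp)
  refine ⟨Submodule.map₂ G S T, hS.map₂ _ hT, fun c hc => ?_, Submodule.apply_mem_map₂ G haS hbT⟩
  refine (Submodule.map₂_le (r := (Submodule.map₂ G S T).comap
    (LinearMap.funLeft ℂ E'' Nat.succ))).2 (fun s hs t ht => ?_) hc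
  exact Submodule.apply_mem_map₂ G (hS' s hs) (hT' t ht)

/-- The sequences attached to all starting vectors form the image of F, and the shift corresponds to
applying T to the starting vector. -/
theorem isRecurrent_of_iterate {F : Type*} [AddCommGroup F] [Module ℂ F] [Module.Finite ℂ F]
    (T : Module.End ℂ F) (g : F →ₗ[ℂ] E) (f : F) : IsRecurrent fun n => g ((T ^ n) f) := by
  let G : F →ₗ[ℂ] (ℕ → E) := LinearMap.pi fun n => g ∘ₗ (T ^ n)
  refine ⟨LinearMap.range G, (Module.Finite.fg_top).map G |> fun h => by
    rwa [Submodule.map_top] at h, ?_, ⟨f, rfl⟩⟩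
  rintro _ ⟨f', rfl⟩
  refine ⟨T f', ?_⟩
  ext n
  simp [G, pow_succ]

/-- With T the shift on the finite dimensional space S, the generating series is the term of index 0
of (1 - uT)⁻¹ a. The operator 1 - uT is invertible over ℂ(u), so this is a rational element. -/
theorem IsRecurrent.exists_coeffMap_eq {a : ℕ → E} (ha : IsRecurrent a) :
    ∃ z : Cu ⊗[ℂ] E, ∀ n : ℤ, coeffMap E n z = if 0 ≤ n then a n.toNat else 0 := by
  obtain ⟨S, hS, hS', haS⟩ := ha
  have : Module.Finite ℂ S := Module.Finite.iff_fg.2 hS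
  let T : Module.End ℂ S := LinearMap.restrict (LinearMap.funLeft ℂ E Nat.succ) hS'
  let L : Module.End Cu (Cu ⊗[ℂ] S) := 1 - uPow 1 • T.baseChange Cu
  have hL : ∀ y n, coeffMap S n (L y) = coeffMap S n y - T (coeffMap S (n - 1) y) := by
    intro y n
    simp only [L, LinearMap.sub_apply, Module.End.one_apply, LinearMap.smul_apply, map_sub,
      coeffMap_uPow_smul, coeffMap_baseChange]
  -- An element of the kernel has coefficients y_n = T y_{n-1}; these vanish far to the left, hence
  -- everywhere. Finite dimension over ℂ(u) then gives surjectivity.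
  have hinj : Function.Injective L := by
    rw [injective_iff_map_eq_zero]
    intro y hy
    obtain ⟨N, hN⟩ := exists_coeffMap_eq_zero y
    have hstep : ∀ n, coeffMap S n y = T (coeffMap S (n - 1) y) := fun n => by
      rw [← sub_eq_zero, ← hL, hy, map_zero]
    have hpos : ∀ k : ℕ, coeffMap S (N + k) y = 0 := by
      intro k
      induction k with
      | zero => rw [hstep, hN _ (by simp), map_zero]
      | succ k ih => rw [hstep, show N + ((k + 1 : ℕ) : ℤ) - 1 = N + k by push_cast; ring, ih, map_zero]
    refine eq_zero_of_coeffMap_eq_zero fun n => ?_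
    rcases lt_or_ge n N with hn | hn
    · exact hN n hn
    · have := hpos (n - N).toNat
      rwa [Int.toNat_of_nonneg (by omega), add_sub_cancel] at this
  obtain ⟨y, hy⟩ := LinearMap.surjective_of_injective hinj (1 ⊗ₜ ⟨a, haS⟩)
  obtain ⟨N, hN⟩ := exists_coeffMap_eq_zero y
  have hstep : ∀ n, coeffMap S n y = T (coeffMap S (n - 1) y) + if n = 0 then ⟨a, haS⟩ else 0 :=
    fun n => by rw [← coeffMap_one_tmul, ← hy, hL, add_sub_cancel]
  have hneg : ∀ n < 0, coeffMap S n y = 0 := by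
    have : ∀ k : ℕ, N + k < 0 → coeffMap S (N + k) y = 0 := by
      intro k
      induction k with
      | zero => exact fun h => by rw [hstep, hN _ (by simp), map_zero, if_neg h.ne, zero_add]
      | succ k ih =>
        intro h
        rw [hstep, show N + ((k + 1 : ℕ) : ℤ) - 1 = N + k by push_cast; ring,
          ih (by push_cast at h; omega), map_zero, if_neg h.ne, zero_add]
    intro n hn
    rcases lt_or_ge n N with h | h
    · exact hN n h
    · have h' := this (n - N).toNat
      rw [Int.toNat_of_nonneg (by omega), add_sub_cancel] at h'
      exact h' hn
  have hpos : ∀ k : ℕ, coeffMap S (k : ℤ) y = (T ^ k) ⟨a, haS⟩ := by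
    intro k
    induction k with
    | zero => rw [hstep, hneg _ (by simp), map_zero]; simp
    | succ k ih =>
      rw [hstep, show ((k + 1 : ℕ) : ℤ) - 1 = k by push_cast; ring, ih, if_neg (by omega),
        add_zero, pow_succ', Module.End.mul_apply]
  have hT : ∀ k m : ℕ, ((T ^ k) ⟨a, haS⟩ : ℕ → E) m = a (m + k) := by
    intro k
    induction k with
    | zero => simp
    | succ k ih =>
      intro m
      rw [pow_succ', Module.End.mul_apply]
      change ((T ^ k) ⟨a, haS⟩ : ℕ → E) (m + 1) = _
      rw [ih]
      congr 1
      ring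
  refine ⟨(LinearMap.proj 0 ∘ₗ S.subtype).baseChange Cu y, fun n => ?_⟩
  rw [coeffMap_baseChange]
  split_ifs with hn
  · lift n to ℕ using hn
    rw [hpos]
    simp [hT]
  · rw [hneg n (not_le.1 hn), map_zero]

/-- A sequence indexed by `ℤ` that satisfies a first order recurrence in both directions in a
finite dimensional space is spanned by its values far away. -/
theorem mem_span_of_recurrence {F : Type*} [AddCommGroup F] [Module ℂ F] [Module.Finite ℂ F]
    {y : ℤ → F} {T' : Module.End ℂ F} (hT' : ∀ n, y (n - 1) = T' (y n)) (N n : ℤ) :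
    y n ∈ Submodule.span ℂ (y '' Set.Ici N) := by
  let W : ℤ → Submodule ℂ F := fun m => Submodule.span ℂ (y '' Set.Ici m)
  have hanti : Antitone W := fun a b hab =>
    Submodule.span_mono (Set.image_mono (Set.Ici_subset_Ici.2 hab))
  let c : ℕ →o (Submodule ℂ F)ᵒᵈ := ⟨fun m => OrderDual.toDual (W m), fun a b hab =>
    hanti (by exact_mod_cast hab)⟩
  -- The spans W m of the values at indices ≥ m decrease in a finite dimensional space, so they are
  -- eventually constant. From there on each y k lies in the span of the later values.
  obtain ⟨m, hm⟩ := IsArtinian.monotone_stabilizes c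
  have h1 : ∀ k : ℕ, m ≤ k → y k ∈ W (k + 1) := by
    intro k hk
    have h : W k = W ((k + 1 : ℕ) : ℤ) :=
      OrderDual.toDual.injective ((hm k hk).symm.trans (hm (k + 1) (by omega)))
    push_cast at h
    rw [← h]
    exact Submodule.subset_span ⟨k, Set.mem_Ici.2 le_rfl, rfl⟩
  -- Applying T' shifts a linear relation between values one step to the left, so the property
  -- spreads from large indices to all of them.
  have h2 : ∀ k, y k ∈ W (k + 1) → y (k - 1) ∈ W (k - 1 + 1) := by
    intro k hk
    rw [hT', sub_add_cancel]
    have := Submodule.mem_map_of_mem (f := T') hk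
    rw [Submodule.map_span] at this
    refine Submodule.span_mono ?_ this
    rintro _ ⟨_, ⟨l, hl, rfl⟩, rfl⟩
    exact ⟨l - 1, by rw [Set.mem_Ici] at hl ⊢; omega, hT' l⟩
  have h3 : ∀ k, y k ∈ W (k + 1) := by
    have h4 : ∀ (j : ℕ) (k : ℤ), m ≤ k + j → y k ∈ W (k + 1) := by
      intro j
      induction j with
      | zero =>
        intro k hk
        lift k to ℕ using by simp at hk; omega
        exact h1 k (by simpa using hk)
      | succ j ih =>
        intro k hk
        have := h2 (k + 1) (ih (k + 1) (by push_cast at hk; omega))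
        rwa [add_sub_cancel_right] at this
    exact fun k => h4 (m - k).toNat k (by omega)
  have h5 : ∀ k, W k ≤ W (k + 1) := by
    intro k
    refine Submodule.span_le.2 ?_
    rintro _ ⟨l, hl, rfl⟩
    rcases eq_or_lt_of_le (Set.mem_Ici.1 hl) with rfl | hl
    · exact h3 k
    · exact Submodule.subset_span ⟨l, Set.mem_Ici.2 hl, rfl⟩
  have h6 : ∀ j : ℕ, W n ≤ W (n + j) := by
    intro j
    induction j with
    | zero => simp
    | succ j ih => refine ih.trans ((h5 _).trans_eq ?_); push_cast; rw [add_assoc]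
  have : y n ∈ W (n + (N - n).toNat) :=
    h6 _ (Submodule.subset_span ⟨n, Set.mem_Ici.2 le_rfl, rfl⟩)
  exact hanti (by omega) this

end Recurrent

/-! ### Recurrences for the modes on weight spaces -/

section Weight

variable {ι : Type*} [Fintype ι] {𝔥 : Type*} [AddCommGroup 𝔥] [Module ℚ 𝔥]
  {A : CartanDatum ι} {R : Realization A 𝔥} {ħ : ℂ}
  {V : Type*} [AddCommGroup V] [Module ℂ V] {ρ : U R ħ →ₐ[ℂ] Module.End ℂ V}

theorem mem_weightSpace {ω : Module.Dual ℚ 𝔥} {v : V} :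
    v ∈ weightSpace ρ ω ↔ ∀ a, ρ (k R ħ a) v = qpow ħ (ω a) • v := by
  simp [weightSpace, Submodule.mem_iInf, sub_eq_zero]

theorem map_x_mem_weightSpace (ε : ℤˣ) (i : ι) (n : ℤ) {ω : Module.Dual ℚ 𝔥} {v : V}
    (hv : v ∈ weightSpace ρ ω) :
    ρ (x R ħ ε i n) v ∈ weightSpace ρ (ω + (ε : ℤ) • R.root i) := by
  rw [mem_weightSpace] at hv ⊢
  intro a
  rw [← Module.End.mul_apply, ← map_mul, (isPreRep_U R ħ).k_x, map_smul, map_mul,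
    LinearMap.smul_apply, Module.End.mul_apply, hv, map_smul, smul_smul, ← qpow_add, add_comm]
  simp

theorem map_mem_weightSpace_of_commute {g : U R ħ} (hg : ∀ a, k R ħ a * g = g * k R ħ a)
    {ω : Module.Dual ℚ 𝔥} {v : V} (hv : v ∈ weightSpace ρ ω) : ρ g v ∈ weightSpace ρ ω := by
  rw [mem_weightSpace] at hv ⊢
  intro a
  rw [← Module.End.mul_apply, ← map_mul, hg, map_mul, Module.End.mul_apply, hv, map_smul]

theorem map_phi_mem_weightSpace (ε : ℤˣ) (i : ι) (n : ℤ) {ω : Module.Dual ℚ 𝔥} {v : V}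
    (hv : v ∈ weightSpace ρ ω) : ρ (phi R ħ ε i n) v ∈ weightSpace ρ ω :=
  map_mem_weightSpace_of_commute (fun a => ((isPreRep_U R ħ).k_phi a ε i n).eq) hv

/-- On a finite dimensional weight space, the operators `x^ε_{i,n}` satisfy first order
recurrences. -/
theorem exists_x_recurrence (hq : NotRootOfUnity ħ) (ε η : ℤˣ) (i : ι) (ω : Module.Dual ℚ 𝔥) :
    ∃ T : Module.End ℂ (weightSpace ρ ω →ₗ[ℂ] weightSpace ρ (ω + (ε : ℤ) • R.root i)), ∀ n,
      (ρ (x R ħ ε i (n + (η : ℤ)))).restrict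
          (fun _ hv => map_x_mem_weightSpace ε i (n + (η : ℤ)) hv) =
        T ((ρ (x R ħ ε i n)).restrict fun _ hv => map_x_mem_weightSpace ε i n hv) := by
  obtain ⟨β, hβ, hc⟩ := (isPreRep_U R ħ).exists_h_comm hq ε i i (m := (η : ℤ)) (by simp)
  have hβ0 : β ≠ 0 := hβ (by
    rw [A.B_self]
    have := A.r_pos i
    positivity)
  have hk : ∀ a, k R ħ a * hU R ħ i η = hU R ħ i η * k R ħ a := fun a => U.k_h a i η
  let L : Module.End ℂ (weightSpace ρ (ω + (ε : ℤ) • R.root i)) :=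
    (ρ (hU R ħ i η)).restrict fun _ hv => map_mem_weightSpace_of_commute hk hv
  let L' : Module.End ℂ (weightSpace ρ ω) :=
    (ρ (hU R ħ i η)).restrict fun _ hv => map_mem_weightSpace_of_commute hk hv
  -- The recurrence operator is the commutator with h_{i,±1}, divided by the constant of the
  -- relation between h and x. That constant is nonzero because B_{i,i} = 2 r_i.
  refine ⟨β⁻¹ • (LinearMap.llcomp ℂ _ _ _ L - LinearMap.lcomp ℂ _ L'), fun n => ?_⟩
  ext v
  have e := congrArg (fun g => ρ g (v : V)) (hc n)
  simp only [map_sub, map_mul, map_smul, LinearMap.sub_apply, LinearMap.smul_apply,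
    Module.End.mul_apply] at e
  change ρ (x R ħ ε i (n + (η : ℤ))) v = β⁻¹ • (ρ (hU R ħ i η) (ρ (x R ħ ε i n) v) -
    ρ (x R ħ ε i n) (ρ (hU R ħ i η) v))
  rw [e, smul_smul, inv_mul_cancel₀ hβ0, one_smul]

theorem isRecurrent_x (hq : NotRootOfUnity ħ) (hρ : IsMod ρ) (ε η : ℤˣ) (i : ι) (r : ℤ)
    {ω : Module.Dual ℚ 𝔥} {v : V} (hv : v ∈ weightSpace ρ ω) :
    IsRecurrent fun n : ℕ => ρ (x R ħ ε i (r + (η : ℤ) * n)) v := by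
  obtain ⟨T, hT⟩ := exists_x_recurrence (ρ := ρ) hq ε η i ω
  have := hρ.finite ω
  have := hρ.finite (ω + (ε : ℤ) • R.root i)
  have hr := isRecurrent_of_iterate T ((Submodule.subtype _) ∘ₗ LinearMap.applyₗ ⟨v, hv⟩)
    ((ρ (x R ħ ε i r)).restrict fun _ hv => map_x_mem_weightSpace ε i r hv)
  have e : ∀ n : ℕ, (T ^ n) ((ρ (x R ħ ε i r)).restrict
      fun _ hv => map_x_mem_weightSpace ε i r hv) = (ρ (x R ħ ε i (r + (η : ℤ) * n))).restrict
        fun _ hv => map_x_mem_weightSpace ε i (r + (η : ℤ) * n) hv := by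
    intro n
    induction n with
    | zero => simp
    | succ n ih =>
      rw [pow_succ', Module.End.mul_apply, ih, ← hT]
      ext w
      simp only [LinearMap.coe_restrict_apply, Nat.cast_add, Nat.cast_one, mul_add, mul_one,
        add_assoc]
  simp only [e] at hr
  exact hr

/-- The recurrence in the direction opposite to η expresses every mode through modes arbitrarily far
in the direction η. Cyclicity rests on this freedom to choose the modes. -/
theorem x_mem_span (hq : NotRootOfUnity ħ) (hρ : IsMod ρ) (ε η : ℤˣ) (i : ι) (n N : ℤ)
    {ω : Module.Dual ℚ 𝔥} {v : V} (hv : v ∈ weightSpace ρ ω) :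
    ρ (x R ħ ε i n) v ∈
      Submodule.span ℂ ((fun m : ℤ => ρ (x R ħ ε i m) v) '' {m | N ≤ (η : ℤ) * m}) := by
  obtain ⟨T, hT⟩ := exists_x_recurrence (ρ := ρ) hq ε (-η) i ω
  have := hρ.finite ω
  have := hρ.finite (ω + (ε : ℤ) • R.root i)
  let y : ℤ → (weightSpace ρ ω →ₗ[ℂ] weightSpace ρ (ω + (ε : ℤ) • R.root i)) := fun m =>
    (ρ (x R ħ ε i ((η : ℤ) * m))).restrict fun _ hv => map_x_mem_weightSpace ε i _ hv
  have hy : ∀ m, y (m - 1) = T (y m) := by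
    intro m
    rw [← hT]
    ext w
    simp only [y, LinearMap.coe_restrict_apply]
    congr 4
    push_cast
    ring
  have h1 := mem_span_of_recurrence hy N ((η : ℤ) * n)
  have h2 := Submodule.mem_map_of_mem (f := (Submodule.subtype _) ∘ₗ LinearMap.applyₗ ⟨v, hv⟩) h1
  rw [Submodule.map_span] at h2
  have e : ρ (x R ħ ε i n) v = ((Submodule.subtype _) ∘ₗ LinearMap.applyₗ ⟨v, hv⟩)
      (y ((η : ℤ) * n)) := by
    simp [y, units_mul_units_mul]
  rw [e]
  refine Submodule.span_mono ?_ h2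
  rintro _ ⟨_, ⟨m, hm, rfl⟩, rfl⟩
  exact ⟨(η : ℤ) * m, by rwa [Set.mem_ofPred_eq, units_mul_units_mul], rfl⟩

/-- For an index of sign ε, the element φ^{-ε} vanishes and φ^ε is a multiple of the commutator of
x^+_0 with a mode of x^-, to which the recurrence for x applies. At index 0 both φ^+ and φ^-
contribute, which is why the sequence starts at index 1. -/
theorem isRecurrent_phi (hq : NotRootOfUnity ħ) (hρ : IsMod ρ) (ε : ℤˣ) (i : ι)
    {ω : Module.Dual ℚ 𝔥} {v : V} (hv : v ∈ weightSpace ρ ω) :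
    IsRecurrent fun n : ℕ => ρ (phi R ħ ε i ((ε : ℤ) * (n + 1))) v := by
  set c := qpow ħ (A.r i) - qpow ħ (-(A.r i)) with hc
  have hc0 : c ≠ 0 := by
    have := A.r_pos i
    have := pow_sub_inv_pow_ne_zero hq (c := A.r i) (by positivity) (m := 1) one_ne_zero
    rwa [pow_one, pow_one, ← qpow_neg] at this
  have h1 := (isRecurrent_x hq hρ (-1) ε i ε hv).map
    (((ε : ℤ) : ℂ) • c • ρ (x R ħ 1 i 0))
  have h2 := (isRecurrent_x hq hρ (-1) ε i ε (map_x_mem_weightSpace (ρ := ρ) 1 i 0 hv)).map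
    ((-((ε : ℤ) : ℂ) * c) • (1 : Module.End ℂ V))
  have h3 := h1.add h2
  convert h3 using 2 with n
  have e := congrArg (fun g => ρ g v) ((isPreRep_U R ħ).x_pm_same i 0 ((ε : ℤ) * (n + 1)))
  rw [zero_add, ← hc] at e
  rw [show (ε : ℤ) + (ε : ℤ) * (n : ℤ) = (ε : ℤ) * (n + 1) by ring]
  simp only [map_sub, map_mul, map_smul, LinearMap.sub_apply, LinearMap.smul_apply,
    Module.End.mul_apply, Module.End.one_apply] at e ⊢
  rw [neg_mul, neg_smul, ← sub_eq_add_neg, smul_smul, ← smul_sub, e, smul_smul,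
    mul_assoc, mul_inv_cancel₀ hc0, mul_one]
  rcases Int.units_eq_one_or ε with rfl | rfl
  · rw [phi_eq_zero (-1) i _ (by simp; omega)]
    simp
  · rw [phi_eq_zero 1 i _ (by simp; omega)]
    simp

end Weight

/-! ### Weights of tensor products -/

section

variable {ι : Type*} [Fintype ι] {𝔥 : Type*} [AddCommGroup 𝔥] [Module ℚ 𝔥]
  {A : CartanDatum ι} {R : Realization A 𝔥} {ħ : ℂ}
  {V : Type*} [AddCommGroup V] [Module ℂ V] {ρ : U R ħ →ₐ[ℂ] Module.End ℂ V}
  {V' : Type*} [AddCommGroup V'] [Module ℂ V'] {ρ' : U R ħ →ₐ[ℂ] Module.End ℂ V'}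

theorem Realization.eq_of_sum_zsmul_root_eq (R : Realization A 𝔥) {a b : ι → ℤ}
    (h : ∑ j, a j • R.root j = ∑ j, b j • R.root j) : a = b := by
  have := Fintype.linearIndependent_iff.1 R.root_indep (fun j => ((a j - b j : ℤ) : ℚ)) (by
    simp only [Int.cast_smul_eq_zsmul, sub_smul, Finset.sum_sub_distrib, h, sub_self])
  funext j
  have := this j
  rw [Int.cast_eq_zero, sub_eq_zero] at this
  exact this

/-- The coefficients of two weights below fixed weights, in terms of their sum. -/
theorem Realization.coeff_add_eq [DecidableEq ι] (R : Realization A 𝔥) {lam lam' μ : Module.Dual ℚ 𝔥}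
    {z₀ : ι → ℤ} (hz : lam + lam' - μ = ∑ j, z₀ j • R.root j) {c c' : ι → ℕ} {i : ι} {m : ℤ}
    (h : lam - ∑ j, c j • R.root j + (lam' - ∑ j, c' j • R.root j) = μ + m • R.root i) (j : ι) :
    (c j : ℤ) + c' j = z₀ j - if j = i then m else 0 := by
  have e : (fun j => (c j : ℤ) + c' j + if j = i then m else 0) = z₀ := by
    apply R.eq_of_sum_zsmul_root_eq
    rw [← hz]
    simp only [add_smul, Finset.sum_add_distrib, natCast_zsmul, ite_smul, zero_smul,
      Finset.sum_ite_eq', Finset.mem_univ, if_true]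
    rw [eq_sub_iff_add_eq, add_assoc, add_comm (m • _), ← h]
    abel
  rw [← congrFun e j]
  ring

/-- The coefficients other than the i-th lie in a finite box, so only finitely many i-strings occur,
and the bounds given by integrability have a maximum. -/
theorem IsMod.exists_string_bound [DecidableEq ι] (hρ : IsMod ρ) (lam : Module.Dual ℚ 𝔥) (i : ι) (D : ι → ℕ) :
    ∃ N : ℕ, ∀ c : ι → ℕ, (∀ j, j ≠ i → c j ≤ D j) → N ≤ c i →
      weightSpace ρ (lam - ∑ j, c j • R.root j) = ⊥ := by
  choose N hN using fun c : ι → ℕ => hρ.integrable (lam - ∑ j, c j • R.root j) i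
  refine ⟨(Finset.Iic (Function.update D i 0)).sup N, fun c hc hci => ?_⟩
  have hmem : Function.update c i 0 ∈ Finset.Iic (Function.update D i 0) := by
    rw [Finset.mem_Iic]
    intro j
    by_cases hj : j = i
    · subst hj; simp
    · simpa [hj] using hc j hj
  have h := (hN _ _ ((Finset.le_sup hmem).trans hci)).2
  rw [sub_sub] at h
  convert h using 4
  rw [← Finset.add_sum_erase _ _ (Finset.mem_univ i), ← Finset.add_sum_erase Finset.univ
    (fun j => Function.update c i 0 j • R.root j) (Finset.mem_univ i), Function.update_self,
    zero_smul, zero_add, add_comm]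
  congr 1
  refine Finset.sum_congr rfl fun j hj => ?_
  rw [Function.update_of_ne (Finset.ne_of_mem_erase hj)]

/-- A prescribed total weight fixes every sum c_j + c'_j. Those with j ≠ i do not depend on m, while
c_i + c'_i is a constant minus m. If |m| is large, then either that sum would be negative or one of
c_i, c'_i is large. -/
theorem IsMod.exists_pair_bound (hρ : IsMod ρ) (hρ' : IsMod ρ') (lam lam' μ : Module.Dual ℚ 𝔥)
    (i : ι) : ∃ N : ℕ, ∀ m : ℤ, N ≤ m.natAbs → ∀ c c' : ι → ℕ,
      lam - ∑ j, c j • R.root j + (lam' - ∑ j, c' j • R.root j) = μ + m • R.root i →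
      weightSpace ρ (lam - ∑ j, c j • R.root j) = ⊥ ∨
        weightSpace ρ' (lam' - ∑ j, c' j • R.root j) = ⊥ := by
  classical
  by_cases hz : ∃ z₀ : ι → ℤ, lam + lam' - μ = ∑ j, z₀ j • R.root j
  · obtain ⟨z₀, hz⟩ := hz
    obtain ⟨N, hN⟩ := hρ.exists_string_bound lam i fun j => (z₀ j).toNat
    obtain ⟨N', hN'⟩ := hρ'.exists_string_bound lam' i fun j => (z₀ j).toNat
    -- When the sum is not negative, this bound makes c_i + c'_i larger than N + N', so c_i ≥ N or
    -- c'_i ≥ N'.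
    refine ⟨N + N' + (z₀ i).natAbs + 1, fun m hm c c' h => ?_⟩
    have key := R.coeff_add_eq hz h
    have hne : ∀ j, j ≠ i → c j ≤ (z₀ j).toNat ∧ c' j ≤ (z₀ j).toNat := by
      intro j hj
      have := key j
      rw [if_neg hj] at this
      omega
    have hi := key i
    rw [if_pos rfl] at hi
    by_cases hc : N ≤ c i
    · exact Or.inl (hN c (fun j hj => (hne j hj).1) hc)
    · exact Or.inr (hN' c' (fun j hj => (hne j hj).2) (by omega))
  · refine ⟨0, fun m _ c c' h => (hz ⟨fun j => (c j : ℤ) + c' j + if j = i then m else 0, ?_⟩).elim⟩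
    simp only [add_smul, Finset.sum_add_distrib, natCast_zsmul, ite_smul, zero_smul,
      Finset.sum_ite_eq', Finset.mem_univ, if_true]
    rw [sub_eq_iff_eq_add, add_assoc, add_comm (m • _), ← h]
    abel

variable (ρ ρ') in
/-- The weight spaces of `V ⊗ V'`. -/
def totalWeight (μ : Module.Dual ℚ 𝔥) : Submodule ℂ (V ⊗[ℂ] V') :=
  ⨆ ω, Submodule.map₂ (TensorProduct.mk ℂ V V') (weightSpace ρ ω) (weightSpace ρ' (μ - ω))

theorem tmul_mem_totalWeight {ω ω' : Module.Dual ℚ 𝔥} {v : V} {v' : V'}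
    (hv : v ∈ weightSpace ρ ω) (hv' : v' ∈ weightSpace ρ' ω') :
    v ⊗ₜ v' ∈ totalWeight ρ ρ' (ω + ω') := by
  refine Submodule.mem_iSup_of_mem ω (Submodule.apply_mem_map₂ (TensorProduct.mk ℂ V V') hv ?_)
  rwa [add_sub_cancel_left]

theorem totalWeight_le {μ : Module.Dual ℚ 𝔥} {F : Submodule ℂ (V ⊗[ℂ] V')}
    (h : ∀ ω ω', ω + ω' = μ → ∀ v ∈ weightSpace ρ ω, ∀ v' ∈ weightSpace ρ' ω', v ⊗ₜ v' ∈ F) :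
    totalWeight ρ ρ' μ ≤ F :=
  iSup_le fun ω => Submodule.map₂_le.2 fun v hv v' hv' =>
    h ω (μ - ω) (add_sub_cancel _ _) v hv v' hv'

theorem span_weight_eq_top (hρ : IsMod ρ) : Submodule.span ℂ {v | ∃ ω, v ∈ weightSpace ρ ω} = ⊤ := by
  rw [eq_top_iff, ← hρ.iSup_eq_top]
  exact iSup_le fun ω v hv => Submodule.subset_span ⟨ω, hv⟩

theorem span_tmul_weight_eq_top (hρ : IsMod ρ) (hρ' : IsMod ρ') :
    Submodule.span ℂ {e : V ⊗[ℂ] V' | ∃ ω ω', ∃ v ∈ weightSpace ρ ω, ∃ v' ∈ weightSpace ρ' ω',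
      e = v ⊗ₜ v'} = ⊤ := by
  have h := Submodule.map₂_span_span ℂ (TensorProduct.mk ℂ V V') {v | ∃ ω, v ∈ weightSpace ρ ω}
    {v | ∃ ω, v ∈ weightSpace ρ' ω}
  rw [span_weight_eq_top hρ, span_weight_eq_top hρ', TensorProduct.map₂_mk_top_top_eq_top] at h
  rw [eq_top_iff, h]
  refine Submodule.span_mono ?_
  rintro _ ⟨v, ⟨ω, hv⟩, v', ⟨ω', hv'⟩, rfl⟩
  exact ⟨ω, ω', v, hv, v', hv', rfl⟩

theorem iSup_totalWeight_eq_top (hρ : IsMod ρ) (hρ' : IsMod ρ') : ⨆ μ, totalWeight ρ ρ' μ = ⊤ := by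
  rw [eq_top_iff, ← span_tmul_weight_eq_top hρ hρ', Submodule.span_le]
  rintro _ ⟨ω, ω', v, hv, v', hv', rfl⟩
  exact Submodule.mem_iSup_of_mem _ (tmul_mem_totalWeight hv hv')

theorem map_mem_totalWeight {f : Module.End ℂ V} {g : Module.End ℂ V'} {a b : Module.Dual ℚ 𝔥}
    (hf : ∀ ω, ∀ v ∈ weightSpace ρ ω, f v ∈ weightSpace ρ (ω + a))
    (hg : ∀ ω, ∀ v ∈ weightSpace ρ' ω, g v ∈ weightSpace ρ' (ω + b)) {μ : Module.Dual ℚ 𝔥}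
    {e : V ⊗[ℂ] V'} (he : e ∈ totalWeight ρ ρ' μ) :
    TensorProduct.map f g e ∈ totalWeight ρ ρ' (μ + (a + b)) := by
  refine totalWeight_le (F := (totalWeight ρ ρ' (μ + (a + b))).comap (TensorProduct.map f g)) ?_ he
  rintro ω ω' rfl v hv v' hv'
  rw [Submodule.mem_comap, TensorProduct.map_tmul, add_add_add_comm]
  exact tmul_mem_totalWeight (hf _ _ hv) (hg _ _ hv')

theorem totalWeight_integrable (hρ : IsMod ρ) (hρ' : IsMod ρ') (μ : Module.Dual ℚ 𝔥) (i : ι) :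
    ∃ N : ℕ, ∀ m : ℤ, N ≤ m.natAbs → totalWeight ρ ρ' (μ + m • R.root i) = ⊥ := by
  obtain ⟨S, hS⟩ := hρ.bounded
  obtain ⟨S', hS'⟩ := hρ'.bounded
  choose N hN using fun p : Module.Dual ℚ 𝔥 × Module.Dual ℚ 𝔥 =>
    hρ.exists_pair_bound hρ' p.1 p.2 μ i
  refine ⟨(S ×ˢ S').sup N, fun m hm => ?_⟩
  rw [eq_bot_iff]
  refine totalWeight_le fun ω ω' h v hv v' hv' => ?_
  by_cases h1 : weightSpace ρ ω = ⊥
  · rw [h1, Submodule.mem_bot] at hv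
    simp [hv]
  by_cases h2 : weightSpace ρ' ω' = ⊥
  · rw [h2, Submodule.mem_bot] at hv'
    simp [hv']
  obtain ⟨lam, hl, c, hc⟩ := hS ω h1
  obtain ⟨lam', hl', c', hc'⟩ := hS' ω' h2
  have e : ω = lam - ∑ j, c j • R.root j := by rw [← hc, sub_sub_cancel]
  have e' : ω' = lam' - ∑ j, c' j • R.root j := by rw [← hc', sub_sub_cancel]
  have := hN (lam, lam') m ((Finset.le_sup (f := N) (Finset.mk_mem_product hl hl')).trans hm) c c'
    (by rw [← e, ← e', h])
  rw [← e, ← e'] at this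
  exact (this.elim h1 h2).elim

/-- For each pair of cones, the coefficients of the two weights have fixed sums, so only finitely
many decompositions of μ occur. The total weight space is then a finite sum of tensor products of
finite dimensional spaces. -/
theorem finite_totalWeight (hρ : IsMod ρ) (hρ' : IsMod ρ') (μ : Module.Dual ℚ 𝔥) :
    Module.Finite ℂ (totalWeight ρ ρ' μ) := by
  classical
  obtain ⟨S, hS⟩ := hρ.bounded
  obtain ⟨S', hS'⟩ := hρ'.bounded
  have hfin : {ω | weightSpace ρ ω ≠ ⊥ ∧ weightSpace ρ' (μ - ω) ≠ ⊥}.Finite := by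
    have hp : ∀ p : Module.Dual ℚ 𝔥 × Module.Dual ℚ 𝔥, {ω | ∃ c c' : ι → ℕ,
        ω = p.1 - ∑ j, c j • R.root j ∧ μ - ω = p.2 - ∑ j, c' j • R.root j}.Finite := by
      intro p
      by_cases hz : ∃ z₀ : ι → ℤ, p.1 + p.2 - μ = ∑ j, z₀ j • R.root j
      · obtain ⟨z₀, hz⟩ := hz
        refine ((Set.finite_Iic fun j => (z₀ j).toNat).image
          fun c : ι → ℕ => p.1 - ∑ j, c j • R.root j).subset ?_
        rintro ω ⟨c, c', hc, hc'⟩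
        refine ⟨c, fun j => ?_, hc.symm⟩
        have := R.coeff_add_eq hz (c := c) (c' := c') (i := j) (m := 0)
          (by rw [← hc, ← hc', zero_smul, add_zero, add_sub_cancel]) j
        simp only [ite_self, sub_zero] at this
        change c j ≤ (z₀ j).toNat
        omega
      · convert Set.finite_empty
        rw [Set.eq_empty_iff_forall_notMem]
        rintro ω ⟨c, c', hc, hc'⟩
        refine hz ⟨fun j => (c j : ℤ) + c' j, ?_⟩
        simp only [add_smul, Finset.sum_add_distrib, natCast_zsmul]
        rw [eq_sub_iff_add_eq'] at hc
        rw [eq_sub_iff_add_eq'] at hc'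
        rw [← hc, ← hc']
        abel
    refine ((Finset.finite_toSet (S ×ˢ S')).biUnion fun p _ => hp p).subset ?_
    rintro ω ⟨h1, h2⟩
    obtain ⟨lam, hl, c, hc⟩ := hS ω h1
    obtain ⟨lam', hl', c', hc'⟩ := hS' _ h2
    exact Set.mem_biUnion (Finset.mk_mem_product hl hl')
      ⟨c, c', by rw [← hc, sub_sub_cancel], by rw [← hc', sub_sub_cancel]⟩
  have e : totalWeight ρ ρ' μ = ⨆ ω ∈ hfin.toFinset, Submodule.map₂ (TensorProduct.mk ℂ V V')
      (weightSpace ρ ω) (weightSpace ρ' (μ - ω)) := by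
    refine le_antisymm (iSup_le fun ω => ?_) (iSup₂_le fun ω _ => le_iSup_of_le ω le_rfl)
    by_cases h1 : weightSpace ρ ω = ⊥
    · rw [h1, Submodule.map₂_bot_left]; exact bot_le
    by_cases h2 : weightSpace ρ' (μ - ω) = ⊥
    · rw [h2, Submodule.map₂_bot_right]; exact bot_le
    exact le_iSup₂_of_le ω (hfin.mem_toFinset.2 ⟨h1, h2⟩) le_rfl
  rw [Module.Finite.iff_fg, e]
  refine Submodule.fg_biSup _ _ fun ω _ => Submodule.FG.map₂ _ ?_ ?_
  · exact Module.Finite.iff_fg.1 (hρ.finite ω)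
  · exact Module.Finite.iff_fg.1 (hρ'.finite _)

/-- Simultaneous eigenspaces for the characters `q ^ ω` are independent. -/
theorem iSupIndep_of_qpow (hq : NotRootOfUnity ħ) {E : Type*} [AddCommGroup E] [Module ℂ E]
    (K : 𝔥 → Module.End ℂ E) (hK : ∀ a b, Commute (K a) (K b))
    (F : Module.Dual ℚ 𝔥 → Submodule ℂ E) (hF : ∀ ω, ∀ e ∈ F ω, ∀ a, K a e = qpow ħ (ω a) • e) :
    iSupIndep F := by
  have h := Module.End.independent_iInf_maxGenEigenspace_of_forall_mapsTo K fun a b φ =>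
    Module.End.mapsTo_maxGenEigenspace_of_comm (hK b a) φ
  have hinj : Function.Injective fun (ω : Module.Dual ℚ 𝔥) (a : 𝔥) => qpow ħ (ω a) := by
    intro ω ω' he
    ext a
    exact hq.qpow_injective (congrFun he a)
  refine (h.comp hinj).mono fun ω => le_iInf fun a => ?_
  exact le_trans (fun e he => Module.End.mem_eigenspace_iff.2 (hF ω e he a))
    Module.End.eigenspace_le_maxGenEigenspace

theorem iSupIndep_totalWeight (hq : NotRootOfUnity ħ) : iSupIndep (totalWeight ρ ρ') := by
  refine iSupIndep_of_qpow hq (fun a => TensorProduct.map (ρ (k R ħ a)) (ρ' (k R ħ a))) ?_ _ ?_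
  · intro a b
    have h := (isPreRep_U R ħ).k_add
    rw [commute_iff_eq]
    simp only [← TensorProduct.map_mul, ← map_mul, h, add_comm b a]
  · intro μ e he a
    have : totalWeight ρ ρ' μ ≤ LinearMap.ker
        (TensorProduct.map (ρ (k R ħ a)) (ρ' (k R ħ a)) - qpow ħ (μ a) • (1 : Module.End ℂ _)) := by
      refine totalWeight_le ?_
      rintro ω ω' rfl v hv v' hv'
      rw [mem_weightSpace] at hv hv'
      simp [hv, hv', TensorProduct.smul_tmul, TensorProduct.tmul_smul, smul_smul, qpow_add,
        mul_comm]
    simpa [sub_eq_zero] using this he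

end

/-! ### The fused action -/

section HahnWeight

variable {E : Type*} [AddCommGroup E] [Module ℂ E]

/-- The formal series with coefficients in a subspace. -/
def hahnSub (F : Submodule ℂ E) : AddSubgroup (HahnModule ℤ (Module.End ℂ E) E) where
  carrier := {z | ∀ n, hcoeff z n ∈ F}
  zero_mem' _ := F.zero_mem
  add_mem' hy hz n := F.add_mem (hy n) (hz n)
  neg_mem' hz n := F.neg_mem (hz n)

theorem smul_mem_hahnSub {F F' : Submodule ℂ E} {D : HahnSeries ℤ (Module.End ℂ E)}
    (hD : ∀ n, ∀ e ∈ F, D.coeff n e ∈ F') {z : HahnModule ℤ (Module.End ℂ E) E}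
    (hz : z ∈ hahnSub F) : D • z ∈ hahnSub F' := by
  intro n
  rw [hcoeff_smul]
  exact finsum_induction (· ∈ F') F'.zero_mem (fun _ _ => F'.add_mem) fun k => hD k _ (hz _)

theorem toHahn_one_tmul_mem {F : Submodule ℂ E} {e : E} (he : e ∈ F) :
    toHahn (1 ⊗ₜ e) ∈ hahnSub F := by
  intro n
  rw [hcoeff_toHahn, coeffMap_one_tmul]
  split_ifs
  exacts [he, F.zero_mem]

end HahnWeight

section

variable {ι : Type*} [Fintype ι] {𝔥 : Type*} [AddCommGroup 𝔥] [Module ℚ 𝔥]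
  {A : CartanDatum ι} {R : Realization A 𝔥} {ħ : ℂ}
  {V : Type*} [AddCommGroup V] [Module ℂ V] {V' : Type*} [AddCommGroup V'] [Module ℂ V']
  (ρ : U R ħ →ₐ[ℂ] Module.End ℂ V) (ρ' : U R ħ →ₐ[ℂ] Module.End ℂ V')

/-- The action of `U ⊗ U` on `V ⊗ V'`. -/
def tensorHom : U R ħ ⊗[ℂ] U R ħ →ₐ[ℂ] Module.End ℂ (V ⊗[ℂ] V') :=
  (Module.endTensorEndAlgHom (R := ℂ) (S := ℂ) (A := ℂ) (M := V) (N := V')).comp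
    (Algebra.TensorProduct.map ρ ρ')

@[simp] theorem tensorHom_tmul (g g' : U R ħ) :
    tensorHom ρ ρ' (g ⊗ₜ g') = TensorProduct.map (ρ g) (ρ' g') := by
  simp [tensorHom, Module.endTensorEndAlgHom_apply]
  rfl

/-- The action of the deformed coproduct of `x^ε_{i,r}`. -/
def fuseX (ε : ℤˣ) (i : ι) (r : ℤ) : HahnSeries ℤ (Module.End ℂ (V ⊗[ℂ] V')) :=
  hahnMap (tensorHom ρ ρ') ((isPreRep_U R ħ).deltaX ε i r)

/-- The action of the deformed coproduct of `k_a`. -/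
def fuseK (a : 𝔥) : HahnSeries ℤ (Module.End ℂ (V ⊗[ℂ] V')) :=
  hahnMap (tensorHom ρ ρ') (deltaK (k R ħ) a)

/-- The action of the deformed coproduct of `φ^ε_{i,n}`. -/
def fusePhi (ε : ℤˣ) (i : ι) (n : ℤ) : HahnSeries ℤ (Module.End ℂ (V ⊗[ℂ] V')) :=
  hahnMap (tensorHom ρ ρ') (deltaPhi (phi R ħ) ε i n)

theorem coeff_fuseX_one (i : ι) (r n : ℤ) : (fuseX ρ ρ' 1 i r).coeff n =
    (if n = 0 then TensorProduct.map (ρ (x R ħ 1 i r)) 1 else 0) +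
      TensorProduct.map (ρ (phi R ħ (-1) i (r - n))) (ρ' (x R ħ 1 i n)) := by
  rw [fuseX, coeff_hahnMap, IsPreRep.deltaX_one, HahnSeries.coeff_add, map_add,
    IsPreRep.coeff_plusTail, tensorHom_tmul, HahnSeries.coeff_single]
  split_ifs <;> simp

theorem coeff_fuseX_neg_one (i : ι) (r n : ℤ) : (fuseX ρ ρ' (-1) i r).coeff n =
    (if n = r then TensorProduct.map 1 (ρ' (x R ħ (-1) i r)) else 0) +
      TensorProduct.map (ρ (x R ħ (-1) i (r - n))) (ρ' (phi R ħ 1 i n)) := by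
  rw [fuseX, coeff_hahnMap, IsPreRep.deltaX_neg_one, HahnSeries.coeff_add, map_add,
    IsPreRep.coeff_minusTail, tensorHom_tmul, HahnSeries.coeff_single]
  split_ifs <;> simp

theorem coeff_fusePhi (ε : ℤˣ) (i : ι) (m n : ℤ) : (fusePhi ρ ρ' ε i m).coeff n =
    TensorProduct.map (ρ (phi R ħ ε i (m - n))) (ρ' (phi R ħ ε i n)) := by
  rw [fusePhi, coeff_hahnMap, (isPreRep_U R ħ).coeff_deltaPhi, tensorHom_tmul]

theorem coeff_fuseK (a : 𝔥) (n : ℤ) : (fuseK ρ ρ' a).coeff n =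
    if n = 0 then TensorProduct.map (ρ (k R ħ a)) (ρ' (k R ħ a)) else 0 := by
  rw [fuseK, coeff_hahnMap, deltaK, HahnSeries.coeff_single]
  split_ifs <;> simp

theorem isPreRep_fuse (hq : NotRootOfUnity ħ) : IsPreRep R ħ (fuseX ρ ρ') (fuseK ρ ρ')
    (fun i m => hahnMap (tensorHom ρ ρ') (deltaH (hU R ħ) i m)) (fusePhi ρ ρ') :=
  ((isPreRep_U R ħ).delta hq).map (hahnMap (tensorHom ρ ρ'))

variable {ρ ρ'}

theorem coeff_fuseX_mem (ε : ℤˣ) (i : ι) (r n : ℤ) {μ : Module.Dual ℚ 𝔥} {e : V ⊗[ℂ] V'}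
    (he : e ∈ totalWeight ρ ρ' μ) :
    (fuseX ρ ρ' ε i r).coeff n e ∈ totalWeight ρ ρ' (μ + (ε : ℤ) • R.root i) := by
  rcases Int.units_eq_one_or ε with rfl | rfl
  · rw [coeff_fuseX_one, LinearMap.add_apply]
    refine Submodule.add_mem _ ?_ ?_
    · split_ifs
      · have := map_mem_totalWeight (ρ := ρ) (ρ' := ρ') (b := 0)
          (fun ω v hv => map_x_mem_weightSpace 1 i r hv)
          (g := 1) (fun ω v hv => by simpa using hv) he
        rwa [add_zero] at this
      · simp
    · have := map_mem_totalWeight (ρ := ρ) (ρ' := ρ') (a := 0)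
        (f := ρ (phi R ħ (-1) i (r - n)))
        (fun ω v hv => by simpa using map_phi_mem_weightSpace (-1) i (r - n) hv)
        (fun ω v hv => map_x_mem_weightSpace 1 i n hv) he
      rwa [zero_add] at this
  · rw [coeff_fuseX_neg_one, LinearMap.add_apply]
    refine Submodule.add_mem _ ?_ ?_
    · split_ifs
      · have := map_mem_totalWeight (ρ := ρ) (ρ' := ρ') (a := 0) (f := 1)
          (fun ω v hv => by simpa using hv)
          (fun ω v hv => map_x_mem_weightSpace (-1) i r hv) he
        rwa [zero_add] at this
      · simp
    · have := map_mem_totalWeight (ρ := ρ) (ρ' := ρ') (b := 0)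
        (g := ρ' (phi R ħ 1 i n))
        (fun ω v hv => map_x_mem_weightSpace (-1) i (r - n) hv)
        (fun ω v hv => by simpa using map_phi_mem_weightSpace 1 i n hv) he
      rwa [add_zero] at this

theorem coeff_fuseK_mem (a : 𝔥) (n : ℤ) {μ : Module.Dual ℚ 𝔥} {e : V ⊗[ℂ] V'}
    (he : e ∈ totalWeight ρ ρ' μ) : (fuseK ρ ρ' a).coeff n e ∈ totalWeight ρ ρ' μ := by
  rw [coeff_fuseK]
  split_ifs
  · have hk : ∀ b, k R ħ b * k R ħ a = k R ħ a * k R ħ b := fun b => by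
      rw [U.k_add, U.k_add, add_comm]
    have := map_mem_totalWeight (ρ := ρ) (ρ' := ρ') (a := 0) (b := 0) (f := ρ (k R ħ a))
      (g := ρ' (k R ħ a))
      (fun ω v hv => by simpa using map_mem_weightSpace_of_commute hk hv)
      (fun ω v hv => by simpa using map_mem_weightSpace_of_commute hk hv) he
    rwa [add_zero, add_zero] at this
  · simp

/-- Formal series with coefficients in the total weight spaces form an integrable graded module for
the fused action, so the Serre relations are automatic. -/
theorem serreRel_fuse (hq : NotRootOfUnity ħ) (hρ : IsMod ρ) (hρ' : IsMod ρ') :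
    SerreRel A ħ (fuseX ρ ρ') := by
  refine (isPreRep_fuse ρ ρ' hq).serreRel hq (M := HahnModule ℤ (Module.End ℂ (V ⊗[ℂ] V')) _)
    (fun μ => hahnSub (totalWeight ρ ρ' μ)) ?_ ?_ ?_ ?_ ?_
  · intro c ω w hw
    refine smul_mem_hahnSub (fun n e he => ?_) hw
    rw [HahnSeries.algebraMap_apply, HahnSeries.C_apply, HahnSeries.coeff_single]
    split_ifs
    · exact Submodule.smul_mem _ c he
    · exact Submodule.zero_mem _
  · exact fun ε i r ω w hw => smul_mem_hahnSub (fun n e he => coeff_fuseX_mem ε i r n he) hw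
  · exact fun a ω w hw => smul_mem_hahnSub (fun n e he => coeff_fuseK_mem a n he) hw
  · intro ω i
    have hbot : ∀ ν, totalWeight ρ ρ' ν = ⊥ → hahnSub (totalWeight ρ ρ' ν) = ⊥ := by
      intro ν hν
      rw [eq_bot_iff]
      intro z hz
      rw [AddSubgroup.mem_bot]
      refine hahnModule_ext fun n => ?_
      have := hz n
      rwa [hν, Submodule.mem_bot] at this
    obtain ⟨N, hN⟩ := totalWeight_integrable hρ hρ' ω i
    refine ⟨N, fun r hr => ⟨hbot _ ?_, hbot _ ?_⟩⟩
    · have := hN r (by simpa using hr)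
      rwa [natCast_zsmul] at this
    · have := hN (-r) (by simpa using hr)
      rwa [neg_smul, natCast_zsmul, ← sub_eq_add_neg] at this
  -- Faithfulness: applied to a constant tensor, a formal series of endomorphisms returns its own
  -- coefficients.
  · intro D hD
    refine HahnSeries.ext (funext fun n => ?_)
    refine LinearMap.ext_on (span_tmul_weight_eq_top hρ hρ') ?_
    rintro _ ⟨ω, ω', v, hv, v', hv', rfl⟩
    have := hD (ω + ω') (toHahn (1 ⊗ₜ (v ⊗ₜ v')))
      (toHahn_one_tmul_mem (tmul_mem_totalWeight hv hv'))
    rw [← hcoeff_smul_one_tmul]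
    refine (congrArg (fun z => hcoeff z n) this).trans ?_
    simp

/-- The fused action, by formal series of endomorphisms. -/
def fuseHom (hq : NotRootOfUnity ħ) (hρ : IsMod ρ) (hρ' : IsMod ρ') :
    U R ħ →ₐ[ℂ] HahnSeries ℤ (Module.End ℂ (V ⊗[ℂ] V')) :=
  (isPreRep_fuse ρ ρ' hq).lift (serreRel_fuse hq hρ hρ')

/-- If a series is recurrent up to its first term then it is rational. -/
theorem exists_coeffMap_shift {E : Type*} [AddCommGroup E] [Module ℂ E] {a : ℕ → E}
    (ha : IsRecurrent a) (r : ℤ) :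
    ∃ z : Cu ⊗[ℂ] E, ∀ n : ℤ, coeffMap E n z = if r ≤ n then a (n - r).toNat else 0 := by
  obtain ⟨z, hz⟩ := ha.exists_coeffMap_eq
  refine ⟨uPow r • z, fun n => ?_⟩
  rw [coeffMap_uPow_smul, hz]
  simp only [sub_nonneg]

theorem coeffMap_uPow_tmul {E : Type*} [AddCommGroup E] [Module ℂ E] (n r : ℤ) (e : E) :
    coeffMap E n (uPow r ⊗ₜ e) = if n = r then e else 0 := by
  rw [coeffMap_tmul, uCoeff_uPow]; split_ifs <;> simp

/-- On tensors of weight vectors the coefficients of the tail are tensor products of two recurrent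
sequences, so the tail is the expansion of a rational element. -/
theorem fuseX_mem_rationalEnd (hq : NotRootOfUnity ħ) (hρ : IsMod ρ) (hρ' : IsMod ρ') (ε : ℤˣ)
    (i : ι) (r : ℤ) : fuseX ρ ρ' ε i r ∈ rationalEnd (V ⊗[ℂ] V') := by
  rw [mem_rationalEnd_iff (span_tmul_weight_eq_top hρ hρ')]
  rintro _ ⟨ω, ω', v, hv, v', hv', rfl⟩
  rcases Int.units_eq_one_or ε with rfl | rfl
  · have h1 := isRecurrent_phi hq hρ (-1) i hv
    have h2 := isRecurrent_x hq hρ' 1 1 i (r + 1) hv'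
    -- The recurrence for φ^- starts at index 1, so the tail is recurrent only from u^(r+1) on. Its
    -- first term, with φ^-_0 and u^r, is added separately.
    obtain ⟨z, hz⟩ := exists_coeffMap_shift (h1.map₂ h2 (TensorProduct.mk ℂ V V')) (r + 1)
    refine ⟨1 ⊗ₜ (ρ (x R ħ 1 i r) v ⊗ₜ v') +
      uPow r ⊗ₜ (ρ (phi R ħ (-1) i 0) v ⊗ₜ ρ' (x R ħ 1 i r) v') + z, fun n => ?_⟩
    rw [map_add, map_add, coeffMap_one_tmul, coeffMap_uPow_tmul, hz, coeff_fuseX_one,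
      LinearMap.add_apply, TensorProduct.map_tmul, add_assoc]
    congr 1
    · split_ifs <;> simp
    · rcases lt_trichotomy n r with h | rfl | h
      · rw [if_neg h.ne, if_neg (by omega), phi_eq_zero (-1) i _ (by simp; omega)]
        simp
      · rw [if_pos rfl, if_neg (by omega), sub_self, add_zero]
      · rw [if_neg h.ne', if_pos (by omega), zero_add]
        have e : ((n - (r + 1)).toNat : ℤ) = n - (r + 1) := Int.toNat_of_nonneg (by omega)
        simp only [TensorProduct.mk_apply, e, Units.val_one, Units.val_neg]
        congr 5 <;> ring
  · have h1 := isRecurrent_x hq hρ (-1) (-1) i (r - 1) hv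
    have h2 := isRecurrent_phi hq hρ' 1 i hv'
    obtain ⟨z, hz⟩ := exists_coeffMap_shift (h1.map₂ h2 (TensorProduct.mk ℂ V V')) 1
    refine ⟨uPow r ⊗ₜ (v ⊗ₜ ρ' (x R ħ (-1) i r) v') +
      (1 ⊗ₜ (ρ (x R ħ (-1) i r) v ⊗ₜ ρ' (phi R ħ 1 i 0) v') + z), fun n => ?_⟩
    rw [map_add, map_add, coeffMap_one_tmul, coeffMap_uPow_tmul, hz, coeff_fuseX_neg_one,
      LinearMap.add_apply, TensorProduct.map_tmul]
    congr 1
    · split_ifs <;> simp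
    · rcases lt_trichotomy n 0 with h | rfl | h
      · rw [if_neg h.ne, if_neg (by omega), phi_eq_zero 1 i n (by simp; omega)]
        simp
      · rw [if_pos rfl, if_neg (by omega), sub_zero, add_zero]
      · rw [if_neg h.ne', if_pos (by omega), zero_add]
        have e : ((n - 1).toNat : ℤ) = n - 1 := Int.toNat_of_nonneg (by omega)
        simp only [TensorProduct.mk_apply, e, Units.val_one, Units.val_neg]
        rw [show r - 1 + -1 * (n - 1) = r - n by ring, show (1 : ℤ) * (n - 1 + 1) = n by ring]

theorem fuseK_mem_rationalEnd (a : 𝔥) : fuseK ρ ρ' a ∈ rationalEnd (V ⊗[ℂ] V') := by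
  rw [mem_rationalEnd_iff (S := Set.univ) Submodule.span_univ]
  intro e _
  refine ⟨1 ⊗ₜ (TensorProduct.map (ρ (k R ħ a)) (ρ' (k R ħ a)) e), fun n => ?_⟩
  rw [coeffMap_one_tmul, coeff_fuseK]
  split_ifs <;> simp

theorem fusePhi_apply_eq (ε : ℤˣ) (i : ι) (m : ℕ) (n : ℤ) (v : V) (v' : V') :
    coeffMap (V ⊗[ℂ] V') n (∑ s ∈ Finset.range (m + 1), uPow ((ε : ℤ) * s) ⊗ₜ
      (ρ (phi R ħ ε i ((ε : ℤ) * (m - s))) v ⊗ₜ ρ' (phi R ħ ε i ((ε : ℤ) * s)) v')) =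
      (fusePhi ρ ρ' ε i ((ε : ℤ) * m)).coeff n (v ⊗ₜ v') := by
  rw [map_sum, coeff_fusePhi, TensorProduct.map_tmul]
  have h := congrArg (fun D => tensorHom ρ ρ' (HahnSeries.coeff D n) (v ⊗ₜ v'))
    (deltaPhi_natural (phi R ħ) ε i m)
  simp only [(isPreRep_U R ħ).coeff_deltaPhi, tensorHom_tmul, TensorProduct.map_tmul] at h
  rw [h, HahnSeries.coeff_sum, map_sum, LinearMap.sum_apply]
  refine Finset.sum_congr rfl fun s _ => ?_
  rw [coeffMap_uPow_tmul, HahnSeries.coeff_single]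
  split_ifs <;> simp

theorem fusePhi_mem_rationalEnd (ε : ℤˣ) (i : ι) (n : ℤ) :
    fusePhi ρ ρ' ε i n ∈ rationalEnd (V ⊗[ℂ] V') := by
  rcases lt_or_ge ((ε : ℤ) * n) 0 with hn | hn
  · rw [fusePhi, deltaPhi, if_neg (not_le.2 hn), map_zero]
    exact Subalgebra.zero_mem _
  · rw [exists_eq_units_mul_nat ε hn, mem_rationalEnd_iff (S := {e | ∃ v v', v ⊗ₜ v' = e})
      (TensorProduct.span_tmul_eq_top ℂ V V')]
    rintro _ ⟨v, v', rfl⟩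
    exact ⟨_, fun n => fusePhi_apply_eq ε i _ n v v'⟩

theorem fuseHom_mem_rationalEnd (hq : NotRootOfUnity ħ) (hρ : IsMod ρ) (hρ' : IsMod ρ')
    (g : U R ħ) : fuseHom hq hρ hρ' g ∈ rationalEnd (V ⊗[ℂ] V') := by
  have : (rationalEnd (V ⊗[ℂ] V')).comap (fuseHom hq hρ hρ') = ⊤ :=
    U.subalgebra_eq_top hq _
      (fun ε i r => by
        rw [Subalgebra.mem_comap, fuseHom, IsPreRep.lift_x]
        exact fuseX_mem_rationalEnd hq hρ hρ' ε i r)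
      (fun a => by
        rw [Subalgebra.mem_comap, fuseHom, IsPreRep.lift_k]
        exact fuseK_mem_rationalEnd a)
      (fun ε i n => by
        rw [Subalgebra.mem_comap, fuseHom, IsPreRep.lift_phi]
        exact fusePhi_mem_rationalEnd ε i n)
  exact (this ▸ Algebra.mem_top : g ∈ (rationalEnd (V ⊗[ℂ] V')).comap (fuseHom hq hρ hρ'))

/-- The fused action on `ℂ(u) ⊗ (V ⊗ V')`. -/
def fuseAct (hq : NotRootOfUnity ħ) (hρ : IsMod ρ) (hρ' : IsMod ρ') :
    U R ħ →ₐ[ℂ] Module.End Cu (Cu ⊗[ℂ] (V ⊗[ℂ] V')) :=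
  rationalAct.comp ((fuseHom hq hρ hρ').codRestrict _ (fuseHom_mem_rationalEnd hq hρ hρ'))

theorem toHahn_fuseAct (hq : NotRootOfUnity ħ) (hρ : IsMod ρ) (hρ' : IsMod ρ') (g : U R ħ)
    (y : Cu ⊗[ℂ] (V ⊗[ℂ] V')) :
    toHahn (fuseAct hq hρ hρ' g y) = fuseHom hq hρ hρ' g • toHahn y :=
  toHahn_rationalAct _ y

end

/-! ### Cyclicity of the fused module -/

section HighestWeight

variable {ι : Type*} [Fintype ι] {𝔥 : Type*} [AddCommGroup 𝔥] [Module ℚ 𝔥]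
  {A : CartanDatum ι} {R : Realization A 𝔥} {ħ : ℂ}
  {V : Type*} [AddCommGroup V] [Module ℂ V] {ρ : U R ħ →ₐ[ℂ] Module.End ℂ V}
  {lam : Module.Dual ℚ 𝔥} {Ψ : ℤˣ → ι → ℕ → ℂ} {v : V}

/-- The vectors `x^-_{i₁,r₁} ⋯ x^-_{iₙ,rₙ} v` with all `r_j` in `I`. -/
inductive LoweringWord (ρ : U R ħ →ₐ[ℂ] Module.End ℂ V) (v : V) (I : Set ℤ) : V → Prop
  | base : LoweringWord ρ v I v
  | step {w : V} (hw : LoweringWord ρ v I w) (i : ι) {r : ℤ} (hr : r ∈ I) :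
      LoweringWord ρ v I (ρ (x R ħ (-1) i r) w)

theorem IsLHighestWeightVector.mem_weightSpace (hv : IsLHighestWeightVector ρ lam Ψ v) :
    v ∈ weightSpace ρ lam := QuantumFusion.mem_weightSpace.2 hv.k_apply

theorem IsLHighestWeightVector.exists_weight (hv : IsLHighestWeightVector ρ lam Ψ v) {I : Set ℤ}
    {w : V} (hw : LoweringWord ρ v I w) : ∃ ω, w ∈ weightSpace ρ ω := by
  induction hw with
  | base => exact ⟨lam, hv.mem_weightSpace⟩
  | step hw i hr ih =>
    obtain ⟨ω, h⟩ := ih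
    exact ⟨_, map_x_mem_weightSpace (-1) i _ h⟩

theorem IsLHighestWeightVector.phi_apply_eq (hv : IsLHighestWeightVector ρ lam Ψ v) (ε : ℤˣ)
    (i : ι) (n : ℤ) : ∃ c : ℂ, ρ (phi R ħ ε i n) v = c • v := by
  rcases lt_or_ge ((ε : ℤ) * n) 0 with hn | hn
  · exact ⟨0, by rw [phi_eq_zero ε i n hn]; simp⟩
  · rw [exists_eq_units_mul_nat ε hn]
    exact ⟨_, hv.phi_apply ε i _⟩

/-- This is the triangular decomposition applied to v. The span is stable under φ, which moves to
the right through the x^-; under k, by weights; and under x^+, whose commutators with x^- are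
combinations of φ. -/
theorem IsLHighestWeightVector.span_loweringWord_univ (hq : NotRootOfUnity ħ)
    (hv : IsLHighestWeightVector ρ lam Ψ v) :
    Submodule.span ℂ {w | LoweringWord ρ v Set.univ w} = ⊤ := by
  set S := Submodule.span ℂ {w | LoweringWord ρ v Set.univ w} with hS
  have hle : ∀ g : U R ħ, (∀ w, LoweringWord ρ v Set.univ w → ρ g w ∈ S) →
      ∀ w ∈ S, ρ g w ∈ S := fun g hg =>
    (Submodule.span_le (p := S.comap (ρ g))).2 hg
  have hxm : ∀ i r, ∀ w ∈ S, ρ (x R ħ (-1) i r) w ∈ S := fun i r =>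
    hle _ fun w hw => Submodule.subset_span (hw.step i (Set.mem_univ r))
  have hphi : ∀ ε i n, ∀ w ∈ S, ρ (phi R ħ ε i n) w ∈ S := by
    intro ε i n
    refine hle _ fun w hw => ?_
    induction hw generalizing n with
    | base =>
      obtain ⟨c, hc⟩ := hv.phi_apply_eq ε i n
      rw [hc]
      exact S.smul_mem _ (Submodule.subset_span LoweringWord.base)
    | @step w hw j r _ ih =>
      rcases lt_or_ge ((ε : ℤ) * n) 0 with hn | hn
      · rw [phi_eq_zero ε i n hn]
        simp
      · rw [exists_eq_units_mul_nat ε hn, ← Module.End.mul_apply, ← map_mul,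
          (isPreRep_U R ħ).phi_x, map_sum, LinearMap.sum_apply]
        refine S.sum_mem fun s _ => ?_
        rw [map_smul, map_mul]
        exact S.smul_mem _ (hxm _ _ _ (ih _))
  have hxp : ∀ i r, ∀ w ∈ S, ρ (x R ħ 1 i r) w ∈ S := by
    intro i r
    refine hle _ fun w hw => ?_
    induction hw with
    | base => rw [hv.x_apply]; exact S.zero_mem
    | @step w hw j s _ ih =>
      have hwS : w ∈ S := Submodule.subset_span hw
      have key : ρ (x R ħ 1 i r * x R ħ (-1) j s - x R ħ (-1) j s * x R ħ 1 i r) w ∈ S := by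
        by_cases hij : i = j
        · subst hij
          rw [(isPreRep_U R ħ).x_pm_same, map_smul, map_sub]
          exact S.smul_mem _ (S.sub_mem (hphi _ _ _ _ hwS) (hphi _ _ _ _ hwS))
        · rw [(isPreRep_U R ħ).x_pm_ne i j hij]
          simp
      have := S.add_mem key (hxm j s _ ih)
      simpa using this
  have hk : ∀ a, ∀ w ∈ S, ρ (k R ħ a) w ∈ S := by
    intro a
    refine hle _ fun w hw => ?_
    obtain ⟨ω, hω⟩ := hv.exists_weight hw
    rw [QuantumFusion.mem_weightSpace.1 hω]
    exact S.smul_mem _ (Submodule.subset_span hw)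
  let T : Subalgebra ℂ (U R ħ) :=
    { carrier := {g | ∀ w ∈ S, ρ g w ∈ S}
      mul_mem' := fun {g g'} hg hg' w hw => by
        rw [map_mul]
        exact hg _ (hg' w hw)
      add_mem' := fun {g g'} hg hg' w hw => by
        rw [map_add]
        exact S.add_mem (hg w hw) (hg' w hw)
      algebraMap_mem' := fun c w hw => by
        rw [AlgHom.commutes]
        exact S.smul_mem c hw }
  have hT : T = ⊤ := U.subalgebra_eq_top hq T
    (fun ε i r => by
      rcases Int.units_eq_one_or ε with rfl | rfl
      exacts [hxp i r, hxm i r]) hk hphi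
  rw [eq_top_iff]
  intro w _
  obtain ⟨g, rfl⟩ := hv.generates w
  have hg : g ∈ T := hT ▸ Algebra.mem_top
  exact hg v (Submodule.subset_span LoweringWord.base)

/-- Each letter acts on a weight vector, where `x_mem_span` replaces its mode by modes beyond N in
the direction η. -/
theorem IsLHighestWeightVector.span_loweringWord (hq : NotRootOfUnity ħ) (hρ : IsMod ρ)
    (hv : IsLHighestWeightVector ρ lam Ψ v) (η : ℤˣ) (N : ℤ) :
    Submodule.span ℂ {w | LoweringWord ρ v {r | N ≤ (η : ℤ) * r} w} = ⊤ := by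
  set S := Submodule.span ℂ {w | LoweringWord ρ v {r | N ≤ (η : ℤ) * r} w} with hS
  have hx : ∀ i r, ∀ w ∈ S, ρ (x R ħ (-1) i r) w ∈ S := by
    intro i r
    refine (Submodule.span_le (p := S.comap (ρ (x R ħ (-1) i r)))).2 fun w hw => ?_
    obtain ⟨ω, hω⟩ := hv.exists_weight hw
    have := x_mem_span hq hρ (-1) η i r N hω
    refine (Submodule.span_le (p := S)).2 ?_ this
    rintro _ ⟨m, hm, rfl⟩
    exact Submodule.subset_span (LoweringWord.step hw i hm)
  rw [eq_top_iff, ← hv.span_loweringWord_univ hq, Submodule.span_le]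
  intro w hw
  induction hw with
  | base => exact Submodule.subset_span LoweringWord.base
  | step hw i hr ih => exact hx _ _ _ ih

end HighestWeight

/-! ### From leading coefficients to elements -/

section Lattice

variable {E : Type*} [AddCommGroup E] [Module ℂ E]

/-- The image in ℂ(u) ⊗ (E / F) has zero expansion, so it is zero, and tensoring with ℂ(u) is exact.
-/
theorem exists_baseChange_subtype_eq {F : Submodule ℂ E} {z : Cu ⊗[ℂ] E}
    (hz : toHahn z ∈ hahnSub F) : ∃ y : Cu ⊗[ℂ] F, F.subtype.baseChange Cu y = z := by
  have h0 : F.mkQ.baseChange Cu z = 0 := by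
    refine eq_zero_of_coeffMap_eq_zero fun n => ?_
    rw [coeffMap_baseChange]
    exact (Submodule.Quotient.mk_eq_zero F).2 (hz n)
  have hex : Function.Exact F.subtype F.mkQ := fun e => by simp
  obtain ⟨y, hy⟩ := (lTensor_exact Cu hex F.mkQ_surjective z).1
    (by rw [← LinearMap.baseChange_eq_ltensor]; exact h0)
  exact ⟨y, by rw [← hy, ← LinearMap.baseChange_eq_ltensor]⟩

/-- A series 1 + O(u) does not change the lowest coefficient of a vector, so it kills no nonzero
vector. -/
theorem hcoeff_eq_zero_of_smul_eq_zero {D : HahnSeries ℤ (Module.End ℂ E)}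
    (hD : ∀ n < 0, D.coeff n = 0) (hD0 : D.coeff 0 = 1) {y : Cu ⊗[ℂ] E}
    (h : D • toHahn y = 0) : y = 0 := by
  obtain ⟨N, hN⟩ := exists_coeffMap_eq_zero y
  have hk : ∀ k : ℕ, ∀ n < N + k, coeffMap E n y = 0 := by
    intro k
    induction k with
    | zero => simpa using hN
    | succ k ih =>
      intro n hn
      have e := congrArg (fun z => hcoeff z n) h
      simp only [hcoeff_zero] at e
      rw [hcoeff_smul, finsum_eq_single _ 0] at e
      · rwa [hD0, sub_zero] at e
      · intro j hj
        rcases lt_or_gt_of_ne hj with hj | hj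
        · rw [hD j hj, LinearMap.zero_apply]
        · rw [hcoeff_toHahn, ih (n - j) (by push_cast at hn; omega), map_zero]
  exact eq_zero_of_coeffMap_eq_zero fun n => hk (n - N + 1).toNat n (by omega)

/-- A subspace of `ℂ(u) ⊗ E` that contains enough elements with leading coefficient in a finite
dimensional subspace `F` contains `F`. -/
theorem one_tmul_mem_of_leading {F : Submodule ℂ E} [Module.Finite ℂ F]
    {N : Submodule Cu (Cu ⊗[ℂ] E)}
    (h : ∀ e ∈ F, ∃ z ∈ N, toHahn z ∈ hahnSub F ∧ (∀ n < 0, coeffMap E n z = 0) ∧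
      coeffMap E 0 z = e) {e : E} (he : e ∈ F) : 1 ⊗ₜ e ∈ N := by
  let b := Module.finBasis ℂ F
  have hy : ∀ j, ∃ y : Cu ⊗[ℂ] F, F.subtype.baseChange Cu y ∈ N ∧
      (∀ n < 0, coeffMap F n y = 0) ∧ coeffMap F 0 y = b j := by
    intro j
    obtain ⟨z, hzN, hzF, hneg, h0⟩ := h (b j) (b j).2
    obtain ⟨y, rfl⟩ := exists_baseChange_subtype_eq hzF
    simp only [coeffMap_baseChange] at hneg h0
    exact ⟨y, hzN, fun n hn => by simpa using hneg n hn, Subtype.ext h0⟩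
  choose y hyN hyneg hy0 using hy
  -- L sends each basis vector to a lift in N with that leading coefficient, so L = 1 + O(u). It is
  -- therefore injective, hence surjective in finite dimension, and its image maps into N.
  let L : Module.End Cu (Cu ⊗[ℂ] F) := (b.baseChange Cu).constr Cu y
  have hLb : ∀ j, L (1 ⊗ₜ b j) = y j := by
    intro j
    rw [← Module.Basis.baseChange_apply Cu b j]
    exact (b.baseChange Cu).constr_basis Cu y j
  let g : ℤ → Module.End ℂ F := fun n =>
    coeffMap F n ∘ₗ L.restrictScalars ℂ ∘ₗ TensorProduct.mk ℂ Cu F 1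
  have hg : ∀ n e, g n e = coeffMap F n (L (1 ⊗ₜ e)) := fun n e => rfl
  have hgneg : ∀ n < 0, g n = 0 := fun n hn => b.ext fun j => by
    rw [hg, hLb, hyneg j n hn, LinearMap.zero_apply]
  let D : HahnSeries ℤ (Module.End ℂ F) := HahnSeries.ofSuppBddBelow g ⟨0, fun n hn => by
    by_contra hlt
    exact hn (hgneg n (not_le.1 hlt))⟩
  have hD : ∀ n, D.coeff n = g n := fun n => rfl
  have hLD : ∀ y, toHahn (L y) = D • toHahn y := by
    intro y
    induction y with
    | zero => rw [map_zero, map_zero, hahn_smul_zero]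
    | tmul f e =>
      have e1 : f ⊗ₜ[ℂ] e = f • ((1 : Cu) ⊗ₜ[ℂ] e) := by
        rw [TensorProduct.smul_tmul', smul_eq_mul, mul_one]
      rw [e1, map_smul, smul_toHahn_smul, toHahn_smul]
      congr 1
      refine hahnModule_ext fun n => ?_
      rw [hcoeff_smul_one_tmul, hcoeff_toHahn, hD, hg]
    | add y z hy hz => rw [map_add, map_add, hy, hz, map_add, hahn_smul_add]
  have hinj : Function.Injective L := by
    rw [injective_iff_map_eq_zero]
    intro y hy
    refine hcoeff_eq_zero_of_smul_eq_zero (D := D) hgneg (b.ext fun j => ?_)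
      (by rw [← hLD, hy, map_zero])
    rw [hD, hg, hLb, hy0]
    rfl
  obtain ⟨w, hw⟩ := LinearMap.surjective_of_injective hinj (1 ⊗ₜ ⟨e, he⟩)
  have hall : ∀ w, F.subtype.baseChange Cu (L w) ∈ N := by
    have : (⊤ : Submodule Cu (Cu ⊗[ℂ] F)) ≤ N.comap (F.subtype.baseChange Cu ∘ₗ L) := by
      rw [← (b.baseChange Cu).span_eq, Submodule.span_le]
      rintro _ ⟨j, rfl⟩
      rw [Module.Basis.baseChange_apply]
      change F.subtype.baseChange Cu (L _) ∈ N
      rw [hLb]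
      exact hyN j
    exact fun w => this Submodule.mem_top
  have := hall w
  rw [hw] at this
  simpa using this

end Lattice

/-! ### The submodule generated by the highest weight vectors -/

section Cyclic

variable {ι : Type*} [Fintype ι] {𝔥 : Type*} [AddCommGroup 𝔥] [Module ℚ 𝔥]
  {A : CartanDatum ι} {R : Realization A 𝔥} {ħ : ℂ}
  {V : Type*} [AddCommGroup V] [Module ℂ V] {V' : Type*} [AddCommGroup V'] [Module ℂ V']
  {ρ : U R ħ →ₐ[ℂ] Module.End ℂ V} {ρ' : U R ħ →ₐ[ℂ] Module.End ℂ V'}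

variable (ρ ρ') in
/-- The leading coefficients of the elements of `N` of total weight `μ`. -/
def leading (N : Submodule Cu (Cu ⊗[ℂ] (V ⊗[ℂ] V'))) (μ : Module.Dual ℚ 𝔥) :
    Submodule ℂ (V ⊗[ℂ] V') where
  carrier := {e | ∃ z ∈ N, toHahn z ∈ hahnSub (totalWeight ρ ρ' μ) ∧
    (∀ n < 0, coeffMap (V ⊗[ℂ] V') n z = 0) ∧ coeffMap (V ⊗[ℂ] V') 0 z = e}
  zero_mem' := ⟨0, N.zero_mem, by rw [map_zero]; exact AddSubgroup.zero_mem _, by simp, by simp⟩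
  add_mem' := by
    rintro _ _ ⟨z, hz, hz', hn, rfl⟩ ⟨w, hw, hw', hn', rfl⟩
    exact ⟨z + w, N.add_mem hz hw, by rw [map_add]; exact AddSubgroup.add_mem _ hz' hw',
      fun n h => by rw [map_add, hn n h, hn' n h, add_zero], map_add _ _ _⟩
  smul_mem' := by
    rintro c _ ⟨z, hz, hz', hn, rfl⟩
    refine ⟨c • z, ?_, ?_, fun n h => by rw [map_smul, hn n h, smul_zero], map_smul _ _ _⟩
    · rw [← algebraMap_smul Cu c z]
      exact N.smul_mem _ hz
    · intro n
      rw [hcoeff_toHahn, map_smul]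
      exact Submodule.smul_mem _ _ (hz' n)

theorem leading_le (N : Submodule Cu (Cu ⊗[ℂ] (V ⊗[ℂ] V'))) (μ : Module.Dual ℚ 𝔥) :
    leading ρ ρ' N μ ≤ totalWeight ρ ρ' μ := by
  rintro _ ⟨z, _, hz, _, rfl⟩
  exact hz 0

variable (hq : NotRootOfUnity ħ) (hρ : IsMod ρ) (hρ' : IsMod ρ')

/-- If the expansion of g starts at u^t, then u^{-t} g z lies in N again, and its leading
coefficient is the t-th coefficient of g applied to that of z. -/
theorem leading_map {N : Submodule Cu (Cu ⊗[ℂ] (V ⊗[ℂ] V'))}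
    (hN : ∀ g, ∀ y ∈ N, fuseAct hq hρ hρ' g y ∈ N) {g : U R ħ} {t : ℤ}
    (hg : ∀ n < t, (fuseHom hq hρ hρ' g).coeff n = 0) {μ ν : Module.Dual ℚ 𝔥}
    (hgw : ∀ n, ∀ e ∈ totalWeight ρ ρ' μ,
      (fuseHom hq hρ hρ' g).coeff n e ∈ totalWeight ρ ρ' ν) {e : V ⊗[ℂ] V'}
    (he : e ∈ leading ρ ρ' N μ) : (fuseHom hq hρ hρ' g).coeff t e ∈ leading ρ ρ' N ν := by
  obtain ⟨z, hz, hz', hn, rfl⟩ := he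
  have key : ∀ n, coeffMap (V ⊗[ℂ] V') n (uPow (-t) • fuseAct hq hρ hρ' g z) =
      hcoeff (fuseHom hq hρ hρ' g • toHahn z) (n + t) := by
    intro n
    rw [coeffMap_uPow_smul, ← hcoeff_toHahn, toHahn_fuseAct, sub_neg_eq_add]
  refine ⟨uPow (-t) • fuseAct hq hρ hρ' g z, N.smul_mem _ (hN g z hz), fun n => ?_, fun n h => ?_,
    ?_⟩
  · rw [hcoeff_toHahn, key]
    exact smul_mem_hahnSub hgw hz' _
  · rw [key, hcoeff_smul, finsum_eq_zero_of_forall_eq_zero]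
    intro j
    rcases lt_or_ge j t with hj | hj
    · rw [hg j hj, LinearMap.zero_apply]
    · rw [hcoeff_toHahn, hn _ (by omega), map_zero]
  · rw [key, zero_add, hcoeff_smul, finsum_eq_single _ t]
    · rw [sub_self, hcoeff_toHahn]
    · intro j hj
      rcases lt_or_gt_of_ne hj with hj | hj
      · rw [hg j hj, LinearMap.zero_apply]
      · rw [hcoeff_toHahn, hn _ (by omega), map_zero]

theorem iSup_leading_map {N : Submodule Cu (Cu ⊗[ℂ] (V ⊗[ℂ] V'))}
    (hN : ∀ g, ∀ y ∈ N, fuseAct hq hρ hρ' g y ∈ N) {i : ι} {r t : ℤ}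
    (hg : ∀ n < t, (fuseX ρ ρ' (-1) i r).coeff n = 0) {e : V ⊗[ℂ] V'}
    (he : e ∈ ⨆ μ, leading ρ ρ' N μ) :
    (fuseX ρ ρ' (-1) i r).coeff t e ∈ ⨆ μ, leading ρ ρ' N μ := by
  have hx : fuseHom hq hρ hρ' (x R ħ (-1) i r) = fuseX ρ ρ' (-1) i r := IsPreRep.lift_x _ _ _ _ _
  have : ⨆ μ, leading ρ ρ' N μ ≤
      (⨆ μ, leading ρ ρ' N μ).comap ((fuseX ρ ρ' (-1) i r).coeff t) := by
    refine iSup_le fun μ e he => Submodule.mem_iSup_of_mem (μ + ((-1 : ℤˣ) : ℤ) • R.root i) ?_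
    have := leading_map hq hρ hρ' hN (g := x R ħ (-1) i r) (t := t) (by rwa [hx])
      (by rw [hx]; exact fun n e he => coeff_fuseX_mem (-1) i r n he) he
    rwa [hx] at this
  exact this he

variable {lam lam' : Module.Dual ℚ 𝔥} {Ψ Ψ' : ℤˣ → ι → ℕ → ℂ} {v : V} {v' : V'}

/-- The fused module is generated by the tensor product of the highest weight vectors. -/
theorem eq_top_of_fuseAct_mem (hv : IsLHighestWeightVector ρ lam Ψ v)
    (hv' : IsLHighestWeightVector ρ' lam' Ψ' v') {N : Submodule Cu (Cu ⊗[ℂ] (V ⊗[ℂ] V'))}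
    (hN : ∀ g, ∀ y ∈ N, fuseAct hq hρ hρ' g y ∈ N) (hvN : 1 ⊗ₜ (v ⊗ₜ v') ∈ N) : N = ⊤ := by
  set S := ⨆ μ, leading ρ ρ' N μ with hS
  have hbase : v ⊗ₜ v' ∈ S := by
    refine Submodule.mem_iSup_of_mem (lam + lam') ⟨_, hvN, ?_, fun n hn => ?_, ?_⟩
    · exact toHahn_one_tmul_mem (tmul_mem_totalWeight hv.mem_weightSpace hv'.mem_weightSpace)
    · rw [coeffMap_one_tmul, if_neg hn.ne]
    · rw [coeffMap_one_tmul, if_pos rfl]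
  have h1 : ∀ w', v ⊗ₜ w' ∈ S := by
    have : (⊤ : Submodule ℂ V') ≤ S.comap (TensorProduct.mk ℂ V V' v) := by
      -- With modes r ≤ -1, the term u^r (1 ⊗ x^-_r) comes strictly before the tail, which starts at
      -- u^0. So the leading term acts on the second factor alone.
      rw [← hv'.span_loweringWord hq hρ' (-1) 1, Submodule.span_le]
      intro w' hw'
      induction hw' with
      | base => exact hbase
      | @step w' _ i r hr ih =>
        have hr : 1 ≤ -r := by simpa using hr
        have := iSup_leading_map hq hρ hρ' hN (i := i) (r := r) (t := r) (fun n hn => by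
          rw [coeff_fuseX_neg_one, if_neg hn.ne, phi_eq_zero 1 i n (by simp; omega)]
          simp) ih
        rwa [coeff_fuseX_neg_one, if_pos rfl, phi_eq_zero 1 i r (by simp; omega), map_zero,
          TensorProduct.map_zero_right, add_zero] at this
    exact fun w' => this Submodule.mem_top
  have h2 : ∀ w w', w ⊗ₜ w' ∈ S := by
    have : (⊤ : Submodule ℂ V) ≤ ⨅ w' : V', S.comap ((TensorProduct.mk ℂ V V').flip w') := by
      -- With modes r ≥ 1, the order is reversed: the lowest term is x^-_r ⊗ φ^+_0 at u^0, and 1 ⊗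
      -- x^-_r appears only at u^r.
      rw [← hv.span_loweringWord hq hρ 1 1, Submodule.span_le]
      intro w hw
      induction hw with
      | base => exact (Submodule.mem_iInf _).2 h1
      | @step w _ i r hr ih =>
        have hr : 1 ≤ r := by simpa using hr
        refine (Submodule.mem_iInf _).2 fun w' => ?_
        -- The second vector is multiplied beforehand by the inverse of φ^+_0, so that the leading
        -- term gives x^-_r w ⊗ w' exactly.
        have ih' := (Submodule.mem_iInf _).1 ih (ρ' (k R ħ (-((((1 : ℤˣ) : ℤ) * (A.r i : ℤ)) •
          R.coroot i))) w')
        have := iSup_leading_map hq hρ hρ' hN (i := i) (r := r) (t := 0) (fun n hn => by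
          rw [coeff_fuseX_neg_one, if_neg (by omega), phi_eq_zero 1 i n (by simp; omega)]
          simp) ih'
        rw [coeff_fuseX_neg_one, if_neg (by omega), zero_add, sub_zero, phi_zero_eq,
          LinearMap.flip_apply, TensorProduct.mk_apply, TensorProduct.map_tmul,
          ← Module.End.mul_apply (ρ' _) (ρ' _), ← map_mul, (isPreRep_U R ħ).k_mul_neg, map_one,
          Module.End.one_apply] at this
        exact this
    exact fun w w' => (Submodule.mem_iInf _).1 (this (Submodule.mem_top (x := w))) w'
  have hStop : S = ⊤ := by
    rw [eq_top_iff, ← TensorProduct.span_tmul_eq_top ℂ V V', Submodule.span_le]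
    rintro _ ⟨w, w', rfl⟩
    exact h2 w w'
  -- The leading spaces lie inside the independent total weight spaces and their sum is everything,
  -- so each of them is the full weight space.
  have hle := (iSupIndep_totalWeight (ρ := ρ) (ρ' := ρ') hq).le_iff_eq_of_iSup_eq_top
    (f := leading ρ ρ' N) hStop
  have heq := hle.1 (leading_le N)
  have hone : ∀ e : V ⊗[ℂ] V', (1 : Cu) ⊗ₜ[ℂ] e ∈ N := by
    have : (⊤ : Submodule ℂ (V ⊗[ℂ] V')) ≤
        (N.restrictScalars ℂ).comap (TensorProduct.mk ℂ Cu (V ⊗[ℂ] V') 1) := by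
      rw [← iSup_totalWeight_eq_top hρ hρ']
      refine iSup_le fun μ e he => ?_
      have := finite_totalWeight hρ hρ' μ
      refine one_tmul_mem_of_leading (F := totalWeight ρ ρ' μ) (fun e he => ?_) he
      rwa [← heq] at he
    exact fun e => this Submodule.mem_top
  rw [eq_top_iff]
  intro y _
  induction y with
  | zero => exact N.zero_mem
  | tmul f e =>
    have e1 : f ⊗ₜ[ℂ] e = f • ((1 : Cu) ⊗ₜ[ℂ] e) := by
      rw [TensorProduct.smul_tmul', smul_eq_mul, mul_one]
    rw [e1]
    exact N.smul_mem _ (hone e)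
  | add y z hy hz => exact N.add_mem (hy Submodule.mem_top) (hz Submodule.mem_top)

end Cyclic

/-! ### The fusion product -/

section Fusion

variable {ι : Type*} [Fintype ι] {𝔥 : Type*} [AddCommGroup 𝔥] [Module ℚ 𝔥]
  {A : CartanDatum ι} {R : Realization A 𝔥} {ħ : ℂ}
  {V : Type*} [AddCommGroup V] [Module ℂ V] {V' : Type*} [AddCommGroup V'] [Module ℂ V']
  {ρ : U R ħ →ₐ[ℂ] Module.End ℂ V} {ρ' : U R ħ →ₐ[ℂ] Module.End ℂ V'}

/-- The extension of scalars of a representation on a vector space over `ℂ(u)`. -/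
def liftCu {𝓐 M : Type*} [Ring 𝓐] [Algebra ℂ 𝓐] [AddCommGroup M] [Module Cu M] [Module ℂ M]
    [IsScalarTower ℂ Cu M] (g : 𝓐 →ₐ[ℂ] Module.End Cu M) : Cu ⊗[ℂ] 𝓐 →ₐ[Cu] Module.End Cu M :=
  Algebra.TensorProduct.lift (Algebra.ofId Cu _) g fun c _ => Algebra.commutes c _

theorem liftCu_one_tmul {𝓐 M : Type*} [Ring 𝓐] [Algebra ℂ 𝓐] [AddCommGroup M] [Module Cu M]
    [Module ℂ M] [IsScalarTower ℂ Cu M] (g : 𝓐 →ₐ[ℂ] Module.End Cu M) (a : 𝓐) :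
    liftCu g (1 ⊗ₜ a) = g a :=
  (Algebra.TensorProduct.lift_tmul _ _ _ _ _).trans (by rw [map_one, one_mul])

theorem extendScalars_inU'_tmul (g : U R ħ) (f : Cu) (v : V) :
    extendScalars ρ (inU' g) (f ⊗ₜ v) = f ⊗ₜ ρ g v := by
  have e : extendScalars ρ (inU' g) = Module.End.baseChangeHom ℂ Cu V (ρ g) :=
    liftCu_one_tmul ((Module.End.baseChangeHom ℂ Cu V).comp ρ) g
  rw [e]
  rfl

theorem expand_eq (n : ℤ) (y : (Cu ⊗[ℂ] V) ⊗[Cu] (Cu ⊗[ℂ] V')) : expand V V' n y =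
    coeffMap (V ⊗[ℂ] V') n
      ((TensorProduct.AlgebraTensorModule.distribBaseChange ℂ Cu V V').symm y) := rfl

/-- Together with the prescribed expansions of the generators, this makes the fusion action unique,
and it lets identities be checked coefficient by coefficient in u. -/
theorem expand_injective {y z : (Cu ⊗[ℂ] V) ⊗[Cu] (Cu ⊗[ℂ] V')}
    (h : ∀ n, expand V V' n y = expand V V' n z) : y = z := by
  apply (TensorProduct.AlgebraTensorModule.distribBaseChange ℂ Cu V V').symm.injective
  rw [← sub_eq_zero]
  refine eq_zero_of_coeffMap_eq_zero fun n => ?_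
  rw [map_sub, ← expand_eq, ← expand_eq, h, sub_self]

theorem expand_uPow_smul_tmul (n m : ℤ) (v : V) (v' : V') :
    expand V V' n (uPow m • (((1 : Cu) ⊗ₜ[ℂ] v) ⊗ₜ[Cu] ((1 : Cu) ⊗ₜ[ℂ] v'))) =
      if n = m then v ⊗ₜ v' else 0 := by
  rw [expand_eq, map_smul, TensorProduct.AlgebraTensorModule.distribBaseChange_symm_tmul, mul_one,
    coeffMap_uPow_smul, coeffMap_one_tmul]
  simp only [sub_eq_zero]

theorem expand_tmul (n : ℤ) (v : V) (v' : V') :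
    expand V V' n (((1 : Cu) ⊗ₜ[ℂ] v) ⊗ₜ[Cu] ((1 : Cu) ⊗ₜ[ℂ] v')) =
      if n = 0 then v ⊗ₜ v' else 0 := by
  have := expand_uPow_smul_tmul n 0 v v'
  rwa [uPow, zpow_zero, one_smul] at this

theorem one_tmul_smul (c : ℂ) (v : V) :
    (1 : Cu) ⊗ₜ[ℂ] (c • v) = algebraMap ℂ Cu c • ((1 : Cu) ⊗ₜ[ℂ] v) := by
  rw [TensorProduct.tmul_smul, algebraMap_smul]

theorem tmul_ne_zero_of_ne_zero {v : V} {v' : V'} (hv : v ≠ 0) (hv' : v' ≠ 0) :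
    v ⊗ₜ[ℂ] v' ≠ 0 := by
  intro h
  obtain ⟨f, hf⟩ := not_forall.1 (mt (Module.forall_dual_apply_eq_zero_iff ℂ v).1 hv)
  obtain ⟨f', hf'⟩ := not_forall.1 (mt (Module.forall_dual_apply_eq_zero_iff ℂ v').1 hv')
  have := congrArg ((TensorProduct.lid ℂ ℂ).toLinearMap ∘ₗ TensorProduct.map f f') h
  simp [hf, hf'] at this

theorem end_ext_tmul {f g : Module.End Cu ((Cu ⊗[ℂ] V) ⊗[Cu] (Cu ⊗[ℂ] V'))}
    (h : ∀ v v', f (((1 : Cu) ⊗ₜ[ℂ] v) ⊗ₜ[Cu] ((1 : Cu) ⊗ₜ[ℂ] v')) =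
      g (((1 : Cu) ⊗ₜ[ℂ] v) ⊗ₜ[Cu] ((1 : Cu) ⊗ₜ[ℂ] v'))) : f = g := by
  ext v v'
  exact h v v'

variable (ρ ρ') in
/-- The terms of the sum defining the action of `x^+_{i,r}`. -/
theorem hasUSum_plus_iff (i : ι) (r : ℤ) (v : V) (v' : V')
    (y : (Cu ⊗[ℂ] V) ⊗[Cu] (Cu ⊗[ℂ] V')) :
    HasUSum (fun s : ℕ => uPow (r + s) •
        ((extendScalars ρ (inU' (phi R ħ (-1) i (-s))) (1 ⊗ₜ v)) ⊗ₜ[Cu]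
          (extendScalars ρ' (inU' (x R ħ 1 i (r + s))) (1 ⊗ₜ v'))))
      (y - (extendScalars ρ (inU' (x R ħ 1 i r)) (1 ⊗ₜ v)) ⊗ₜ[Cu] (1 ⊗ₜ v')) ↔
    ∀ n, expand V V' n y = (fuseX ρ ρ' 1 i r).coeff n (v ⊗ₜ v') := by
  refine forall_congr' fun n => ?_
  simp only [extendScalars_inU'_tmul, expand_uPow_smul_tmul, map_sub, expand_tmul]
  have hsupp : ∀ s : ℕ, s ≠ (n - r).toNat → (if n = r + s then ρ (phi R ħ (-1) i (-s)) v ⊗ₜ[ℂ]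
      ρ' (x R ħ 1 i (r + s)) v' else 0) = 0 := fun s hs => if_neg (by omega)
  rw [finsum_eq_single _ (n - r).toNat hsupp, coeff_fuseX_one, LinearMap.add_apply]
  have hfin : (Function.support fun s : ℕ => if n = r + s then ρ (phi R ħ (-1) i (-s)) v ⊗ₜ[ℂ]
      ρ' (x R ħ 1 i (r + s)) v' else 0).Finite :=
    (Set.finite_singleton (n - r).toNat).subset fun s hs => by
      by_contra hne
      exact hs (hsupp s hne)
  have hterm : (if n = r + ((n - r).toNat : ℤ) then
      ρ (phi R ħ (-1) i (-((n - r).toNat : ℤ))) v ⊗ₜ[ℂ]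
        ρ' (x R ħ 1 i (r + ((n - r).toNat : ℤ))) v' else 0) =
      TensorProduct.map (ρ (phi R ħ (-1) i (r - n))) (ρ' (x R ħ 1 i n)) (v ⊗ₜ v') := by
    rcases lt_or_ge n r with h | h
    · rw [if_neg (by omega), phi_eq_zero (-1) i _ (by simp; omega)]
      simp
    · rw [if_pos (by omega), TensorProduct.map_tmul,
        show -((n - r).toNat : ℤ) = r - n by omega, show r + ((n - r).toNat : ℤ) = n by omega]
  rw [and_iff_right hfin, hterm, eq_sub_iff_add_eq', eq_comm]
  split_ifs <;> simp

variable (ρ ρ') in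
/-- The terms of the sum defining the action of `x^-_{i,r}`. -/
theorem hasUSum_minus_iff (i : ι) (r : ℤ) (v : V) (v' : V')
    (y : (Cu ⊗[ℂ] V) ⊗[Cu] (Cu ⊗[ℂ] V')) :
    HasUSum (fun s : ℕ => uPow s •
        ((extendScalars ρ (inU' (x R ħ (-1) i (r - s))) (1 ⊗ₜ v)) ⊗ₜ[Cu]
          (extendScalars ρ' (inU' (phi R ħ 1 i s)) (1 ⊗ₜ v'))))
      (y - uPow r • ((1 ⊗ₜ v) ⊗ₜ[Cu] (extendScalars ρ' (inU' (x R ħ (-1) i r)) (1 ⊗ₜ v')))) ↔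
    ∀ n, expand V V' n y = (fuseX ρ ρ' (-1) i r).coeff n (v ⊗ₜ v') := by
  refine forall_congr' fun n => ?_
  simp only [extendScalars_inU'_tmul, expand_uPow_smul_tmul, map_sub]
  have hsupp : ∀ s : ℕ, s ≠ n.toNat → (if n = s then ρ (x R ħ (-1) i (r - s)) v ⊗ₜ[ℂ]
      ρ' (phi R ħ 1 i s) v' else 0) = 0 := fun s hs => if_neg (by omega)
  rw [finsum_eq_single _ n.toNat hsupp, coeff_fuseX_neg_one, LinearMap.add_apply]
  have hfin : (Function.support fun s : ℕ => if n = s then ρ (x R ħ (-1) i (r - s)) v ⊗ₜ[ℂ]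
      ρ' (phi R ħ 1 i s) v' else 0).Finite :=
    (Set.finite_singleton n.toNat).subset fun s hs => by
      by_contra hne
      exact hs (hsupp s hne)
  have hterm : (if n = (n.toNat : ℤ) then ρ (x R ħ (-1) i (r - (n.toNat : ℤ))) v ⊗ₜ[ℂ]
        ρ' (phi R ħ 1 i (n.toNat : ℤ)) v' else 0) =
      TensorProduct.map (ρ (x R ħ (-1) i (r - n))) (ρ' (phi R ħ 1 i n)) (v ⊗ₜ v') := by
    rcases lt_or_ge n 0 with h | h
    · rw [if_neg (by omega), phi_eq_zero 1 i n (by simpa using h)]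
      simp
    · rw [if_pos (by omega), TensorProduct.map_tmul, Int.toNat_of_nonneg h]
  rw [and_iff_right hfin, hterm, eq_sub_iff_add_eq', eq_comm]
  split_ifs <;> simp

/-- The fusion module structure is unique. -/
theorem IsFusion.unique (hq : NotRootOfUnity ħ)
    {σ τ : U' R ħ →ₐ[Cu] Module.End Cu ((Cu ⊗[ℂ] V) ⊗[Cu] (Cu ⊗[ℂ] V'))}
    (hσ : IsFusion (extendScalars ρ) (extendScalars ρ') σ)
    (hτ : IsFusion (extendScalars ρ) (extendScalars ρ') τ) : τ = σ := by
  have key : (τ.restrictScalars ℂ).comp Algebra.TensorProduct.includeRight =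
      (σ.restrictScalars ℂ).comp Algebra.TensorProduct.includeRight := by
    refine U.algHom_ext' hq (fun ε i r => end_ext_tmul fun v v' => expand_injective fun n => ?_)
      (fun a => end_ext_tmul fun v v' => (hτ.k a v v').trans (hσ.k a v v').symm)
      (fun ε i n => end_ext_tmul fun v v' => ?_)
    · rcases Int.units_eq_one_or ε with rfl | rfl
      · exact ((hasUSum_plus_iff ρ ρ' i r v v' _).1 (hτ.x_plus i r v v') n).trans
          ((hasUSum_plus_iff ρ ρ' i r v v' _).1 (hσ.x_plus i r v v') n).symm
      · exact ((hasUSum_minus_iff ρ ρ' i r v v' _).1 (hτ.x_minus i r v v') n).trans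
          ((hasUSum_minus_iff ρ ρ' i r v v' _).1 (hσ.x_minus i r v v') n).symm
    · rcases lt_or_ge ((ε : ℤ) * n) 0 with hn | hn
      · rw [phi_eq_zero ε i n hn, map_zero, map_zero]
      · rw [exists_eq_units_mul_nat ε hn]
        exact (hτ.phi ε i _ v v').trans (hσ.phi ε i _ v v').symm
  refine Algebra.TensorProduct.ext (by ext) ?_
  exact key

variable (hq : NotRootOfUnity ħ) (hρ : IsMod ρ) (hρ' : IsMod ρ')

/-- The fused action of `U_q(ĝ)` on `i(V) ⊗ i(V')`. -/
def fusionAct : U R ħ →ₐ[ℂ] Module.End Cu ((Cu ⊗[ℂ] V) ⊗[Cu] (Cu ⊗[ℂ] V')) :=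
  (((TensorProduct.AlgebraTensorModule.distribBaseChange ℂ Cu V V').conjAlgEquiv Cu).toAlgHom.restrictScalars
    ℂ).comp (fuseAct hq hρ hρ')

theorem fusionAct_apply (g : U R ħ) (y : (Cu ⊗[ℂ] V) ⊗[Cu] (Cu ⊗[ℂ] V')) :
    fusionAct hq hρ hρ' g y = TensorProduct.AlgebraTensorModule.distribBaseChange ℂ Cu V V'
      (fuseAct hq hρ hρ' g
        ((TensorProduct.AlgebraTensorModule.distribBaseChange ℂ Cu V V').symm y)) := rfl

/-- The fusion module structure on `i(V) ⊗ i(V')`. -/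
def fusion : U' R ħ →ₐ[Cu] Module.End Cu ((Cu ⊗[ℂ] V) ⊗[Cu] (Cu ⊗[ℂ] V')) :=
  liftCu (fusionAct hq hρ hρ')

theorem fusion_inU' (g : U R ħ) : fusion hq hρ hρ' (inU' g) = fusionAct hq hρ hρ' g :=
  liftCu_one_tmul _ _

theorem expand_fusion (g : U R ħ) (n : ℤ) (v : V) (v' : V') :
    expand V V' n (fusion hq hρ hρ' (inU' g) ((1 ⊗ₜ v) ⊗ₜ[Cu] (1 ⊗ₜ v'))) =
      (fuseHom hq hρ hρ' g).coeff n (v ⊗ₜ v') := by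
  rw [fusion_inU', ← hcoeff_smul_one_tmul, ← toHahn_fuseAct, hcoeff_toHahn]
  have e : fusionAct hq hρ hρ' g (((1 : Cu) ⊗ₜ[ℂ] v) ⊗ₜ[Cu] ((1 : Cu) ⊗ₜ[ℂ] v')) =
      TensorProduct.AlgebraTensorModule.distribBaseChange ℂ Cu V V'
        (fuseAct hq hρ hρ' g (1 ⊗ₜ (v ⊗ₜ v'))) := by
    rw [fusionAct_apply, TensorProduct.AlgebraTensorModule.distribBaseChange_symm_tmul, mul_one]
  rw [e, expand_eq, LinearEquiv.symm_apply_apply]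

theorem isFusion_fusion :
    IsFusion (extendScalars ρ) (extendScalars ρ') (fusion hq hρ hρ') where
  x_plus i r v v' := by
    rw [hasUSum_plus_iff]
    intro n
    rw [expand_fusion, fuseHom, IsPreRep.lift_x]
  x_minus i r v v' := by
    rw [hasUSum_minus_iff]
    intro n
    rw [expand_fusion, fuseHom, IsPreRep.lift_x]
  phi ε i m v v' := by
    refine expand_injective fun n => ?_
    rw [expand_fusion, fuseHom, IsPreRep.lift_phi, ← fusePhi_apply_eq, map_sum, map_sum]
    refine Finset.sum_congr rfl fun s _ => ?_
    rw [extendScalars_inU'_tmul, extendScalars_inU'_tmul, expand_uPow_smul_tmul,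
      coeffMap_uPow_tmul]
  k a v v' := by
    refine expand_injective fun n => ?_
    rw [expand_fusion, fuseHom, IsPreRep.lift_k, coeff_fuseK, extendScalars_inU'_tmul,
      extendScalars_inU'_tmul, expand_tmul]
    split_ifs <;> simp

omit [Fintype ι] in
theorem laurentToCu_fusionWeight (Ψ Ψ' : ℤˣ → ι → ℕ → ℂ) (ε : ℤˣ) (i : ι) (m : ℕ) :
    laurentToCu (fusionWeight Ψ Ψ' ε i m) = ∑ s ∈ Finset.range (m + 1),
      algebraMap ℂ Cu (Ψ ε i (m - s) * Ψ' ε i s) * uPow ((ε : ℤ) * s) := by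
  rw [fusionWeight, map_sum]
  refine Finset.sum_congr rfl fun s _ => ?_
  rw [laurentToCu, LaurentPolynomial.eval₂_C_mul_T]
  simp [uPow]

theorem isLUHighestWeightVector_fusion {lam lam' : Module.Dual ℚ 𝔥} {Ψ Ψ' : ℤˣ → ι → ℕ → ℂ}
    {v : V} {v' : V'} (hv : IsLHighestWeightVector ρ lam Ψ v)
    (hv' : IsLHighestWeightVector ρ' lam' Ψ' v') :
    IsLUHighestWeightVector (fusion hq hρ hρ') (lam + lam') (fusionWeight Ψ Ψ')
      ((1 ⊗ₜ v) ⊗ₜ[Cu] (1 ⊗ₜ v')) where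
  isLUWeight ε i := by
    simp only [fusionWeight, zero_add, Finset.range_one, Finset.sum_singleton, Nat.sub_zero,
      Nat.cast_zero, mul_zero, LaurentPolynomial.T_zero, mul_one, hv.isLWeight.2, hv'.isLWeight.2,
      ← qpow_add, LinearMap.add_apply, mul_add]
  ne_zero h := by
    have := congrArg (expand V V' 0) h
    rw [expand_tmul, if_pos rfl, map_zero] at this
    exact tmul_ne_zero_of_ne_zero hv.ne_zero hv'.ne_zero this
  k_apply a := by
    rw [(isFusion_fusion hq hρ hρ').k, extendScalars_inU'_tmul, extendScalars_inU'_tmul,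
      hv.k_apply, hv'.k_apply]
    rw [one_tmul_smul, one_tmul_smul, TensorProduct.smul_tmul_smul, ← map_mul, ← qpow_add,
      LinearMap.add_apply]
  generates w := by
    let e := TensorProduct.AlgebraTensorModule.distribBaseChange ℂ Cu V V'
    -- N' is the cyclic submodule generated by the tensor of the highest weight vectors; it is
    -- transported to ℂ(u) ⊗ (V ⊗ V'), where the leading coefficient argument takes place.
    let N' : Submodule Cu ((Cu ⊗[ℂ] V) ⊗[Cu] (Cu ⊗[ℂ] V')) :=
      LinearMap.range ((LinearMap.applyₗ ((1 ⊗ₜ v) ⊗ₜ[Cu] (1 ⊗ₜ v'))) ∘ₗ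
        (fusion hq hρ hρ').toLinearMap)
    have htop : N'.comap e.toLinearMap = ⊤ := by
      refine eq_top_of_fuseAct_mem hq hρ hρ' hv hv' ?_ ⟨1, ?_⟩
      · rintro g y ⟨g₀, hg₀⟩
        refine ⟨inU' g * g₀, ?_⟩
        change fusion hq hρ hρ' (inU' g * g₀) _ = e (fuseAct hq hρ hρ' g y)
        change fusion hq hρ hρ' g₀ _ = e y at hg₀
        rw [map_mul, Module.End.mul_apply, hg₀, fusion_inU', fusionAct_apply,
          LinearEquiv.symm_apply_apply]
      · change fusion hq hρ hρ' 1 _ = e (1 ⊗ₜ (v ⊗ₜ v'))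
        rw [map_one]
        rfl
    obtain ⟨g, hg⟩ : e.symm w ∈ N'.comap e.toLinearMap := htop ▸ Submodule.mem_top
    exact ⟨g, hg.trans (e.apply_symm_apply w)⟩
  x_apply i r := by
    refine expand_injective fun n => ?_
    rw [expand_fusion, fuseHom, IsPreRep.lift_x, coeff_fuseX_one, map_zero]
    split_ifs <;> simp [hv.x_apply, hv'.x_apply]
  phi_apply ε i m := by
    rw [(isFusion_fusion hq hρ hρ').phi, laurentToCu_fusionWeight, Finset.sum_smul]
    refine Finset.sum_congr rfl fun s hs => ?_
    have hs' : s ≤ m := by simpa [Nat.lt_succ_iff] using hs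
    have e := hv.phi_apply ε i (m - s)
    rw [Nat.cast_sub hs'] at e
    rw [extendScalars_inU'_tmul, extendScalars_inU'_tmul, e, hv'.phi_apply,
      one_tmul_smul, one_tmul_smul, TensorProduct.smul_tmul_smul, ← map_mul, smul_smul, mul_comm]

end Fusion

/-! ### Representations of `U_q(sl̂_2)` with diagonal Cartan part -/

/-- The series is a product of two linear fractions, and logarithmic derivatives add. -/
theorem eulerD_of_quadratic_fractional {α₀ α₁ β₀ β₁ κ : ℂ} {ψ : PowerSeries ℂ}
    (h : (1 - PowerSeries.C α₀ * PowerSeries.X) * (1 - PowerSeries.C α₁ * PowerSeries.X) * ψ =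
      PowerSeries.C κ * (1 - PowerSeries.C β₀ * PowerSeries.X) *
        (1 - PowerSeries.C β₁ * PowerSeries.X)) :
    eulerD ψ = (PowerSeries.mk fun m => α₀ ^ m + α₁ ^ m - β₀ ^ m - β₁ ^ m) * ψ := by
  have hu : ∀ α : ℂ, (1 - PowerSeries.C α * PowerSeries.X) *
      (1 - PowerSeries.C α * PowerSeries.X)⁻¹ = 1 := fun α =>
    PowerSeries.mul_inv_cancel _ (by simp)
  set ψ₀ : PowerSeries ℂ := (1 - PowerSeries.C α₀ * PowerSeries.X)⁻¹ *
    (1 - PowerSeries.C β₀ * PowerSeries.X) with h0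
  set ψ₁ : PowerSeries ℂ := (1 - PowerSeries.C α₁ * PowerSeries.X)⁻¹ *
    (PowerSeries.C κ * (1 - PowerSeries.C β₁ * PowerSeries.X)) with h1
  have e0 : eulerD ψ₀ = (PowerSeries.mk fun m => α₀ ^ m - β₀ ^ m) * ψ₀ :=
    eulerD_of_linear_fractional (κ := 1) (by rw [h0, ← mul_assoc, hu]; simp)
  have e1 : eulerD ψ₁ = (PowerSeries.mk fun m => α₁ ^ m - β₁ ^ m) * ψ₁ :=
    eulerD_of_linear_fractional (κ := κ) (by rw [h1, ← mul_assoc, hu, one_mul])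
  have e : ψ = ψ₀ * ψ₁ := by
    calc ψ = (1 - PowerSeries.C α₀ * PowerSeries.X)⁻¹ * (1 - PowerSeries.C α₁ * PowerSeries.X)⁻¹ *
          ((1 - PowerSeries.C α₀ * PowerSeries.X) * (1 - PowerSeries.C α₁ * PowerSeries.X) * ψ) := by
          linear_combination (-ψ * ((1 - PowerSeries.C α₁ * PowerSeries.X) *
            (1 - PowerSeries.C α₁ * PowerSeries.X)⁻¹)) * hu α₀ - ψ * hu α₁
      _ = ψ₀ * ψ₁ := by rw [h, h0, h1]; ring
  have e2 : (PowerSeries.mk fun m => α₀ ^ m + α₁ ^ m - β₀ ^ m - β₁ ^ m) =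
      (PowerSeries.mk fun m => α₀ ^ m - β₀ ^ m) + PowerSeries.mk fun m => α₁ ^ m - β₁ ^ m := by
    ext m
    simp only [PowerSeries.coeff_mk, map_add]
    ring
  rw [e2, e, eulerD_mul, e0, e1]
  ring

/-- Over the denominator (1 - α₀ t)(1 - α₁ t) the series has a quadratic numerator with constant
term κ. The two hypotheses identify its other coefficients with those of κ (1 - β₀ t)(1 - β₁ t). -/
theorem eulerD_mk_geometric {α₀ α₁ β₀ β₁ γ₀ γ₁ κ : ℂ}
    (h₁ : κ * (α₀ + α₁) - γ₀ * α₀ - γ₁ * α₁ = κ * (β₀ + β₁))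
    (h₂ : (κ - (γ₀ + γ₁)) * (α₀ * α₁) = κ * (β₀ * β₁)) :
    eulerD (PowerSeries.mk fun m => if m = 0 then κ else γ₀ * α₀ ^ m + γ₁ * α₁ ^ m) =
      (PowerSeries.mk fun m => α₀ ^ m + α₁ ^ m - β₀ ^ m - β₁ ^ m) *
        PowerSeries.mk fun m => if m = 0 then κ else γ₀ * α₀ ^ m + γ₁ * α₁ ^ m := by
  refine eulerD_of_quadratic_fractional (κ := κ) ?_
  have hg : ∀ α : ℂ, (1 - PowerSeries.C α * PowerSeries.X) * (PowerSeries.mk fun m => α ^ m) = 1 := by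
    intro α
    ext m
    rcases m with _ | m
    · simp [sub_mul, mul_assoc]
    · rw [sub_mul, one_mul, mul_assoc, map_sub, PowerSeries.coeff_C_mul,
        PowerSeries.coeff_succ_X_mul]
      simp [PowerSeries.coeff_one, pow_succ, mul_comm]
  have e : (PowerSeries.mk fun m => if m = 0 then κ else γ₀ * α₀ ^ m + γ₁ * α₁ ^ m) =
      PowerSeries.C (κ - γ₀ - γ₁) + PowerSeries.C γ₀ * (PowerSeries.mk fun m => α₀ ^ m) +
        PowerSeries.C γ₁ * (PowerSeries.mk fun m => α₁ ^ m) := by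
    ext m
    rcases m with _ | m
    · simp only [PowerSeries.coeff_mk, map_add, PowerSeries.coeff_C_mul, pow_zero, if_true,
        PowerSeries.coeff_zero_C]
      ring
    · simp
  have h1 := congrArg (PowerSeries.C (R := ℂ)) h₁
  have h2 := congrArg (PowerSeries.C (R := ℂ)) h₂
  rw [e]
  simp only [map_sub, map_mul, map_add] at h1 h2 ⊢
  linear_combination (PowerSeries.C γ₀ * (1 - PowerSeries.C α₁ * PowerSeries.X)) * hg α₀ +
    (PowerSeries.C γ₁ * (1 - PowerSeries.C α₀ * PowerSeries.X)) * hg α₁ -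
      PowerSeries.X * h1 + PowerSeries.X ^ 2 * h2

/-- The data of an evaluation-type representation of `U_q(sl̂_2)` on a space with basis `n`. With
`Q = q²`, the basis vector `i` has weight `wt i`, the eigenvalue of `φ^ε_m` on it is
`ε (g₀ Q^{a₀ m} + g₁ Q^{a₁ m})`, that of `(q - q⁻¹) m h_m` is
`Q^{a₀ m} + Q^{a₁ m} - Q^{b₀ m} - Q^{b₁ m}`, and `x^ε_r` has the matrix entries `c Q^{e r}`. -/
structure EvalData (n : Type) where
  wt : n → ℤ
  a₀ : n → ℤ
  a₁ : n → ℤ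
  b₀ : n → ℤ
  b₁ : n → ℤ
  g₀ : n → ℂ
  g₁ : n → ℂ
  c : ℤˣ → n → n → ℂ
  e : ℤˣ → n → n → ℤ

namespace EvalData

variable {n : Type} [DecidableEq n] [Fintype n] (D : EvalData n) (ħ : ℂ)

def X (ε : ℤˣ) (r : ℤ) : Matrix n n ℂ :=
  Matrix.of fun i j => D.c ε i j * qpow ħ 2 ^ (D.e ε i j * r)

def K (a : ℚ) : Matrix n n ℂ := Matrix.diagonal fun i => qpow ħ (D.wt i * a)

/-- The eigenvalue of `(q - q⁻¹) m h_m`. -/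
def p (i : n) (m : ℤ) : ℂ := qpow ħ 2 ^ (D.a₀ i * m) + qpow ħ 2 ^ (D.a₁ i * m) -
  qpow ħ 2 ^ (D.b₀ i * m) - qpow ħ 2 ^ (D.b₁ i * m)

def H (m : ℤ) : Matrix n n ℂ :=
  Matrix.diagonal fun i => D.p ħ i m / ((qpow ħ 1 - qpow ħ (-1)) * m)

/-- The coefficient of `z ^ m` in `φ^+(z) - φ^-(z)`. -/
def g (i : n) (m : ℤ) : ℂ :=
  D.g₀ i * qpow ħ 2 ^ (D.a₀ i * m) + D.g₁ i * qpow ħ 2 ^ (D.a₁ i * m)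

/-- The eigenvalue of `φ^ε_m`. -/
def phiVal (ε : ℤˣ) (i : n) (m : ℤ) : ℂ :=
  if (ε : ℤ) * m < 0 then 0 else if m = 0 then qpow ħ 1 ^ ((ε : ℤ) * D.wt i)
    else ((ε : ℤ) : ℂ) * D.g ħ i m

def P (ε : ℤˣ) (m : ℤ) : Matrix n n ℂ := Matrix.diagonal fun i => D.phiVal ħ ε i m

/-- The conditions under which the data define a representation. -/
structure Valid : Prop where
  sum : ∀ i, D.g₀ i + D.g₁ i = qpow ħ 1 ^ D.wt i - qpow ħ 1 ^ (-D.wt i)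
  newton₁ : ∀ (ε : ℤˣ) i, qpow ħ 1 ^ ((ε : ℤ) * D.wt i) *
        (qpow ħ 2 ^ (D.a₀ i * ε) + qpow ħ 2 ^ (D.a₁ i * ε)) -
      ((ε : ℤ) : ℂ) * D.g₀ i * qpow ħ 2 ^ (D.a₀ i * ε) -
      ((ε : ℤ) : ℂ) * D.g₁ i * qpow ħ 2 ^ (D.a₁ i * ε) =
    qpow ħ 1 ^ ((ε : ℤ) * D.wt i) * (qpow ħ 2 ^ (D.b₀ i * ε) + qpow ħ 2 ^ (D.b₁ i * ε))
  newton₂ : ∀ (ε : ℤˣ) i, (qpow ħ 1 ^ ((ε : ℤ) * D.wt i) -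
        (((ε : ℤ) : ℂ) * D.g₀ i + ((ε : ℤ) : ℂ) * D.g₁ i)) *
      (qpow ħ 2 ^ (D.a₀ i * ε) * qpow ħ 2 ^ (D.a₁ i * ε)) =
    qpow ħ 1 ^ ((ε : ℤ) * D.wt i) * (qpow ħ 2 ^ (D.b₀ i * ε) * qpow ħ 2 ^ (D.b₁ i * ε))
  wt_eq : ∀ (ε : ℤˣ) i j, D.c ε i j ≠ 0 → D.wt i = D.wt j + 2 * (ε : ℤ)
  p_sub : ∀ (ε : ℤˣ) i j, D.c ε i j ≠ 0 → ∀ m : ℤ, D.p ħ i m - D.p ħ j m =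
    (qpow ħ 2 ^ ((ε : ℤ) * m) - qpow ħ 2 ^ (-((ε : ℤ) * m))) * qpow ħ 2 ^ (D.e ε i j * m)
  x_pm : ∀ r s, D.X ħ 1 r * D.X ħ (-1) s - D.X ħ (-1) s * D.X ħ 1 r =
    (qpow ħ 1 - qpow ħ (-1))⁻¹ • Matrix.diagonal fun i => D.g ħ i (r + s)
  x_x : ∀ (ε : ℤˣ) r s, D.X ħ ε (r + 1) * D.X ħ ε s -
      qpow ħ 2 ^ (ε : ℤ) • (D.X ħ ε r * D.X ħ ε (s + 1)) =
    qpow ħ 2 ^ (ε : ℤ) • (D.X ħ ε s * D.X ħ ε (r + 1)) - D.X ħ ε (s + 1) * D.X ħ ε r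

variable {D ħ}

omit [DecidableEq n] [Fintype n] in
theorem p_zero (i : n) : D.p ħ i 0 = 0 := by simp [p]

theorem hConst_mul_div (hq : NotRootOfUnity ħ) (η : ℤˣ) (y : ℂ) {m : ℕ} (hm : 0 < m) :
    hConst ħ η * (m * (y / ((qpow ħ 1 - qpow ħ (-1)) * (((η : ℤ) * m : ℤ) : ℂ)))) = y := by
  have h := hConst_ne_zero hq η
  have hm' : (m : ℂ) ≠ 0 := by exact_mod_cast hm.ne'
  have e : (qpow ħ 1 - qpow ħ (-1)) * (((η : ℤ) * m : ℤ) : ℂ) = hConst ħ η * m := by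
    rw [hConst]; push_cast; ring
  rw [e]
  field_simp

/-- Because the Cartan part is diagonal, the relations with k and h reduce to one scalar identity
per matrix entry. The Newton recursion becomes the statement that each eigenvalue of φ is the
expansion of a quadratic fraction with prescribed zeros and poles. -/
theorem isPreRep (hq : NotRootOfUnity ħ) (hD : D.Valid ħ) :
    IsPreRep sl2Realization ħ (fun ε _ r => D.X ħ ε r) (D.K ħ) (fun _ m => D.H ħ m)
      (fun ε _ m => D.P ħ ε m) where
  k_add a b := by
    simp only [K, Matrix.diagonal_mul_diagonal, ← qpow_add, mul_add]
  k_zero := by simp [K, qpow_zero]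
  k_h a _ m := by simp only [K, H, Matrix.diagonal_mul_diagonal, mul_comm]
  h_h _ _ m m' := by simp only [H, Matrix.diagonal_mul_diagonal, mul_comm]
  k_x a ε _ r := by
    ext i j
    simp only [K, X, Matrix.diagonal_mul, Matrix.smul_apply, Matrix.mul_diagonal, Matrix.of_apply,
      smul_eq_mul]
    by_cases hc : D.c ε i j = 0
    · simp [hc]
    · rw [hD.wt_eq ε i j hc]
      have : qpow ħ (((D.wt j + 2 * (ε : ℤ) : ℤ) : ℚ) * a) =
          qpow ħ ((ε : ℤ) * (sl2Realization.root () a)) * qpow ħ (D.wt j * a) := by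
        rw [← qpow_add]
        congr 1
        simp [sl2Realization]
        ring
      rw [this]
      ring
  phi_zero ε _ := by
    simp only [P, K, phiVal]
    congr 1
    ext i
    have : qpow ħ (D.wt i * ((((ε : ℤ) * ((sl2Datum.r () : ℕ) : ℤ)) • sl2Realization.coroot () : ℚ))) =
        qpow ħ 1 ^ ((ε : ℤ) * D.wt i) := by
      rw [← qpow_mul_int]
      congr 1
      simp [sl2Realization, sl2Datum]
      ring
    simpa using this.symm
  phi_neg ε _ m hm := by
    simp [P, phiVal, hm]
  newton ε _ := by
    have hs : ∀ i, eulerD (PowerSeries.mk fun m : ℕ => D.phiVal ħ ε i ((ε : ℤ) * m)) =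
        (PowerSeries.mk fun m : ℕ => D.p ħ i ((ε : ℤ) * m)) *
          PowerSeries.mk fun m : ℕ => D.phiVal ħ ε i ((ε : ℤ) * m) := by
      intro i
      have e1 : (PowerSeries.mk fun m : ℕ => D.phiVal ħ ε i ((ε : ℤ) * m)) =
          PowerSeries.mk fun m => if m = 0 then qpow ħ 1 ^ ((ε : ℤ) * D.wt i) else
            ((ε : ℤ) : ℂ) * D.g₀ i * (qpow ħ 2 ^ (D.a₀ i * ε)) ^ m +
            ((ε : ℤ) : ℂ) * D.g₁ i * (qpow ħ 2 ^ (D.a₁ i * ε)) ^ m := by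
        congr 1
        funext m
        have hm : ¬ (ε : ℤ) * ((ε : ℤ) * m) < 0 := by
          rw [units_mul_units_mul]; omega
        have hm' : (ε : ℤ) * m = 0 ↔ m = 0 := by simp
        simp only [phiVal, if_neg hm, hm', g, ← zpow_natCast, ← zpow_mul, mul_assoc]
        congr 1
        ring
      have e2 : (PowerSeries.mk fun m : ℕ => D.p ħ i ((ε : ℤ) * m)) =
          PowerSeries.mk fun m : ℕ => (qpow ħ 2 ^ (D.a₀ i * ε)) ^ m +
            (qpow ħ 2 ^ (D.a₁ i * ε)) ^ m - (qpow ħ 2 ^ (D.b₀ i * ε)) ^ m -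
            (qpow ħ 2 ^ (D.b₁ i * ε)) ^ m := by
        simp only [p, ← zpow_natCast, ← zpow_mul, mul_assoc]
      rw [e1, e2]
      exact eulerD_mk_geometric (hD.newton₁ ε i) (hD.newton₂ ε i)
    ext m i j
    rw [coeff_eulerD, PowerSeries.coeff_smul, PowerSeries.coeff_mul]
    by_cases hij : i = j
    · subst hij
      have e := congrArg (PowerSeries.coeff m) (hs i)
      rw [coeff_eulerD, PowerSeries.coeff_mul] at e
      simp only [PowerSeries.coeff_mk] at e
      simp only [coeff_halfSeries, coeff_eulerD, Matrix.smul_apply, Matrix.sum_apply, P, H,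
        Matrix.diagonal_mul_diagonal, Matrix.diagonal_apply_eq, smul_mul_assoc]
      rw [e, Finset.smul_sum]
      refine Finset.sum_congr rfl fun p _ => ?_
      rcases Nat.eq_zero_or_pos p.1 with hp | hp
      · simp [hp, p_zero]
      · have := hConst_mul_div hq ε (D.p ħ i ((ε : ℤ) * p.1)) hp
        simp only [smul_eq_mul] at this ⊢
        linear_combination -D.phiVal ħ ε i ((ε : ℤ) * p.2) * this
    · simp [P, H, Matrix.sum_apply, Matrix.diagonal_apply_ne _ hij]
  h_x η ε _ _ m r := by
    ext i j
    simp only [H, X, Matrix.diagonal_mul, Matrix.smul_apply, Matrix.mul_diagonal, Matrix.of_apply,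
      smul_eq_mul, Matrix.sub_apply]
    by_cases hc : D.c ε i j = 0
    · simp [hc]
    rcases Nat.eq_zero_or_pos m with rfl | hm
    · simp
    have := hD.p_sub ε i j hc ((η : ℤ) * m)
    have e := fun y => hConst_mul_div hq η y hm
    rw [show ∀ a b t : ℂ, hConst ħ η * m * (a / t * b - b * (D.p ħ j ((η : ℤ) * m) / t)) =
      hConst ħ η * (m * ((a - D.p ħ j ((η : ℤ) * m)) / t)) * b from fun a b t => by ring, e, this]
    have e1 : qpow ħ ((η : ℤ) * (ε : ℤ) * (sl2Datum.B () () : ℤ)) =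
        qpow ħ 2 ^ ((η : ℤ) * (ε : ℤ)) := by
      rw [← qpow_mul_int]
      congr 1
      simp [sl2Datum, CartanDatum.B]
      ring
    rw [e1, ← zpow_neg, ← zpow_natCast, ← zpow_natCast, ← zpow_mul, ← zpow_mul,
      mul_add (D.e ε i j), zpow_add₀ (qpow_ne_zero ħ 2),
      show (ε : ℤ) * ((η : ℤ) * m) = (η : ℤ) * ε * m by ring, neg_mul]
    ring
  x_pm_same _ r s := by
    rw [hD.x_pm]
    rw [P, P, Matrix.diagonal_sub]
    simp only [sl2Datum, Nat.cast_one]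
    congr 2
    funext i
    generalize r + s = t
    rcases lt_trichotomy t 0 with h | h | h
    · simp [phiVal, h, h.ne, h.not_gt]
    · simp [phiVal, h, g, hD.sum]
    · simp [phiVal, h.ne', h.not_gt, h]
  x_pm_ne i j hij := absurd rfl hij
  x_x ε _ _ r s := by
    have : qpow ħ ((ε : ℤ) * (sl2Datum.B () () : ℤ)) = qpow ħ 2 ^ (ε : ℤ) := by
      rw [← qpow_mul_int]
      congr 1
      simp [sl2Datum, CartanDatum.B]
      ring
    rw [this]
    exact hD.x_x ε r s

/-! ### The module of a valid set of data -/

/-- The representation on `n → ℂ`. -/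
def rep (hq : NotRootOfUnity ħ) (hD : D.Valid ħ) : Usl2 ħ →ₐ[ℂ] Module.End ℂ (n → ℂ) :=
  (Matrix.toLinAlgEquiv' (R := ℂ) (n := n)).toAlgHom.comp
    -- With a single node there is no pair of distinct indices, so the Serre relations are vacuous.
    ((isPreRep hq hD).lift fun _ i j hij => absurd (Subsingleton.elim i j) hij)

variable (hq : NotRootOfUnity ħ) (hD : D.Valid ħ)

theorem rep_x (ε : ℤˣ) (r : ℤ) : rep hq hD (x sl2Realization ħ ε () r) = (D.X ħ ε r).toLin' :=
  congrArg (Matrix.toLinAlgEquiv' (R := ℂ) (n := n)) ((isPreRep hq hD).lift_x _ ε () r)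

theorem rep_k (a : ℚ) : rep hq hD (k sl2Realization ħ a) = (D.K ħ a).toLin' :=
  congrArg (Matrix.toLinAlgEquiv' (R := ℂ) (n := n)) ((isPreRep hq hD).lift_k _ a)

theorem rep_phi (ε : ℤˣ) (m : ℤ) :
    rep hq hD (phi sl2Realization ħ ε () m) = (D.P ħ ε m).toLin' :=
  congrArg (Matrix.toLinAlgEquiv' (R := ℂ) (n := n)) ((isPreRep hq hD).lift_phi _ ε () m)

theorem single_mem_weightSpace (i : n) :
    Pi.single i 1 ∈ weightSpace (rep hq hD) ((D.wt i : ℚ) • LinearMap.id) := by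
  rw [mem_weightSpace]
  intro a
  rw [rep_k, K, Matrix.toLin'_apply]
  ext j
  rw [Matrix.mulVec_diagonal]
  rcases eq_or_ne j i with rfl | h
  · simp
  · simp [h]

end EvalData

/-- A finite dimensional module that is the sum of its weight spaces is in `Mod(U_q(ĝ))`. -/
theorem isMod_of_finite {ι : Type*} [Fintype ι] {𝔥 : Type*} [AddCommGroup 𝔥] [Module ℚ 𝔥]
    {A : CartanDatum ι} {R : Realization A 𝔥} {ħ : ℂ} (hq : NotRootOfUnity ħ)
    {V : Type*} [AddCommGroup V] [Module ℂ V] [Module.Finite ℂ V]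
    {ρ : U R ħ →ₐ[ℂ] Module.End ℂ V} (h : ⨆ ω, weightSpace ρ ω = ⊤) : IsMod ρ := by
  have hind : iSupIndep (weightSpace ρ) := by
    refine iSupIndep_of_qpow hq (fun a => ρ (k R ħ a)) (fun a b => ?_) _ fun ω e he a =>
      mem_weightSpace.1 he a
    have hk := (isPreRep_U R ħ).k_add
    rw [commute_iff_eq, ← map_mul, ← map_mul, hk, hk, add_comm]
  have hfin : {ω | weightSpace ρ ω ≠ ⊥}.Finite := WellFoundedGT.finite_ne_bot_of_iSupIndep hind
  refine ⟨hind, h, fun ω => inferInstance, fun ω i => ?_, hfin.toFinset, fun ω hω =>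
    ⟨ω, by simpa using hω, 0, by simp⟩⟩
  have hroot : R.root i ≠ 0 := fun h0 => R.root_indep.ne_zero i h0
  have hinj : ∀ c : ℚ, c ≠ 0 → Function.Injective fun r : ℕ => ω + (c * r) • R.root i := by
    intro c hc r s hrs
    have := smul_left_injective ℚ hroot (add_left_cancel hrs)
    exact_mod_cast mul_left_cancel₀ hc this
  have hN : ∀ c : ℚ, c ≠ 0 → ∃ N : ℕ, ∀ r : ℕ, N ≤ r →
      weightSpace ρ (ω + (c * r) • R.root i) = ⊥ := by
    intro c hc
    obtain ⟨N, hN⟩ := (hfin.preimage (hinj c hc).injOn).bddAbove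
    refine ⟨N + 1, fun r hr => ?_⟩
    by_contra hne
    have := hN (show r ∈ _ from hne)
    omega
  obtain ⟨N, h1⟩ := hN 1 one_ne_zero
  obtain ⟨N', h2⟩ := hN (-1) (by norm_num)
  refine ⟨max N N', fun r hr => ⟨?_, ?_⟩⟩
  · simpa [Nat.cast_smul_eq_nsmul] using h1 r (le_of_max_le_left hr)
  · simpa [Nat.cast_smul_eq_nsmul, sub_eq_add_neg] using h2 r (le_of_max_le_right hr)

theorem EvalData.isMod_rep {n : Type} [DecidableEq n] [Fintype n] {D : EvalData n} {ħ : ℂ}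
    (hq : NotRootOfUnity ħ) (hD : D.Valid ħ) : IsMod (EvalData.rep hq hD) := by
  refine isMod_of_finite hq (top_unique ?_)
  rw [← (Pi.basisFun ℂ n).span_eq, Submodule.span_le]
  rintro _ ⟨i, rfl⟩
  rw [Pi.basisFun_apply]
  exact Submodule.mem_iSup_of_mem _ (EvalData.single_mem_weightSpace hq hD i)

/-! ### The evaluation modules and their usual tensor product -/

theorem qpow_two (ħ : ℂ) : qpow ħ 2 = qpow ħ 1 ^ 2 := by
  rw [← qpow_nat_mul]; norm_num

theorem NotRootOfUnity.sq_sub_one_ne_zero {ħ : ℂ} (hq : NotRootOfUnity ħ) :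
    qpow ħ 1 ^ 2 - 1 ≠ 0 := sub_ne_zero.2 (hq 2 two_pos)

theorem NotRootOfUnity.sq_add_one_ne_zero {ħ : ℂ} (hq : NotRootOfUnity ħ) :
    qpow ħ 1 ^ 2 + 1 ≠ 0 := fun h =>
  hq 4 (by norm_num) (by linear_combination (qpow ħ 1 ^ 2 - 1) * h)

/-- The evaluation module of dimension 2 at the point `q ^ (2 c)`. -/
def evalTwo (ħ : ℂ) (c : ℤ) : EvalData (Fin 2) where
  wt := ![1, -1]
  a₀ := fun _ => c
  a₁ := fun _ => 0
  b₀ := ![c - 1, c + 1]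
  b₁ := fun _ => 0
  g₀ := ![qpow ħ 1 - (qpow ħ 1)⁻¹, (qpow ħ 1)⁻¹ - qpow ħ 1]
  g₁ := fun _ => 0
  c := fun ε => if ε = 1 then !![0, 1; 0, 0] else !![0, 0; 1, 0]
  e := fun _ _ _ => c

theorem evalTwo_valid {ħ : ℂ} (hq : NotRootOfUnity ħ) (c : ℤ) : (evalTwo ħ c).Valid ħ := by
  have h0 := qpow_ne_zero ħ 1
  have h1 := hq.sq_sub_one_ne_zero
  have hc : ∀ z : ℤ, (qpow ħ 1 ^ 2) ^ z ≠ 0 := fun z => zpow_ne_zero _ (pow_ne_zero 2 h0)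
  have hQ := pow_ne_zero 2 h0
  constructor
  · intro i
    fin_cases i <;> simp [evalTwo]
  · intro ε i
    rw [qpow_two]
    have := hc c
    rcases Int.units_eq_one_or ε with rfl | rfl <;> fin_cases i <;>
      simp [evalTwo, zpow_sub₀ hQ, zpow_add₀ hQ] <;> field_simp <;> ring
  · intro ε i
    rw [qpow_two]
    have := hc c
    rcases Int.units_eq_one_or ε with rfl | rfl <;> fin_cases i <;>
      simp [evalTwo, zpow_sub₀ hQ, zpow_add₀ hQ] <;> field_simp
  · intro ε i j
    rcases Int.units_eq_one_or ε with rfl | rfl <;> fin_cases i <;> fin_cases j <;>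
      simp [evalTwo]
  · intro ε i j h m
    rw [EvalData.p, EvalData.p, qpow_two]
    have := hc m
    have := hc (c * m)
    rcases Int.units_eq_one_or ε with rfl | rfl <;> fin_cases i <;> fin_cases j <;>
      simp [evalTwo] at h ⊢ <;>
      simp [sub_mul, add_mul, zpow_sub₀ hQ, zpow_add₀ hQ] <;> field_simp
  · intro r s
    rw [qpow_neg]
    ext i j
    fin_cases i <;> fin_cases j <;>
      simp [evalTwo, EvalData.X, EvalData.g, qpow_two, Matrix.mul_apply, mul_add, zpow_add₀ hQ] <;>
      field_simp <;> ring
  · intro ε r s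
    ext i j
    rcases Int.units_eq_one_or ε with rfl | rfl <;> fin_cases i <;> fin_cases j <;>
      simp [evalTwo, EvalData.X, Matrix.mul_apply]

/-- The tensor product of the evaluation modules at `1` and `q²`, in the basis
`v₀ ⊗ v₀`, `q⁻¹ v₁ ⊗ v₀ + v₀ ⊗ v₁`, `v₁ ⊗ v₀`, `v₁ ⊗ v₁`. -/
def evalFour (ħ : ℂ) : EvalData (Fin 4) where
  wt := ![2, 0, 0, -2]
  a₀ := ![1, 0, 0, 0]
  a₁ := ![0, 1, 0, 0]
  b₀ := ![-1, -1, 0, 2]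
  b₁ := ![0, 2, 0, 0]
  g₀ := ![qpow ħ 1 ^ 2 - (qpow ħ 1 ^ 2)⁻¹, qpow ħ 1 ^ 2 - (qpow ħ 1 ^ 2)⁻¹, 0,
    (qpow ħ 1 ^ 2)⁻¹ - qpow ħ 1 ^ 2]
  g₁ := ![0, (qpow ħ 1 ^ 2)⁻¹ - qpow ħ 1 ^ 2, 0, 0]
  -- In both matrices the row of index 2 is zero, so no mode x^±_r has a component along v₁ ⊗ v₀ in
  -- its image.
  c := fun ε => if ε = 1 then
      !![0, qpow ħ 1 + (qpow ħ 1)⁻¹, 1, 0; 0, 0, 0, 1; 0, 0, 0, 0; 0, 0, 0, 0]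
    else !![0, 0, 0, 0; 1, 0, 0, 0; 0, 0, 0, 0; 0, qpow ħ 1 + (qpow ħ 1)⁻¹, 1, 0]
  e := fun ε => if ε = 1 then !![0, 1, 0, 0; 0, 0, 0, 0; 0, 0, 0, 0; 0, 0, 0, 0]
    else !![0, 0, 0, 0; 1, 0, 0, 0; 0, 0, 0, 0; 0, 0, 1, 0]

theorem evalFour_valid {ħ : ℂ} (hq : NotRootOfUnity ħ) : (evalFour ħ).Valid ħ := by
  have h0 := qpow_ne_zero ħ 1
  have h1 := hq.sq_sub_one_ne_zero
  have hc : ∀ z : ℤ, (qpow ħ 1 ^ 2) ^ z ≠ 0 := fun z => zpow_ne_zero _ (pow_ne_zero 2 h0)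
  have hQ := pow_ne_zero 2 h0
  have hz : ∀ z : ℤ, (qpow ħ 1 ^ 2) ^ (2 * z) = ((qpow ħ 1 ^ 2) ^ z) ^ 2 := fun z => by
    rw [mul_comm, zpow_mul]; rfl
  have hp1 : qpow ħ 1 ^ (-2 : ℤ) = (qpow ħ 1 ^ 2)⁻¹ := by rw [zpow_neg]; rfl
  have hp2 : qpow ħ 1 ^ (2 : ℤ) = qpow ħ 1 ^ 2 := rfl
  have hp3 : (qpow ħ 1 ^ 2) ^ (-2 : ℤ) = ((qpow ħ 1 ^ 2) ^ 2)⁻¹ := by rw [zpow_neg]; rfl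
  have hp4 : (qpow ħ 1 ^ 2) ^ (2 : ℤ) = (qpow ħ 1 ^ 2) ^ 2 := rfl
  constructor
  · intro i
    fin_cases i <;> simp [evalFour, hp1, hp2]
  · intro ε i
    rw [qpow_two]
    rcases Int.units_eq_one_or ε with rfl | rfl <;> fin_cases i <;>
      simp [evalFour, hp1, hp2, hp3, hp4] <;> field_simp <;> ring
  · intro ε i
    rw [qpow_two]
    rcases Int.units_eq_one_or ε with rfl | rfl <;> fin_cases i <;>
      simp [evalFour, hp1, hp2, hp3, hp4] <;> field_simp
  · intro ε i j
    rcases Int.units_eq_one_or ε with rfl | rfl <;> fin_cases i <;> fin_cases j <;>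
      simp [evalFour]
  · intro ε i j h m
    rw [EvalData.p, EvalData.p, qpow_two]
    have := hc m
    rcases Int.units_eq_one_or ε with rfl | rfl <;> fin_cases i <;> fin_cases j <;>
      simp [evalFour, hz] at h ⊢ <;> field_simp <;> ring
  · intro r s
    rw [qpow_neg]
    ext i j
    fin_cases i <;> fin_cases j <;>
      simp [evalFour, EvalData.X, EvalData.g, qpow_two, Matrix.mul_apply, Fin.sum_univ_succ,
        zpow_add₀ hQ] <;>
      field_simp <;> ring
  · intro ε r s
    ext i j
    rcases Int.units_eq_one_or ε with rfl | rfl <;> fin_cases i <;> fin_cases j <;>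
      simp [evalFour, EvalData.X, Matrix.mul_apply, Fin.sum_univ_succ, qpow_two,
        zpow_add₀ hQ] <;> field_simp <;> ring

/-! ### The counterexample for the usual tensor product -/

section

variable {ħ : ℂ} (hq : NotRootOfUnity ħ)

theorem isLHighestWeight_evalTwo (c : ℤ) :
    IsLHighestWeight (EvalData.rep hq (evalTwo_valid hq c)) := by
  refine ⟨LinearMap.id, fun ε _ m => (evalTwo ħ c).phiVal ħ ε 0 ((ε : ℤ) * m), Pi.single 0 1,
    ⟨fun _ => ⟨1, by simp [sl2Realization]⟩, fun ε _ => ?_⟩, by simp, fun a => ?_, fun w => ?_,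
    fun _ r => ?_, fun ε _ m => ?_⟩
  · rw [show ((ε : ℤ) : ℚ) * (((sl2Datum.r () : ℕ) : ℚ) * LinearMap.id (sl2Realization.coroot ())) =
      1 * (ε : ℤ) by simp [sl2Datum, sl2Realization], qpow_mul_int]
    simp [EvalData.phiVal, evalTwo]
  · simpa [evalTwo] using
      mem_weightSpace.1 (EvalData.single_mem_weightSpace hq (evalTwo_valid hq c) 0) a
  · refine ⟨algebraMap ℂ _ (w 0) + w 1 • x sl2Realization ħ (-1) () 0, ?_⟩
    rw [map_add, map_smul, AlgHom.commutes, EvalData.rep_x]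
    ext i
    fin_cases i <;> simp [EvalData.X, evalTwo, Matrix.toLin'_apply]
  · rw [EvalData.rep_x]
    ext i
    fin_cases i <;> simp [EvalData.X, evalTwo, Matrix.toLin'_apply, Matrix.mulVec, dotProduct]
  · rw [EvalData.rep_phi]
    ext i
    fin_cases i <;> simp [EvalData.P, evalTwo, Matrix.toLin'_apply, Matrix.mulVec_diagonal]

/-- The coordinates on `ℂ² ⊗ ℂ²` in the basis of `evalFour`. -/
def tensorCoord (ħ : ℂ) : ((Fin 2 → ℂ) ⊗[ℂ] (Fin 2 → ℂ)) ≃ₗ[ℂ] (Fin 4 → ℂ) :=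
  LinearEquiv.ofLinearMap
    (TensorProduct.lift (LinearMap.mk₂ ℂ
      (fun a b => ![a 0 * b 0, a 0 * b 1, a 1 * b 0 - (qpow ħ 1)⁻¹ * (a 0 * b 1), a 1 * b 1])
      (fun a a' b => by ext i; fin_cases i <;> simp <;> ring)
      (fun c a b => by ext i; fin_cases i <;> simp <;> ring)
      (fun a b b' => by ext i; fin_cases i <;> simp <;> ring)
      (fun c a b => by ext i; fin_cases i <;> simp <;> ring)))
    ((LinearMap.proj 0).smulRight (Pi.single 0 1 ⊗ₜ Pi.single 0 1) +
      (LinearMap.proj 1).smulRight ((qpow ħ 1)⁻¹ • (Pi.single 1 1 ⊗ₜ Pi.single 0 1) +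
        Pi.single 0 1 ⊗ₜ Pi.single 1 1) +
      (LinearMap.proj 2).smulRight (Pi.single 1 1 ⊗ₜ Pi.single 0 1) +
      (LinearMap.proj 3).smulRight (Pi.single 1 1 ⊗ₜ Pi.single 1 1))
    (by
      refine LinearMap.ext fun z => funext fun i => ?_
      fin_cases i <;> simp)
    (by
      refine TensorProduct.ext ((Pi.basisFun ℂ (Fin 2)).ext fun i =>
        (Pi.basisFun ℂ (Fin 2)).ext fun j => ?_)
      fin_cases i <;> fin_cases j <;> simp [smul_add, ← smul_assoc])

theorem tensorCoord_tmul (a b : Fin 2 → ℂ) : tensorCoord ħ (a ⊗ₜ b) =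
    ![a 0 * b 0, a 0 * b 1, a 1 * b 0 - (qpow ħ 1)⁻¹ * (a 0 * b 1), a 1 * b 1] := by
  simp [tensorCoord]

/-- The usual tensor product of the evaluation modules at `1` and `q²`. -/
def usualTensor : Usl2 ħ →ₐ[ℂ] Module.End ℂ ((Fin 2 → ℂ) ⊗[ℂ] (Fin 2 → ℂ)) :=
  ((tensorCoord ħ).symm.conjAlgEquiv ℂ).toAlgHom.comp (EvalData.rep hq (evalFour_valid hq))

theorem tensorCoord_usualTensor (g : Usl2 ħ) (z : (Fin 2 → ℂ) ⊗[ℂ] (Fin 2 → ℂ)) :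
    tensorCoord ħ (usualTensor hq g z) =
      EvalData.rep hq (evalFour_valid hq) g (tensorCoord ħ z) := by
  simp [usualTensor, LinearEquiv.conjAlgEquiv_apply]

theorem usualTensor_ext {f : Module.End ℂ ((Fin 2 → ℂ) ⊗[ℂ] (Fin 2 → ℂ))} {g : Usl2 ħ}
    (h : ∀ a b, EvalData.rep hq (evalFour_valid hq) g (tensorCoord ħ (a ⊗ₜ b)) =
      tensorCoord ħ (f (a ⊗ₜ b))) : usualTensor hq g = f := by
  refine TensorProduct.ext' fun a b => (tensorCoord ħ).injective ?_
  rw [tensorCoord_usualTensor, h]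

/-- The four dimensional module is given by its Drinfeld modes, so it is a module of the Drinfeld
algebra from the start. Only the finitely many Drinfeld-Jimbo generators and the k_a remain to be
compared with the coproduct, in the coordinates `tensorCoord`. -/
theorem isUsualTensor_usualTensor : IsUsualTensor (EvalData.rep hq (evalTwo_valid hq 0))
    (EvalData.rep hq (evalTwo_valid hq 1)) (usualTensor hq) := by
  have h0 := qpow_ne_zero ħ 1
  constructor
  · intro t
    refine usualTensor_ext hq fun a b => ?_
    have e1 : qpow ħ (2 * t) = qpow ħ t * qpow ħ t := by rw [← qpow_add]; ring_nf
    have e2 : qpow ħ (-(2 * t)) = qpow ħ (-t) * qpow ħ (-t) := by rw [← qpow_add]; ring_nf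
    have e3 : qpow ħ t ≠ 0 := qpow_ne_zero ħ t
    simp only [TensorProduct.map_tmul, tensorCoord_tmul, EvalData.rep_k]
    ext i
    fin_cases i <;> simp [EvalData.K, evalTwo, evalFour, Matrix.mulVec_diagonal, e1, e2, qpow_neg,
      qpow_zero] <;> field_simp
  · refine usualTensor_ext hq fun a b => ?_
    simp only [TensorProduct.map_tmul, LinearMap.add_apply, map_add, tensorCoord_tmul,
      EvalData.rep_k, EvalData.rep_x, k1]
    ext i
    fin_cases i <;> simp [EvalData.K, EvalData.X, evalTwo, evalFour, Matrix.mulVec,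
      dotProduct, Fin.sum_univ_succ, qpow_neg] <;> field_simp <;> ring
  · refine usualTensor_ext hq fun a b => ?_
    simp only [TensorProduct.map_tmul, LinearMap.add_apply, map_add, tensorCoord_tmul,
      EvalData.rep_k, EvalData.rep_x, k1]
    ext i
    fin_cases i <;> simp [EvalData.K, EvalData.X, evalTwo, evalFour, Matrix.mulVec,
      dotProduct, Fin.sum_univ_succ, qpow_neg] <;> field_simp <;> ring
  · refine usualTensor_ext hq fun a b => ?_
    simp only [TensorProduct.map_tmul, LinearMap.add_apply, map_add, tensorCoord_tmul,
      EvalData.rep_k, EvalData.rep_x, k1, e0, map_mul, Module.End.mul_apply]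
    ext i
    fin_cases i <;> simp [EvalData.K, EvalData.X, evalTwo, evalFour, Matrix.mulVec,
      dotProduct, Fin.sum_univ_succ, qpow_neg, qpow_zero, qpow_two] <;> field_simp <;> ring
  · refine usualTensor_ext hq fun a b => ?_
    simp only [TensorProduct.map_tmul, LinearMap.add_apply, map_add, tensorCoord_tmul,
      EvalData.rep_k, EvalData.rep_x, k1, f0, map_mul, Module.End.mul_apply]
    ext i
    fin_cases i <;> simp [EvalData.K, EvalData.X, evalTwo, evalFour, Matrix.mulVec,
      dotProduct, Matrix.vecHead, Matrix.vecTail, Fin.sum_univ_succ, qpow_neg, qpow_zero, qpow_two] <;> field_simp <;> ring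

/-- The hyperplane spanned by all basis vectors of `evalFour` but `v₁ ⊗ v₀` is a submodule. -/
theorem rep_evalFour_apply_two (g : Usl2 ħ) (z : Fin 4 → ℂ) (hz : z 2 = 0) :
    EvalData.rep hq (evalFour_valid hq) g z 2 = 0 := by
  let S : Subalgebra ℂ (Usl2 ħ) :=
    { carrier := {g | ∀ z : Fin 4 → ℂ, z 2 = 0 → EvalData.rep hq (evalFour_valid hq) g z 2 = 0}
      mul_mem' := fun ha hb z hz => by
        rw [map_mul, Module.End.mul_apply]; exact ha _ (hb z hz)
      add_mem' := fun ha hb z hz => by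
        rw [map_add, LinearMap.add_apply, Pi.add_apply, ha z hz, hb z hz, add_zero]
      algebraMap_mem' := fun c z hz => by simp [hz] }
  have hS : S = ⊤ := by
    refine U.subalgebra_eq_top hq S (fun ε i r z hz => ?_) (fun a z hz => ?_) fun ε i m z hz => ?_
    · rw [EvalData.rep_x]
      rcases Int.units_eq_one_or ε with rfl | rfl <;>
        simp [EvalData.X, evalFour, Matrix.mulVec, dotProduct, Fin.sum_univ_succ]
    · rw [EvalData.rep_k]
      simp [EvalData.K, Matrix.mulVec_diagonal, hz]
    · rw [EvalData.rep_phi]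
      simp [EvalData.P, Matrix.mulVec_diagonal, hz]
  exact (hS ▸ Algebra.mem_top : g ∈ S) z hz

/-- Vanishing under x^+_0 and x^+_1 forces an l-highest weight vector into the stable hyperplane,
where it cannot generate v₁ ⊗ v₀. -/
theorem not_isLHighestWeight_usualTensor : ¬ IsLHighestWeight (usualTensor hq) := by
  rintro ⟨lam, Ψ, v, hv⟩
  have hx : ∀ r, ((evalFour ħ).X ħ 1 r).mulVec (tensorCoord ħ v) = 0 := fun r => by
    rw [← Matrix.toLin'_apply, ← EvalData.rep_x hq (evalFour_valid hq), ← tensorCoord_usualTensor,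
      hv.x_apply, map_zero]
  set u := tensorCoord ħ v
  have e0 := congrFun (hx 0) 0
  have e1 := congrFun (hx 1) 0
  simp [EvalData.X, evalFour, Matrix.mulVec, dotProduct, Fin.sum_univ_succ, qpow_two] at e0 e1
  have h0 := qpow_ne_zero ħ 1
  -- The first coordinates of x^+_0 and x^+_1 applied to the vector are (q + q⁻¹) u₁ + u₂ and (q +
  -- q⁻¹) q² u₁ + u₂. Their difference, multiplied by q, is (q² + 1)(q² - 1) u₁, and both factors
  -- are nonzero since q is not a root of unity.
  have hu1 : u 1 = 0 := by
    have h : (qpow ħ 1 ^ 2 + 1) * (qpow ħ 1 ^ 2 - 1) * u 1 = 0 := by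
      field_simp at e0 e1
      linear_combination qpow ħ 1 * e1 - e0
    simpa [hq.sq_add_one_ne_zero, hq.sq_sub_one_ne_zero] using h
  have hu2 : u 2 = 0 := by simpa [hu1] using e0
  obtain ⟨g, hg⟩ := hv.generates ((tensorCoord ħ).symm (Pi.single 2 1))
  have h := rep_evalFour_apply_two hq g u hu2
  rw [← tensorCoord_usualTensor, hg] at h
  simp at h

end

end QuantumFusion

end

open QuantumFusion in
theorem theorem6p2 (ħ : ℂ) (hq : NotRootOfUnity ħ) :
    (∀ (ι : Type*) [Fintype ι] (𝔥 : Type*) [AddCommGroup 𝔥] [Module ℚ 𝔥]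
        (A : CartanDatum ι) (R : Realization A 𝔥)
        (V : Type*) [AddCommGroup V] [Module ℂ V] (V' : Type*) [AddCommGroup V'] [Module ℂ V']
        (ρ : U R ħ →ₐ[ℂ] Module.End ℂ V) (ρ' : U R ħ →ₐ[ℂ] Module.End ℂ V'),
        IsMod ρ → IsMod ρ' → IsLHighestWeight ρ → IsLHighestWeight ρ' →
        ∃ σ : U' R ħ →ₐ[Cu] Module.End Cu ((Cu ⊗[ℂ] V) ⊗[Cu] (Cu ⊗[ℂ] V')),
          IsFusion (extendScalars ρ) (extendScalars ρ') σ ∧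
          (∀ τ, IsFusion (extendScalars ρ) (extendScalars ρ') τ → τ = σ) ∧
          IsLUHighestWeight σ ∧
          ∀ lam Ψ v lam' Ψ' v',
            IsLHighestWeightVector ρ lam Ψ v → IsLHighestWeightVector ρ' lam' Ψ' v' →
            IsLUHighestWeightVector σ (lam + lam') (fusionWeight Ψ Ψ')
              ((1 ⊗ₜ v) ⊗ₜ[Cu] (1 ⊗ₜ v'))) ∧
    (∃ (V : Type) (_ : AddCommGroup V) (_ : Module ℂ V)
        (V' : Type) (_ : AddCommGroup V') (_ : Module ℂ V')
        (ρ : Usl2 ħ →ₐ[ℂ] Module.End ℂ V) (ρ' : Usl2 ħ →ₐ[ℂ] Module.End ℂ V')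
        (τ : Usl2 ħ →ₐ[ℂ] Module.End ℂ (V ⊗[ℂ] V')),
        IsMod ρ ∧ IsMod ρ' ∧ IsLHighestWeight ρ ∧ IsLHighestWeight ρ' ∧
          IsUsualTensor ρ ρ' τ ∧ ¬ IsLHighestWeight τ) := by
  refine ⟨?_, Fin 2 → ℂ, inferInstance, inferInstance, Fin 2 → ℂ, inferInstance, inferInstance,
    EvalData.rep hq (evalTwo_valid hq 0), EvalData.rep hq (evalTwo_valid hq 1), usualTensor hq,
    EvalData.isMod_rep hq _, EvalData.isMod_rep hq _, isLHighestWeight_evalTwo hq 0,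
    isLHighestWeight_evalTwo hq 1, isUsualTensor_usualTensor hq,
    not_isLHighestWeight_usualTensor hq⟩
  intro ι _ 𝔥 _ _ A R V _ _ V' _ _ ρ ρ' hρ hρ' hl hl'
  obtain ⟨lam, Ψ, v, hv⟩ := hl
  obtain ⟨lam', Ψ', v', hv'⟩ := hl'
  exact ⟨fusion hq hρ hρ', isFusion_fusion hq hρ hρ',
    fun τ hτ => (isFusion_fusion hq hρ hρ').unique hq hτ,
    ⟨_, _, _, isLUHighestWeightVector_fusion hq hρ hρ' hv hv'⟩,
    fun _ _ _ _ _ _ hw hw' => isLUHighestWeightVector_fusion hq hρ hρ' hw hw'⟩
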